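/- **Setting.** Let $d\ge 1$, $Q=(0,1)^d$, $a_{\min},a_{\max}>0$. For $A>0$ let $\mathrm{Hol}(\Omega;A)$ be the set of real analytic functions on $\mathbb R^d$ with period one in every coordinate and $\|v\|_{W^{k,\infty}(Q)}\le A^{k+1}k!$ for all $k\ge 0$. Let $\mathcal D\subset \mathrm{Hol}(\Omega;A_{\mathcal D})$, $A_{\mathcal D}>0$, satisfy $a_{\min}\le a\le a_{\max}$ on $Q$ for all $a\in\mathcal D$. Put $C_{\mathrm{coer}}=\min(a_{\min},1)$, $C_{\mathrm{cont}}=\max(a_{\max},1)$, $\alpha=1/(C_{\mathrm{coer}}+C_{\mathrm{cont}})$, $\delta=\alpha C_{\mathrm{coer}}$. Let $L_i$ be the Legendre polynomials on $(0,1)$ with $L_i(1)=1$, and $\phi^{1d}_0=L_0$, $\phi^{1d}_{2i-1}=L_{2i}$, $\phi^{1d}_{2i}=L_{2i+1}-L_1$ for $i\ge1$. For an integer $p\ge2$ let $n_b=p^d-1$ and $\phi_{i_1+p i_2+\dots+p^{d-1}i_d}=\phi^{1d}_{i_1}\otimes\dots\otimes\phi^{1d}_{i_d}$ for $(i_1,\dots,i_d)\in\{0,\dots,p-1\}^d$.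 Let $q=p+1$, $n_q=q^d$, let $x_k,w_k$ $(1\le k\le n_q)$ be the nodes and weights of the tensor product $q$-point Gauss–Lobatto rule on $[0,1]^d$, $\boldsymbol a=(a(x_k))_k\in\mathbb R^{n_q}$, $$[\mathbf A^a]_{ij}=\sum_{k=1}^{n_q}w_k\,a(x_k)\,\nabla\phi_j(x_k)\cdot\nabla\phi_i(x_k),\quad 1\le i,j\le n_b,\qquad \widetilde{\mathbf A}^a=(\mathbf A^1)^{-1}\mathbf A^a .$$ A ReLU network is a finite sequence of pairs (matrix, bias) with positive layer widths; its realization $\mathrm R(\Phi)$ applies $x\mapsto\max(0,x)$ componentwise after every layer but the last, its depth is the number of layers and its size the number of nonzero weights and biases. $\Phi^1\bullet\Phi^2$ is the concatenation in which the last layer of $\Phi^2$ and the first layer of $\Phi^1$ are merged, and $\Phi^1\odot\Phi^2=\Phi^1\bullet\Phi^{\mathrm{Id}}\bullet\Phi^2$ the sparse concatenation, with $\Phi^{\mathrm{Id}}$ the two-layer network $x\mapsto\max(0,x)-\max(0,-x)$. Let $\mathrm{vec}$ be column-stacking vectorization, $\mathrm{matr}$ its inverse, and $\|\cdot\|_2$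 the spectral norm. Let $\Phi^{A,\alpha}$ be the one-layer linear network with zero bias whose $k$-th column is $-\alpha\,\mathrm{vec}\big((w_k\nabla\phi_i(x_k)\cdot\nabla\phi_j(x_k))_{ij}\big)$, and $$\Phi^{\widetilde A,\mathrm{Id},\alpha}=\big((\mathbf{Id}_{n_b}\otimes(\mathbf A^1)^{-1},\mathrm{vec}(\mathbf{Id}_{n_b}))\big)\odot\Phi^{A,\alpha},$$ which maps $\boldsymbol a$ to $\mathrm{vec}(\mathbf{Id}_{n_b}-\alpha\widetilde{\mathbf A}^a)$. **Proposition.** There is a constant $C_{\mathrm{inv},A}>0$, depending only on $d,a_{\min},a_{\max}$, such that for all integers $p\ge 2$ and all $\epsilon_{\mathrm{inv}}\in(0,1)$ there is an inversion network $\Psi$ with $n_b^2$-dimensional input and output and $$\|(\mathbf{Id}_{n_b}-\mathbf B)^{-1}-\mathrm{matr}(\mathrm R(\Psi)(\mathrm{vec}(\mathbf B)))\|_2\le \epsilon_{\mathrm{inv}}/\alpha\qquad\text{for all }\mathbf B\in\mathbb R^{n_b\times n_b}\text{ with }\|\mathbf B\|_2\le 1-\delta,$$ such that the network $$\Phi=\big((\alpha\mathbf{Id}_{n_b^2},\mathbf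 0_{n_b^2})\big)\bullet\Psi\odot\Phi^{\widetilde A,\mathrm{Id},\alpha}$$ has the following properties: for every $a\in\mathcal D$ the matrix $\widetilde{\mathbf A}^a$ is invertible, $$\sup_{a\in\mathcal D}\big\|(\widetilde{\mathbf A}^a)^{-1}-\mathrm{matr}(\mathrm R(\Phi)(\boldsymbol a))\big\|_2\le\epsilon_{\mathrm{inv}},$$ and, with $\ell=|\log\epsilon_{\mathrm{inv}}|$, $$\mathrm{depth}(\Phi)\le C_{\mathrm{inv},A}\,[1+\log(1+\ell)+\log n_b]\,[1+\ell+\log n_b+\log(1+\ell)],$$ $$\mathrm{size}(\Phi)\le C_{\mathrm{inv},A}\,n_b^3\,[1+\ell]\,[1+\log(1+\ell)+\log n_b]^2\,[1+\ell+\log n_b+\log(1+\ell)].$$ -/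

import Mathlib

open scoped Matrix.Norms.L2Operator Kronecker Polynomial

noncomputable section

/-! ## ReLU networks -/

/-- A feed-forward network with input dimension `m` and output dimension `n`: a nonempty list of
pairs (weight matrix, bias vector) of compatible sizes, the first layer being listed first. -/
inductive NN : ℕ → ℕ → Type
  | last {m n : ℕ} (A : Matrix (Fin n) (Fin m) ℝ) (b : Fin n → ℝ) : NN m n
  | cons {m k n : ℕ} (A : Matrix (Fin k) (Fin m) ℝ) (b : Fin k → ℝ) (rest : NN k n) : NN m n

/-- The number of nonzero entries of a vector. -/
def nnzVec {n : ℕ} (b : Fin n → ℝ) : ℕ := (Finset.univ.filter fun i => b i ≠ 0).card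

/-- The number of nonzero entries of a matrix. -/
def nnzMat {m n : ℕ} (A : Matrix (Fin n) (Fin m) ℝ) : ℕ :=
  (Finset.univ.filter fun ij : Fin n × Fin m => A ij.1 ij.2 ≠ 0).card

namespace NN

/-- The realization: affine maps with the ReLU `max 0` after every layer except the last. -/
def realize : {m n : ℕ} → NN m n → (Fin m → ℝ) → (Fin n → ℝ)
  | _, _, last A b, x => A.mulVec x + b
  | _, _, cons A b rest, x => rest.realize fun i => max 0 ((A.mulVec x + b) i)

/-- The number of layers. -/
def depth : {m n : ℕ} → NN m n → ℕ
  | _, _, last _ _ => 1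
  | _, _, cons _ _ rest => rest.depth + 1

/-- The number of nonzero weights and biases. -/
def size : {m n : ℕ} → NN m n → ℕ
  | _, _, last A b => nnzMat A + nnzVec b
  | _, _, cons A b rest => nnzMat A + nnzVec b + rest.size

/-- All layers have positive width. -/
def PosWidths : {m n : ℕ} → NN m n → Prop
  | _, n, last _ _ => 0 < n
  | _, _, @cons _ k _ _ _ rest => 0 < k ∧ rest.PosWidths

/-- Merges the affine map `x ↦ A x + b` into the first layer of a network. -/
def precomp {m k n : ℕ} (A : Matrix (Fin k) (Fin m) ℝ) (b : Fin k → ℝ) : NN k n → NN m n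
  | last A' b' => last (A' * A) (A'.mulVec b + b')
  | cons A' b' rest => cons (A' * A) (A'.mulVec b + b') rest

/-- The concatenation `Φ₁ ● Φ₂` (first `Φ₂`, then `Φ₁`), in which the last layer of `Φ₂` and the
first layer of `Φ₁` are merged; it has `L₁ + L₂ - 1` layers. -/
def concat {l : ℕ} : {m k : ℕ} → NN k l → NN m k → NN m l
  | _, _, Φ₁, last A b => precomp A b Φ₁
  | _, _, Φ₁, cons A b rest => cons A b (concat Φ₁ rest)

/-- The two-layer network `x ↦ relu x - relu (-x)`, which realizes the identity of `ℝⁿ`. -/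
def idTwo (n : ℕ) : NN n n :=
  cons (k := n + n)
    (Matrix.of (Fin.append (fun i => (1 : Matrix (Fin n) (Fin n) ℝ) i)
      (fun i => (-1 : Matrix (Fin n) (Fin n) ℝ) i))) 0
    (last (Matrix.of fun i => Fin.append ((1 : Matrix (Fin n) (Fin n) ℝ) i)
      ((-1 : Matrix (Fin n) (Fin n) ℝ) i)) 0)

/-- The sparse concatenation `Φ₁ ⊙ Φ₂`: a two-layer identity network is inserted between `Φ₂` and
`Φ₁`, so that it has `L₁ + L₂` layers. -/
def sparseConcat {m k l : ℕ} (Φ₁ : NN k l) (Φ₂ : NN m k) : NN m l :=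
  concat Φ₁ (concat (idTwo k) Φ₂)

end NN

/-! ## Vectorization -/

/-- Column-stacking vectorization of a square matrix. -/
def vecM {n : ℕ} (A : Matrix (Fin n) (Fin n) ℝ) : Fin (n * n) → ℝ :=
  fun r => A (finProdFinEquiv.symm r).2 (finProdFinEquiv.symm r).1

/-- Matricization, the inverse of `vecM`. -/
def matM {n : ℕ} (v : Fin (n * n) → ℝ) : Matrix (Fin n) (Fin n) ℝ :=
  Matrix.of fun i j => v (finProdFinEquiv (j, i))

/-- The Kronecker product `Id ⊗ M`, acting on vectorized matrices. -/
def idKron {n : ℕ} (M : Matrix (Fin n) (Fin n) ℝ) : Matrix (Fin (n * n)) (Fin (n * n)) ℝ :=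
  Matrix.reindex finProdFinEquiv finProdFinEquiv ((1 : Matrix (Fin n) (Fin n) ℝ) ⊗ₖ M)

/-! ## Coefficients -/

/-- The partial derivative `∂ⱼ u (x)`. -/
def partialD {d : ℕ} (j : Fin d) (u : (Fin d → ℝ) → ℝ) (x : Fin d → ℝ) : ℝ :=
  fderiv ℝ u x (Pi.single j 1)

/-- `Hol(Ω; C)`: the real analytic functions on `ℝᵈ` that have period one in all coordinates and
satisfy `‖v‖_{W^{k,∞}(Q)} ≤ C^{k+1} k!` on `Q = (0,1)ᵈ` for all `k`. The norm is the maximum over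
all partial derivatives of order at most `k` of their suprema. -/
def Hol (d : ℕ) (C : ℝ) : Set ((Fin d → ℝ) → ℝ) :=
  {v | AnalyticOnNhd ℝ v Set.univ ∧ (∀ x j, v (x + Pi.single j 1) = v x) ∧
    ∀ k m : ℕ, m ≤ k → ∀ s : Fin m → Fin d, ∀ x ∈ Set.pi Set.univ fun _ => Set.Ioo (0 : ℝ) 1,
      |iteratedFDeriv ℝ m v x fun i => Pi.single (s i) 1| ≤ C ^ (k + 1) * k.factorial}

/-! ## Polynomial basis -/

/-- The Legendre polynomial of degree `i` on `(0,1)`, with value `1` at `1`. -/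
def legendre01 (i : ℕ) : ℝ[X] :=
  Polynomial.C ((-1) ^ i) * (Polynomial.shiftedLegendre i).map (Int.castRingHom ℝ)

/-- The univariate basis `L₀, L₂, L₃ - L₁, L₄, L₅ - L₁, …` of the periodic polynomials. -/
def phi1d (i : ℕ) : ℝ[X] :=
  if i = 0 then legendre01 0
  else if Odd i then legendre01 (i + 1)
  else legendre01 (i + 1) - legendre01 1

/-- The number `n_b = p ^ d - 1` of basis functions. -/
def nb (d p : ℕ) : ℕ := p ^ d - 1

/-- The multi-index in `{0, …, p-1}ᵈ` of the basis function with number `j + 1 ∈ {1, …, n_b}`: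
its base-`p` digits, the least significant one first. -/
def modeIndex (d p : ℕ) (j : Fin (nb d p)) : Fin d → Fin p :=
  finFunctionFinEquiv.symm ⟨j + 1, by have := j.isLt; unfold nb at this; omega⟩

/-- The tensor product basis functions `φ₁, …, φ_{n_b}` (numbered from `0` here). -/
def phi (d p : ℕ) (j : Fin (nb d p)) : (Fin d → ℝ) → ℝ :=
  fun x => ∏ l, (phi1d (modeIndex d p j l)).eval (x l)

/-! ## Gauss-Lobatto quadrature -/

/-- `x` and `w` are the nodes and weights of the `q`-point Gauss-Lobatto rule on `[0,1]`: both
endpoints are nodes and polynomials of degree at most `2q - 3` are integrated exactly. -/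
structure IsGaussLobatto (q : ℕ) (x w : Fin q → ℝ) : Prop where
  strictMono : StrictMono x
  mem_Icc : ∀ k, x k ∈ Set.Icc (0 : ℝ) 1
  exists_zero : ∃ k, x k = 0
  exists_one : ∃ k, x k = 1
  exact_of_natDegree_le : ∀ P : ℝ[X], P.natDegree ≤ 2 * q - 3 →
    ∫ t in (0 : ℝ)..1, P.eval t = ∑ k, w k * P.eval (x k)

/-- Multiplying a nonzero polynomial by suitable linear factors, one for some of its zeros in
`(0,1)` each, removes all its sign changes in `(0,1)`. -/
theorem exists_finset_constSign (n : ℕ) : ∀ M : ℝ[X], M ≠ 0 → M.natDegree ≤ n →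
    ∃ S : Finset ℝ, (∀ s ∈ S, s ∈ Set.Ioo (0 : ℝ) 1 ∧ M.IsRoot s) ∧
      ((∀ t ∈ Set.Ioo (0 : ℝ) 1, 0 ≤ (M * ∏ s ∈ S, (Polynomial.X - Polynomial.C s)).eval t) ∨
       (∀ t ∈ Set.Ioo (0 : ℝ) 1, (M * ∏ s ∈ S, (Polynomial.X - Polynomial.C s)).eval t ≤ 0)) := by
  classical
  induction n with
  | zero =>
    intro M hM hd
    obtain ⟨c, rfl⟩ := Polynomial.natDegree_eq_zero.mp (Nat.le_zero.mp hd)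
    refine ⟨∅, by simp, ?_⟩
    rcases le_total 0 c with h | h
    · left; intro t _; simpa using h
    · right; intro t _; simpa using h
  | succ n ih =>
    intro M hM hd
    by_cases hr : ∃ r ∈ Set.Ioo (0 : ℝ) 1, M.IsRoot r
    · obtain ⟨r, hr01, hr⟩ := hr
      obtain ⟨M', rfl⟩ := Polynomial.dvd_iff_isRoot.mpr hr
      have hM' : M' ≠ 0 := right_ne_zero_of_mul hM
      have hdeg : M'.natDegree ≤ n := by
        rw [Polynomial.natDegree_mul (left_ne_zero_of_mul hM) hM',
          Polynomial.natDegree_X_sub_C] at hd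
        omega
      obtain ⟨S, hS, hsign⟩ := ih M' hM' hdeg
      by_cases hrS : r ∈ S
      · refine ⟨S.erase r, ?_, ?_⟩
        · intro s hs
          have := hS s (Finset.mem_of_mem_erase hs)
          exact ⟨this.1, Polynomial.root_mul_left_of_isRoot _ this.2⟩
        · have : (Polynomial.X - Polynomial.C r) * M' *
              ∏ s ∈ S.erase r, (Polynomial.X - Polynomial.C s)
              = M' * ∏ s ∈ S, (Polynomial.X - Polynomial.C s) := by
            rw [← Finset.mul_prod_erase S _ hrS]; ring
          rw [this]; exact hsign
      · refine ⟨insert r S, ?_, ?_⟩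
        · intro s hs
          rcases Finset.mem_insert.mp hs with rfl | hs
          · exact ⟨hr01, hr⟩
          · exact ⟨(hS s hs).1, Polynomial.root_mul_left_of_isRoot _ (hS s hs).2⟩
        · have : (Polynomial.X - Polynomial.C r) * M' *
              ∏ s ∈ insert r S, (Polynomial.X - Polynomial.C s)
              = (Polynomial.X - Polynomial.C r) ^ 2 *
                (M' * ∏ s ∈ S, (Polynomial.X - Polynomial.C s)) := by
            rw [Finset.prod_insert hrS]; ring
          rw [this]
          rcases hsign with h | h
          · left; intro t ht
            rw [Polynomial.eval_mul, Polynomial.eval_pow]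
            exact mul_nonneg (sq_nonneg _) (h t ht)
          · right; intro t ht
            rw [Polynomial.eval_mul, Polynomial.eval_pow]
            exact mul_nonpos_of_nonneg_of_nonpos (sq_nonneg _) (h t ht)
    · push Not at hr
      refine ⟨∅, by simp, ?_⟩
      simp only [Finset.prod_empty, mul_one]
      by_contra hcon
      push Not at hcon
      obtain ⟨⟨a, ha, hMa⟩, ⟨b, hb, hMb⟩⟩ := hcon
      have hsub : Set.uIcc a b ⊆ Set.Ioo (0 : ℝ) 1 := Set.ordConnected_Ioo.uIcc_subset ha hb
      have := intermediate_value_uIcc (f := fun t => M.eval t) (a := a) (b := b)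
        M.continuous.continuousOn
      obtain ⟨c, hc, hc0⟩ := this (Set.mem_uIcc.mpr (Or.inl ⟨hMa.le, hMb.le⟩))
      exact hr c (hsub hc) hc0

/-- A nonzero polynomial of degree at most `N` that is orthogonal to all polynomials of smaller
degree than `N`, for the weight `t (1 - t)` on `(0,1)`. -/
theorem exists_orthogonal (N : ℕ) : ∃ M : ℝ[X], M ≠ 0 ∧ M.natDegree ≤ N ∧
    ∀ R ∈ Polynomial.degreeLT ℝ N, ∫ t in (0 : ℝ)..1, t * (1 - t) * (M.eval t * R.eval t) = 0 := by
  let I (P : ℝ[X]) : ℝ := ∫ t in (0 : ℝ)..1, t * (1 - t) * P.eval t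
  have hint (P : ℝ[X]) : IntervalIntegrable (fun t => t * (1 - t) * P.eval t)
      MeasureTheory.volume 0 1 := by
    apply Continuous.intervalIntegrable
    have := P.continuous
    fun_prop
  let L : ℝ[X] →ₗ[ℝ] ℝ :=
    { toFun := I
      map_add' := by
        intro P Q
        simp only [I]
        rw [← intervalIntegral.integral_add (hint P) (hint Q)]
        congr 1; ext t; rw [Polynomial.eval_add]; ring
      map_smul' := by
        intro c P
        simp only [I, RingHom.id_apply, smul_eq_mul]
        rw [← intervalIntegral.integral_const_mul]
        congr 1; ext t; rw [Polynomial.eval_smul, smul_eq_mul]; ring }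
  let B : Polynomial.degreeLT ℝ (N + 1) →ₗ[ℝ] (Fin N → ℝ) :=
    LinearMap.pi fun k => (L ∘ₗ LinearMap.mulRight ℝ (Polynomial.X ^ (k : ℕ))) ∘ₗ
      (Polynomial.degreeLT ℝ (N + 1)).subtype
  have hfin : FiniteDimensional ℝ (Polynomial.degreeLT ℝ (N + 1)) :=
    LinearEquiv.finiteDimensional (Polynomial.degreeLTEquiv ℝ (N + 1)).symm
  have hker : LinearMap.ker B ≠ ⊥ := by
    apply LinearMap.ker_ne_bot_of_finrank_lt
    rw [(Polynomial.degreeLTEquiv ℝ (N + 1)).finrank_eq]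
    simp
  obtain ⟨M, hM, hM0⟩ := Submodule.exists_mem_ne_zero_of_ne_bot hker
  refine ⟨M, by simpa using hM0, ?_, ?_⟩
  · have := M.2
    rw [Polynomial.mem_degreeLT] at this
    rw [Polynomial.natDegree_le_iff_degree_le]
    refine Order.le_of_lt_succ ?_
    rw [← WithBot.coe_natCast] at *
    exact_mod_cast this
  · intro R hR
    have hmon (k : ℕ) (hk : k < N) : L ((M : ℝ[X]) * Polynomial.X ^ k) = 0 := by
      have := congrFun (LinearMap.mem_ker.mp hM) ⟨k, hk⟩
      simpa [B] using this
    have hall : ∀ R ∈ Polynomial.degreeLT ℝ N, L ((M : ℝ[X]) * R) = 0 := by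
      intro R hR
      rw [Polynomial.degreeLT_eq_span_X_pow] at hR
      induction hR using Submodule.span_induction with
      | mem x hx =>
        simp only [Finset.coe_image, Set.mem_image, Finset.coe_range, Set.mem_Iio] at hx
        obtain ⟨k, hk, rfl⟩ := hx
        exact hmon k hk
      | zero => simp
      | add x y _ _ hx hy => rw [mul_add, map_add, hx, hy, add_zero]
      | smul c x _ hx => rw [mul_smul_comm, map_smul, hx, smul_zero]
    have := hall R hR
    simpa [L, I] using this

/-- The Gauss-Lobatto rule exists. -/
theorem exists_isGaussLobatto (q : ℕ) (hq : 2 ≤ q) : ∃ x w : Fin q → ℝ, IsGaussLobatto q x w := by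
  classical
  obtain ⟨N, rfl⟩ := Nat.exists_eq_add_of_le' hq
  obtain ⟨M, hM0, hMd, hMo⟩ := exists_orthogonal N
  obtain ⟨S, hS, hsign⟩ := exists_finset_constSign N M hM0 hMd
  let PS : ℝ[X] := ∏ s ∈ S, (Polynomial.X - Polynomial.C s)
  have hPSmon : PS.Monic := Polynomial.monic_prod_of_monic _ _ fun s _ => Polynomial.monic_X_sub_C s
  have hPSdeg : PS.natDegree = S.card := by
    simp only [PS]
    rw [Polynomial.natDegree_prod_of_monic _ _ fun s _ => Polynomial.monic_X_sub_C s]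
    simp
  have hSle : S.card ≤ N := by
    have : S.val ≤ M.roots := by
      rw [Finset.val_le_iff_val_subset]
      intro s hs
      exact (Polynomial.mem_roots hM0).mpr (hS s hs).2
    exact (Multiset.card_le_card this).trans ((Polynomial.card_roots' M).trans hMd)
  have hScard : S.card = N := by
    by_contra hne
    have hlt : S.card < N := lt_of_le_of_ne hSle hne
    have hI : ∫ t in (0 : ℝ)..1, t * (1 - t) * (M.eval t * PS.eval t) = 0 := by
      apply hMo
      rw [Polynomial.mem_degreeLT, Polynomial.degree_eq_natDegree hPSmon.ne_zero, hPSdeg]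
      exact_mod_cast hlt
    have hMPS : M * PS ≠ 0 := mul_ne_zero hM0 hPSmon.ne_zero
    have hcont : Continuous fun t : ℝ => t * (1 - t) * (M.eval t * PS.eval t) := by
      have h1 := M.continuous
      have h2 := PS.continuous
      fun_prop
    obtain ⟨t, ht, htne⟩ : ∃ t ∈ Set.Ioo (0 : ℝ) 1, (M * PS).eval t ≠ 0 := by
      by_contra hcon
      push Not at hcon
      exact hMPS (Polynomial.eq_zero_of_infinite_isRoot _
        ((Set.Ioo_infinite (by norm_num : (0 : ℝ) < 1)).mono fun t ht => hcon t ht))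
    rw [Polynomial.eval_mul] at htne
    rcases hsign with h | h
    · have hpos : 0 < ∫ t in (0 : ℝ)..1, t * (1 - t) * (M.eval t * PS.eval t) := by
        apply intervalIntegral.integral_pos (by norm_num) hcont.continuousOn
        · intro s hs
          rcases eq_or_lt_of_le hs.2 with rfl | h1
          · simp
          · have := h s ⟨hs.1, h1⟩
            rw [Polynomial.eval_mul] at this
            exact mul_nonneg (mul_nonneg hs.1.le (by linarith)) this
        · refine ⟨t, ⟨ht.1.le, ht.2.le⟩, ?_⟩
          have := h t ht
          rw [Polynomial.eval_mul] at this
          exact mul_pos (mul_pos ht.1 (by linarith [ht.2])) (lt_of_le_of_ne this htne.symm)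
      exact hpos.ne' hI
    · have hpos : 0 < ∫ t in (0 : ℝ)..1, -(t * (1 - t) * (M.eval t * PS.eval t)) := by
        apply intervalIntegral.integral_pos (by norm_num) hcont.neg.continuousOn
        · intro s hs
          change 0 ≤ -(s * (1 - s) * (M.eval s * PS.eval s))
          rcases eq_or_lt_of_le hs.2 with rfl | h1
          · simp
          · have := h s ⟨hs.1, h1⟩
            rw [Polynomial.eval_mul] at this
            have h3 := mul_nonneg (mul_nonneg hs.1.le (by linarith : 0 ≤ 1 - s)) (neg_nonneg.mpr this)
            simp only [PS] at h3 ⊢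
            linarith
        · refine ⟨t, ⟨ht.1.le, ht.2.le⟩, ?_⟩
          change 0 < -(t * (1 - t) * (M.eval t * PS.eval t))
          have := h t ht
          rw [Polynomial.eval_mul] at this
          have h3 := mul_pos (mul_pos ht.1 (by linarith [ht.2] : 0 < 1 - t))
            (neg_pos.mpr (lt_of_le_of_ne this htne))
          simp only [PS] at h3 ⊢
          linarith
      rw [intervalIntegral.integral_neg, hI] at hpos
      simp at hpos
  have hMeq : M = Polynomial.C M.leadingCoeff * PS := by
    have hdvd : PS ∣ M := by
      refine Finset.prod_dvd_of_coprime ?_ fun s hs => Polynomial.dvd_iff_isRoot.mpr (hS s hs).2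
      intro a _ b _ hab
      exact Polynomial.isCoprime_X_sub_C_of_isUnit_sub (sub_ne_zero.mpr hab).isUnit
    obtain ⟨c, hc⟩ := hdvd
    have hc0 : c ≠ 0 := by rintro rfl; exact hM0 (by simpa using hc)
    have hcd : c.natDegree = 0 := by
      have := Polynomial.natDegree_mul hPSmon.ne_zero hc0
      rw [← hc, hPSdeg, hScard] at this
      omega
    obtain ⟨e, rfl⟩ := Polynomial.natDegree_eq_zero.mp hcd
    have : M.leadingCoeff = e := by
      rw [hc, Polynomial.leadingCoeff_mul, hPSmon.leadingCoeff]; simp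
    rw [this, hc]; ring
  have hlead : M.leadingCoeff ≠ 0 := Polynomial.leadingCoeff_ne_zero.mpr hM0
  have h0S : (0 : ℝ) ∉ S := fun h => lt_irrefl _ (hS 0 h).1.1
  have h1S : (1 : ℝ) ∉ S := fun h => lt_irrefl _ (hS 1 h).1.2
  have h0 : (0 : ℝ) ∉ insert (1 : ℝ) S := by simp [h0S]
  let T : Finset ℝ := insert 0 (insert 1 S)
  have hT : T.card = N + 2 := by
    simp only [T]
    rw [Finset.card_insert_of_notMem h0, Finset.card_insert_of_notMem h1S, hScard]
  let x : Fin (N + 2) → ℝ := T.orderEmbOfFin hT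
  have hxmono : StrictMono x := (T.orderEmbOfFin hT).strictMono
  have hxT (k) : x k ∈ T := Finset.orderEmbOfFin_mem T hT k
  have hrange : Set.range x = T := Finset.range_orderEmbOfFin T hT
  let b (k : Fin (N + 2)) : ℝ[X] := Lagrange.basis Finset.univ x k
  refine ⟨x, fun k => ∫ t in (0 : ℝ)..1, (b k).eval t, hxmono, ?_, ?_, ?_, ?_⟩
  · intro k
    rcases Finset.mem_insert.mp (hxT k) with h | h
    · rw [h]; norm_num
    · rcases Finset.mem_insert.mp h with h | h
      · rw [h]; norm_num
      · exact ⟨(hS _ h).1.1.le, (hS _ h).1.2.le⟩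
  · have : (0 : ℝ) ∈ Set.range x := by rw [hrange]; simp [T]
    exact this
  · have : (1 : ℝ) ∈ Set.range x := by rw [hrange]; simp [T]
    exact this
  · intro P hP
    let W : ℝ[X] := Polynomial.X * (Polynomial.X - Polynomial.C 1) * PS
    have hWmon : W.Monic :=
      (Polynomial.monic_X.mul (Polynomial.monic_X_sub_C 1)).mul hPSmon
    have hWdeg : W.natDegree = N + 2 := by
      simp only [W]
      rw [(Polynomial.monic_X.mul (Polynomial.monic_X_sub_C 1)).natDegree_mul hPSmon,
        Polynomial.monic_X.natDegree_mul (Polynomial.monic_X_sub_C 1), hPSdeg, hScard,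
        Polynomial.natDegree_X, Polynomial.natDegree_X_sub_C]
      omega
    have hWx (k) : W.eval (x k) = 0 := by
      simp only [W, PS, Polynomial.eval_mul, Polynomial.eval_prod, Polynomial.eval_sub,
        Polynomial.eval_X, Polynomial.eval_C]
      rcases Finset.mem_insert.mp (hxT k) with h | h
      · rw [h]; simp
      · rcases Finset.mem_insert.mp h with h | h
        · rw [h]; simp
        · rw [Finset.prod_eq_zero h (by simp)]; simp
    let R := P %ₘ W
    let Q := P /ₘ W
    have hdiv : R + W * Q = P := Polynomial.modByMonic_add_div P W
    have hQ : Q ∈ Polynomial.degreeLT ℝ N := by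
      rw [Polynomial.mem_degreeLT]
      by_cases hQ0 : Q = 0
      · rw [hQ0, Polynomial.degree_zero]; exact WithBot.bot_lt_coe _
      · rw [Polynomial.degree_eq_natDegree hQ0]
        have : Q.natDegree = P.natDegree - W.natDegree := Polynomial.natDegree_divByMonic P hWmon
        have hle : W.natDegree ≤ P.natDegree := by
          by_contra hlt
          apply hQ0
          apply (Polynomial.divByMonic_eq_zero_iff hWmon).mpr
          exact Polynomial.degree_lt_degree (by omega)
        have : Q.natDegree < N := by omega
        exact_mod_cast this
    have hIW : ∫ t in (0 : ℝ)..1, (W * Q).eval t = 0 := by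
      have h := hMo Q hQ
      have heq : (fun t : ℝ => t * (1 - t) * (M.eval t * Q.eval t)) =
          fun t => (-M.leadingCoeff) * (W * Q).eval t := by
        ext t
        have : M.eval t = M.leadingCoeff * PS.eval t := by
          conv_lhs => rw [hMeq]
          simp
        rw [this]
        simp only [W, Polynomial.eval_mul, Polynomial.eval_sub, Polynomial.eval_X,
          Polynomial.eval_C]
        ring
      rw [heq, intervalIntegral.integral_const_mul] at h
      rcases mul_eq_zero.mp h with h | h
      · exact absurd (neg_eq_zero.mp h) hlead
      · exact h
    have hii (P : ℝ[X]) : IntervalIntegrable (fun t => P.eval t) MeasureTheory.volume 0 1 :=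
      P.continuous.intervalIntegrable _ _
    have hPx (k) : P.eval (x k) = R.eval (x k) := by
      rw [← hdiv, Polynomial.eval_add, Polynomial.eval_mul, hWx]; ring
    have hRdeg : R.degree < (Finset.univ : Finset (Fin (N + 2))).card := by
      have := Polynomial.degree_modByMonic_lt P hWmon
      rw [Polynomial.degree_eq_natDegree hWmon.ne_zero, hWdeg] at this
      simpa using this
    have hRL : R = ∑ k, Polynomial.C (R.eval (x k)) * b k := by
      have := Lagrange.eq_interpolate (s := Finset.univ) (v := x) (f := R)
        hxmono.injective.injOn hRdeg
      rw [Lagrange.interpolate_apply] at this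
      exact this
    have h1 : ∫ t in (0 : ℝ)..1, P.eval t = ∫ t in (0 : ℝ)..1, R.eval t := by
      rw [← hdiv]
      simp only [Polynomial.eval_add]
      rw [intervalIntegral.integral_add (hii R) (hii (W * Q)), hIW, add_zero]
    rw [h1]
    have h2 : (fun t => R.eval t) = fun t => ∑ k, R.eval (x k) * (b k).eval t := by
      ext t
      conv_lhs => rw [hRL]
      simp [Polynomial.eval_finsetSum]
    rw [h2, intervalIntegral.integral_finsetSum]
    · refine Finset.sum_congr rfl fun k _ => ?_
      rw [intervalIntegral.integral_const_mul, hPx, mul_comm]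
    · intro k _
      exact (hii (b k)).const_mul _

/-- The nodes of the `q`-point Gauss-Lobatto rule on `[0,1]` (for `q ≥ 2`), in increasing order. -/
def glNode (q : ℕ) : Fin q → ℝ :=
  if h : 2 ≤ q then (exists_isGaussLobatto q h).choose else 0

/-- The weights of the `q`-point Gauss-Lobatto rule on `[0,1]` (for `q ≥ 2`). -/
def glWeight (q : ℕ) : Fin q → ℝ :=
  if h : 2 ≤ q then (exists_isGaussLobatto q h).choose_spec.choose else 0

theorem isGaussLobatto_gl (q : ℕ) (hq : 2 ≤ q) : IsGaussLobatto q (glNode q) (glWeight q) := by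
  unfold glNode glWeight
  rw [dif_pos hq, dif_pos hq]
  exact (exists_isGaussLobatto q hq).choose_spec.choose_spec

/-- The `n_q = q ^ d` nodes of the tensor product Gauss-Lobatto rule on `[0,1]ᵈ`. -/
def quadNode (d q : ℕ) (k : Fin (q ^ d)) : Fin d → ℝ :=
  fun l => glNode q (finFunctionFinEquiv.symm k l)

/-- The weights of the tensor product Gauss-Lobatto rule on `[0,1]ᵈ`. -/
def quadWeight (d q : ℕ) (k : Fin (q ^ d)) : ℝ :=
  ∏ l, glWeight q (finFunctionFinEquiv.symm k l)

/-- The encoder: the vector of the values of `a` at the quadrature nodes. -/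
def nodalValues (d q : ℕ) (a : (Fin d → ℝ) → ℝ) : Fin (q ^ d) → ℝ :=
  fun k => a (quadNode d q k)

/-- The bilinear form `∫_Q a ∇u · ∇v`, with the integral replaced by quadrature. -/
def quadForm (d q : ℕ) (a u v : (Fin d → ℝ) → ℝ) : ℝ :=
  ∑ k, quadWeight d q k * a (quadNode d q k) *
    ∑ l, partialD l u (quadNode d q k) * partialD l v (quadNode d q k)

/-- The Galerkin matrix `A^a_{n_b,n_q}` with numerical integration. -/
def galerkin (d p q : ℕ) (a : (Fin d → ℝ) → ℝ) : Matrix (Fin (nb d p)) (Fin (nb d p)) ℝ :=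
  Matrix.of fun i j => quadForm d q a (phi d p j) (phi d p i)

/-- The preconditioned Galerkin matrix `Ã^a = (A^1)⁻¹ A^a`. -/
def precGalerkin (d p q : ℕ) (a : (Fin d → ℝ) → ℝ) : Matrix (Fin (nb d p)) (Fin (nb d p)) ℝ :=
  (galerkin d p q fun _ => 1)⁻¹ * galerkin d p q a

/-! ## The networks -/

/-- The matrix with entries `w_k ∇φ_i(x_k) · ∇φ_j(x_k)`. -/
def nodeMatrix (d p q : ℕ) (k : Fin (q ^ d)) : Matrix (Fin (nb d p)) (Fin (nb d p)) ℝ :=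
  Matrix.of fun i j => quadWeight d q k *
    ∑ l, partialD l (phi d p i) (quadNode d q k) * partialD l (phi d p j) (quadNode d q k)

/-- The one-layer linear input network, which maps the nodal values of `a` to `vec (-α A^a)`. -/
def inputNet (d p q : ℕ) (α : ℝ) : NN (q ^ d) (nb d p * nb d p) :=
  NN.last (Matrix.of fun r k => -α * vecM (nodeMatrix d p q k) r) 0

/-- The two-layer network `((Id ⊗ (A^1)⁻¹, vec Id)) ⊙ inputNet`, which maps the nodal values of `a`
to `vec (Id - α Ã^a)`. -/
def precInputNet (d p q : ℕ) (α : ℝ) : NN (q ^ d) (nb d p * nb d p) :=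
  NN.sparseConcat
    (NN.last (idKron (galerkin d p q fun _ => 1)⁻¹) (vecM 1))
    (inputNet d p q α)

/-- `Ψ` is an inversion network of accuracy `ε` on the ball of radius `1 - δ`: it maps `vec A` to an
`ε`-approximation of `(Id - A)⁻¹` (the sum of the Neumann series of `A`) if `‖A‖₂ ≤ 1 - δ`. -/
def IsInversionNet (n : ℕ) (δ ε : ℝ) (Ψ : NN (n * n) (n * n)) : Prop :=
  ∀ A : Matrix (Fin n) (Fin n) ℝ, ‖A‖ ≤ 1 - δ → ‖(1 - A)⁻¹ - matM (Ψ.realize (vecM A))‖ ≤ ε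

/-- The network `(α Id, 0) ● Ψ ⊙ precInputNet`. -/
def fullNet (d p q : ℕ) (α : ℝ) (Ψ : NN (nb d p * nb d p) (nb d p * nb d p)) :
    NN (q ^ d) (nb d p * nb d p) :=
  NN.concat (NN.last (α • (1 : Matrix (Fin (nb d p * nb d p)) (Fin (nb d p * nb d p)) ℝ)) 0)
    (NN.sparseConcat Ψ (precInputNet d p q α))

end

noncomputable section

/-! ## Calculus of networks -/

/-! With `B = 1 - α Ã^a`, the Neumann series gives `(Ã^a)⁻¹ = α ∑ B^k`, so the network has to
evaluate a truncated geometric series of matrices. The delicate point is that `Ã^a = (A^1)⁻¹ A^a`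
need not be symmetric, so `‖B‖₂ ≤ 1 - δ` is not available, and accuracy of `Ψ` on that spectral ball
alone would not suffice.

`B` is, however, self-adjoint for the energy inner product of `A^1`. The form `y · (A^1 - α A^a) y`
is the quadrature of `(1 - α a) |∇u|²`; the weights are positive, and `|1 - α a| ≤ 1 - δ` at the
nodes because `α C_coer ≤ α a ≤ α C_cont` and `α C_coer + α C_cont = 1`. Hence `B` contracts the
energy norm by `ρ = 1 - δ` (`energy_contraction`). Energy norm and Euclidean norm of the
coefficients are equivalent with constants polynomial in `n_b`: Legendre orthogonality, a Poincaré
inequality and the sign of the Gauss-Lobatto error on squares give this in one variable, and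
`tensor_lower_bound` lifts the lower bound to `d` variables. Converting norms only once yields
`‖B^k‖ ≤ C₀ n_b^5 ρ^k` (`norm_pow_one_sub_precGalerkin_le`).

The inversion network is therefore built for all matrices whose powers decay like this
(`exists_inversion_net`); the spectral ball of radius `1 - δ` is a special case. The polynomial
factor only adds multiples of `log n_b` to the number of series terms and to the required precision,
which the claimed bounds absorb.

The network computes `2^J` terms by iterating `(X, B) ↦ ((1 + B) X, B²)`. Scalar products come from
`xy = ((x+y)/2)² - ((x-y)/2)²`, and squares from an `m`-layer ReLU iteration with error `4^(-m)`.
Errors grow at most by a factor `3R` per step, so `m` of order `log n_b + J log R + |log ε|` is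
enough. Each composition doubles the size already accumulated, but `2^J` is only of order `(1 + |log
ε|)(1 + log n_b)`. -/

theorem nnzMat_eq_sum {m n : ℕ} (A : Matrix (Fin n) (Fin m) ℝ) :
    nnzMat A = ∑ i, ∑ j, if A i j ≠ 0 then 1 else 0 := by
  unfold nnzMat
  rw [Finset.card_filter, ← Finset.univ_product_univ, Finset.sum_product]

theorem nnzVec_eq_sum {n : ℕ} (b : Fin n → ℝ) : nnzVec b = ∑ i, if b i ≠ 0 then 1 else 0 := by
  unfold nnzVec
  rw [Finset.card_filter]

theorem nnzVec_zero {n : ℕ} : nnzVec (0 : Fin n → ℝ) = 0 := by simp [nnzVec]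

namespace NN

/-- The matrix that stacks `1` on top of `-1`. -/
def splitMat (n : ℕ) : Matrix (Fin (n + n)) (Fin n) ℝ :=
  Matrix.of (Fin.append (fun i => (1 : Matrix (Fin n) (Fin n) ℝ) i)
    (fun i => (-1 : Matrix (Fin n) (Fin n) ℝ) i))

/-- The matrix `(1, -1)`. -/
def mergeMat (n : ℕ) : Matrix (Fin n) (Fin (n + n)) ℝ :=
  Matrix.of fun i => Fin.append ((1 : Matrix (Fin n) (Fin n) ℝ) i)
    ((-1 : Matrix (Fin n) (Fin n) ℝ) i)

theorem splitMat_mulVec_castAdd {n : ℕ} (x : Fin n → ℝ) (i : Fin n) :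
    (splitMat n).mulVec x (Fin.castAdd n i) = x i := by
  simp [splitMat, Matrix.mulVec, dotProduct, Matrix.one_apply, -Fin.natAdd_eq_addNat]

theorem splitMat_mulVec_natAdd {n : ℕ} (x : Fin n → ℝ) (i : Fin n) :
    (splitMat n).mulVec x (Fin.natAdd n i) = -x i := by
  simp [splitMat, Matrix.mulVec, dotProduct, Matrix.one_apply, -Fin.natAdd_eq_addNat]

theorem mergeMat_mulVec {n : ℕ} (h : Fin (n + n) → ℝ) (i : Fin n) :
    (mergeMat n).mulVec h i = h (Fin.castAdd n i) - h (Fin.natAdd n i) := by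
  simp [mergeMat, Matrix.mulVec, dotProduct, Matrix.one_apply, Fin.sum_univ_add, sub_eq_add_neg,
    -Fin.natAdd_eq_addNat]

theorem splitMat_mul_castAdd {m n : ℕ} (A : Matrix (Fin n) (Fin m) ℝ) (i : Fin n) (j : Fin m) :
    (splitMat n * A) (Fin.castAdd n i) j = A i j := by
  simp [splitMat, Matrix.mul_apply, Matrix.one_apply, -Fin.natAdd_eq_addNat]

theorem splitMat_mul_natAdd {m n : ℕ} (A : Matrix (Fin n) (Fin m) ℝ) (i : Fin n) (j : Fin m) :
    (splitMat n * A) (Fin.natAdd n i) j = -A i j := by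
  simp [splitMat, Matrix.mul_apply, Matrix.one_apply, -Fin.natAdd_eq_addNat]

theorem mul_mergeMat_castAdd {m n : ℕ} (A : Matrix (Fin m) (Fin n) ℝ) (i : Fin m) (j : Fin n) :
    (A * mergeMat n) i (Fin.castAdd n j) = A i j := by
  simp [mergeMat, Matrix.mul_apply, Matrix.one_apply, -Fin.natAdd_eq_addNat]

theorem mul_mergeMat_natAdd {m n : ℕ} (A : Matrix (Fin m) (Fin n) ℝ) (i : Fin m) (j : Fin n) :
    (A * mergeMat n) i (Fin.natAdd n j) = -A i j := by
  simp [mergeMat, Matrix.mul_apply, Matrix.one_apply, -Fin.natAdd_eq_addNat]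

theorem nnzMat_splitMat_mul {m n : ℕ} (A : Matrix (Fin n) (Fin m) ℝ) :
    nnzMat (splitMat n * A) = 2 * nnzMat A := by
  simp only [nnzMat_eq_sum, Fin.sum_univ_add, splitMat_mul_castAdd, splitMat_mul_natAdd,
    neg_ne_zero, two_mul]

theorem nnzMat_mul_mergeMat {m n : ℕ} (A : Matrix (Fin m) (Fin n) ℝ) :
    nnzMat (A * mergeMat n) = 2 * nnzMat A := by
  simp only [nnzMat_eq_sum, Fin.sum_univ_add, mul_mergeMat_castAdd, mul_mergeMat_natAdd,
    neg_ne_zero, two_mul, Finset.sum_add_distrib]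

theorem nnzVec_splitMat_mulVec {n : ℕ} (b : Fin n → ℝ) :
    nnzVec ((splitMat n).mulVec b + 0) = 2 * nnzVec b := by
  simp only [nnzVec_eq_sum, Fin.sum_univ_add, add_zero, splitMat_mulVec_castAdd,
    splitMat_mulVec_natAdd, neg_ne_zero, two_mul]

theorem idTwo_eq (n : ℕ) : idTwo n = cons (splitMat n) 0 (last (mergeMat n) 0) := rfl

theorem realize_precomp {m k n : ℕ} (A : Matrix (Fin k) (Fin m) ℝ) (b : Fin k → ℝ) (Φ : NN k n)
    (x : Fin m → ℝ) : (precomp A b Φ).realize x = Φ.realize (A.mulVec x + b) := by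
  cases Φ with
  | last A' b' =>
    simp only [precomp, realize, Matrix.mulVec_add, Matrix.mulVec_mulVec, add_assoc]
  | cons A' b' rest =>
    simp only [precomp, realize, Matrix.mulVec_add, Matrix.mulVec_mulVec, add_assoc]

theorem realize_concat {m k l : ℕ} (Φ₂ : NN m k) (Φ₁ : NN k l) (x : Fin m → ℝ) :
    (concat Φ₁ Φ₂).realize x = Φ₁.realize (Φ₂.realize x) := by
  induction Φ₂ with
  | last A b => simp only [concat, realize, realize_precomp]
  | cons A b rest ih => simp only [concat, realize, ih]

theorem realize_idTwo {n : ℕ} (x : Fin n → ℝ) : (idTwo n).realize x = x := by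
  ext i
  simp only [idTwo_eq, realize, add_zero, mergeMat_mulVec, splitMat_mulVec_castAdd,
    splitMat_mulVec_natAdd]
  simp [max_comm (0 : ℝ)]

theorem realize_sparseConcat {m k l : ℕ} (Φ₁ : NN k l) (Φ₂ : NN m k) (x : Fin m → ℝ) :
    (sparseConcat Φ₁ Φ₂).realize x = Φ₁.realize (Φ₂.realize x) := by
  rw [sparseConcat, realize_concat, realize_concat, realize_idTwo]

theorem depth_precomp {m k n : ℕ} (A : Matrix (Fin k) (Fin m) ℝ) (b : Fin k → ℝ) (Φ : NN k n) :
    (precomp A b Φ).depth = Φ.depth := by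
  cases Φ <;> rfl

theorem depth_concat {m k l : ℕ} (Φ₂ : NN m k) (Φ₁ : NN k l) :
    (concat Φ₁ Φ₂).depth + 1 = Φ₁.depth + Φ₂.depth := by
  induction Φ₂ with
  | last A b => simp only [concat, depth, depth_precomp]
  | cons A b rest ih => have := ih Φ₁; simp only [concat, depth]; omega

theorem depth_sparseConcat {m k l : ℕ} (Φ₁ : NN k l) (Φ₂ : NN m k) :
    (sparseConcat Φ₁ Φ₂).depth = Φ₁.depth + Φ₂.depth := by
  have h1 := depth_concat (concat (idTwo k) Φ₂) Φ₁
  have h2 := depth_concat Φ₂ (idTwo k)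
  have h3 : (idTwo k).depth = 2 := rfl
  rw [sparseConcat]
  omega

theorem size_precomp_mergeMat {k n : ℕ} (Φ : NN k n) :
    (precomp (mergeMat k) 0 Φ).size ≤ 2 * Φ.size := by
  cases Φ with
  | last A b =>
    simp only [precomp, size, nnzMat_mul_mergeMat, Matrix.mulVec_zero, zero_add]; omega
  | cons A b rest =>
    simp only [precomp, size, nnzMat_mul_mergeMat, Matrix.mulVec_zero, zero_add]; omega

/-- The inserted identity only duplicates, with both signs, the rows of the last layer of `Φ₂` and
the columns of the first layer of `Φ₁`. No product of two dense weight matrices arises, so there is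
no fill-in. -/
theorem size_sparseConcat {m k l : ℕ} (Φ₁ : NN k l) (Φ₂ : NN m k) :
    (sparseConcat Φ₁ Φ₂).size ≤ 2 * (Φ₁.size + Φ₂.size) := by
  induction Φ₂ with
  | last A b =>
    have := size_precomp_mergeMat Φ₁
    simp only [sparseConcat, idTwo_eq, concat, precomp, size, nnzMat_splitMat_mul,
      nnzVec_splitMat_mulVec] at this ⊢
    omega
  | cons A b rest ih =>
    have := ih Φ₁
    simp only [sparseConcat, concat, size] at this ⊢
    omega

theorem posWidths_precomp {m k n : ℕ} (A : Matrix (Fin k) (Fin m) ℝ) (b : Fin k → ℝ) (Φ : NN k n)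
    (h : Φ.PosWidths) : (precomp A b Φ).PosWidths := by
  cases Φ <;> exact h

theorem posWidths_concat {m k l : ℕ} (Φ₂ : NN m k) (Φ₁ : NN k l) (h₁ : Φ₁.PosWidths)
    (h₂ : Φ₂.PosWidths) : (concat Φ₁ Φ₂).PosWidths := by
  induction Φ₂ with
  | last A b => exact posWidths_precomp _ _ _ h₁
  | cons A b rest ih => exact ⟨h₂.1, ih _ h₁ h₂.2⟩

theorem pos_of_posWidths {m n : ℕ} (Φ : NN m n) (h : Φ.PosWidths) : 0 < n := by
  induction Φ with
  | last A b => exact h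
  | cons A b rest ih => exact ih h.2

theorem posWidths_sparseConcat {m k l : ℕ} (Φ₁ : NN k l) (Φ₂ : NN m k) (h₁ : Φ₁.PosWidths)
    (h₂ : Φ₂.PosWidths) : (sparseConcat Φ₁ Φ₂).PosWidths := by
  have hk := pos_of_posWidths Φ₂ h₂
  refine posWidths_concat _ _ h₁ (posWidths_concat _ _ ?_ h₂)
  exact ⟨by omega, hk⟩

/-- Scaling the last layer creates no new nonzero entries, so here the merging concatenation is
harmless. -/
theorem size_concat_smul {m n : ℕ} (c : ℝ) (Φ : NN m n) :
    (concat (last (c • (1 : Matrix (Fin n) (Fin n) ℝ)) 0) Φ).size ≤ Φ.size := by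
  induction Φ with
  | last A b =>
    simp only [concat, precomp, size, add_zero, Matrix.smul_mulVec, Matrix.one_mulVec,
      Matrix.smul_mul, Matrix.one_mul]
    gcongr
    · refine Finset.card_le_card fun ij h => ?_
      simp only [Finset.mem_filter, Finset.mem_univ, true_and, Matrix.smul_apply, smul_eq_mul] at h ⊢
      exact right_ne_zero_of_mul h
    · refine Finset.card_le_card fun ij h => ?_
      simp only [Finset.mem_filter, Finset.mem_univ, true_and, Pi.smul_apply, smul_eq_mul] at h ⊢
      exact right_ne_zero_of_mul h
  | cons A b rest ih => simpa only [concat, size] using Nat.add_le_add_left ih _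

end NN

/-! ## Functions realized by networks, with general index types -/

/-- The number of nonzero entries of a matrix with general index types. -/
def nnzM {ι κ : Type} [Fintype ι] [Fintype κ] (A : Matrix κ ι ℝ) : ℕ :=
  (Finset.univ.filter fun ij : κ × ι => A ij.1 ij.2 ≠ 0).card

/-- The number of nonzero entries of a vector with general index type. -/
def nnzV {κ : Type} [Fintype κ] (b : κ → ℝ) : ℕ := (Finset.univ.filter fun i => b i ≠ 0).card

theorem nnzV_le {κ : Type} [Fintype κ] (b : κ → ℝ) : nnzV b ≤ Fintype.card κ :=
  Finset.card_le_univ _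

/-- `f` is the realization of a network of depth `L` and size at most `W`, for every numbering
of the inputs and of the outputs. -/
def Realizes {ι κ : Type} [Fintype ι] [Fintype κ] (f : (ι → ℝ) → κ → ℝ) (L W : ℕ) : Prop :=
  ∀ (a b : ℕ) (ei : ι ≃ Fin a) (ek : κ ≃ Fin b), ∃ Φ : NN a b,
    (∀ x : ι → ℝ, Φ.realize (x ∘ ei.symm) = f x ∘ ek.symm) ∧ Φ.depth = L ∧ Φ.size ≤ W ∧
      Φ.PosWidths

theorem nnzMat_reindex {ι κ : Type} [Fintype ι] [Fintype κ] {a b : ℕ} (ei : ι ≃ Fin a)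
    (ek : κ ≃ Fin b) (A : Matrix κ ι ℝ) : nnzMat (Matrix.reindex ek ei A) = nnzM A := by
  refine (Finset.card_equiv (ek.prodCongr ei) fun ij => ?_).symm
  simp only [Finset.mem_filter, Finset.mem_univ, true_and]
  simp

theorem nnzVec_reindex {κ : Type} [Fintype κ] {b : ℕ} (ek : κ ≃ Fin b) (v : κ → ℝ) :
    nnzVec (v ∘ ek.symm) = nnzV v := by
  refine (Finset.card_equiv ek fun ij => ?_).symm
  simp only [Finset.mem_filter, Finset.mem_univ, true_and]
  simp

theorem reindex_mulVec {ι κ : Type} [Fintype ι] [Fintype κ] {a b : ℕ} (ei : ι ≃ Fin a)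
    (ek : κ ≃ Fin b) (A : Matrix κ ι ℝ) (x : ι → ℝ) :
    (Matrix.reindex ek ei A).mulVec (x ∘ ei.symm) = A.mulVec x ∘ ek.symm := by
  ext i
  simp only [Matrix.mulVec, dotProduct, Matrix.reindex_apply, Matrix.submatrix_apply,
    Function.comp_apply]
  exact Equiv.sum_comp ei.symm fun j => A (ek.symm i) j * x j

section
variable {ι κ μ : Type} [Fintype ι] [Fintype κ] [Fintype μ]

theorem realizes_affine [Nonempty κ] (A : Matrix κ ι ℝ) (v : κ → ℝ) :
    Realizes (fun x => A.mulVec x + v) 1 (nnzM A + nnzV v) := by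
  intro a b ei ek
  refine ⟨NN.last (Matrix.reindex ek ei A) (v ∘ ek.symm), fun x => ?_, rfl, ?_, ?_⟩
  · rw [NN.realize, reindex_mulVec]; rfl
  · rw [NN.size, nnzMat_reindex, nnzVec_reindex]
  · exact Fin.pos_iff_nonempty.mpr (ek.symm.nonempty)

theorem Realizes.layer [Nonempty κ] {g : (κ → ℝ) → μ → ℝ} {L W : ℕ} (hg : Realizes g L W)
    (A : Matrix κ ι ℝ) (v : κ → ℝ) :
    Realizes (fun x => g fun i => max 0 ((A.mulVec x + v) i)) (L + 1) (nnzM A + nnzV v + W) := by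
  intro a b ei ek
  obtain ⟨Φ, h1, h2, h3, h4⟩ := hg _ b (Fintype.equivFin κ) ek
  refine ⟨NN.cons (Matrix.reindex (Fintype.equivFin κ) ei A) (v ∘ (Fintype.equivFin κ).symm) Φ,
    fun x => ?_, ?_, ?_, ?_⟩
  · rw [NN.realize, reindex_mulVec, ← h1]; rfl
  · rw [NN.depth, h2]
  · rw [NN.size, nnzMat_reindex, nnzVec_reindex]; omega
  · exact ⟨Fintype.card_pos, h4⟩

theorem Realizes.comp {g : (κ → ℝ) → μ → ℝ} {f : (ι → ℝ) → κ → ℝ} {L W L' W' : ℕ}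
    (hg : Realizes g L W) (hf : Realizes f L' W') :
    Realizes (fun x => g (f x)) (L + L') (2 * (W + W')) := by
  intro a b ei ek
  obtain ⟨Φ, h1, h2, h3, h4⟩ := hg _ b (Fintype.equivFin κ) ek
  obtain ⟨Ψ, k1, k2, k3, k4⟩ := hf a _ ei (Fintype.equivFin κ)
  refine ⟨NN.sparseConcat Φ Ψ, fun x => ?_, ?_, ?_, NN.posWidths_sparseConcat _ _ h4 k4⟩
  · rw [NN.realize_sparseConcat, k1, h1]
  · rw [NN.depth_sparseConcat, h2, k2]
  · exact (NN.size_sparseConcat _ _).trans (by omega)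

theorem Realizes.mono {f : (ι → ℝ) → κ → ℝ} {L W W' : ℕ} (hf : Realizes f L W) (h : W ≤ W') :
    Realizes f L W' := by
  intro a b ei ek
  obtain ⟨Φ, h1, h2, h3, h4⟩ := hf a b ei ek
  exact ⟨Φ, h1, h2, h3.trans h, h4⟩

/-- A matrix with at most `t` nonzero entries in every row. -/
theorem nnzM_le_of_row (A : Matrix κ ι ℝ) (t : ℕ) (s : κ → Finset ι) (hs : ∀ r, (s r).card ≤ t)
    (h : ∀ r c, A r c ≠ 0 → c ∈ s r) : nnzM A ≤ t * Fintype.card κ := by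
  classical
  calc nnzM A ≤ (Finset.univ.sigma s).card := by
        refine Finset.card_le_card_of_injOn (fun ij => ⟨ij.1, ij.2⟩) (fun ij hij => ?_) ?_
        · simp only [Finset.coe_filter, Finset.mem_univ, true_and, Set.mem_ofPred_eq] at hij
          simpa using h _ _ hij
        · rintro ⟨i, j⟩ _ ⟨i', j'⟩ _ hij
          simpa using hij
    _ = ∑ r, (s r).card := Finset.card_sigma _ _
    _ ≤ ∑ _r : κ, t := Finset.sum_le_sum fun r _ => hs r
    _ = t * Fintype.card κ := by simp [mul_comm]

/-- A matrix with at most `t` nonzero entries in every column. -/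
theorem nnzM_le_of_col (A : Matrix κ ι ℝ) (t : ℕ) (s : ι → Finset κ) (hs : ∀ c, (s c).card ≤ t)
    (h : ∀ r c, A r c ≠ 0 → r ∈ s c) : nnzM A ≤ t * Fintype.card ι := by
  have h1 : nnzM A = nnzM A.transpose := by
    refine Finset.card_equiv (Equiv.prodComm κ ι) fun ij => ?_
    simp only [Finset.mem_filter, Finset.mem_univ, true_and]
    simp
  rw [h1]
  exact nnzM_le_of_row _ t s hs fun r c hrc => h c r hrc

end

/-! ## Approximate squaring -/

/-- The accumulator after `m` steps of `(x, a) ↦ (2|x| - 1, 4a + 4|x| - 1)`, a map that multiplies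
`a + x²` by four. -/
def sqAcc : ℕ → ℝ → ℝ → ℝ
  | 0, _, a => a
  | m + 1, x, a => sqAcc m (2 * |x| - 1) (4 * a + 4 * |x| - 1)

/-- The invariant is `(4a + 4|x| - 1) + (2|x| - 1)² = 4 (a + x²)`. The map `x ↦ 2|x| - 1` preserves
`[-1,1]`, and `y` is its last iterate; dividing by `4^m` makes its contribution negligible. -/
theorem exists_sqAcc_add_sq (m : ℕ) : ∀ x a : ℝ, |x| ≤ 1 →
    ∃ y : ℝ, |y| ≤ 1 ∧ sqAcc m x a + y ^ 2 = 4 ^ m * (a + x ^ 2) := by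
  induction m with
  | zero => intro x a hx; exact ⟨x, hx, by simp [sqAcc]⟩
  | succ m ih =>
    intro x a hx
    have h0 := abs_nonneg x
    obtain ⟨y, hy, h⟩ := ih (2 * |x| - 1) (4 * a + 4 * |x| - 1)
      (abs_le.mpr ⟨by linarith, by linarith⟩)
    refine ⟨y, hy, ?_⟩
    rw [sqAcc, h, pow_succ, ← sq_abs x]
    ring

/-- The approximation of `x²` by `m` steps of the iteration. -/
def sqApprox (m : ℕ) (x : ℝ) : ℝ := (4 ^ m)⁻¹ * sqAcc m x 0

theorem abs_sqApprox_sub_sq (m : ℕ) {x : ℝ} (hx : |x| ≤ 1) :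
    |sqApprox m x - x ^ 2| ≤ (4 ^ m)⁻¹ := by
  obtain ⟨y, hy, h⟩ := exists_sqAcc_add_sq m x 0 hx
  have h4 : (0 : ℝ) < 4 ^ m := by positivity
  have : sqApprox m x - x ^ 2 = -((4 ^ m)⁻¹ * y ^ 2) := by
    rw [sqApprox, eq_sub_of_add_eq h]
    field_simp
    ring
  rw [this, abs_neg, abs_of_nonneg (by positivity)]
  have : y ^ 2 ≤ 1 := by rw [← sq_abs]; exact pow_le_one₀ (abs_nonneg y) hy
  exact mul_le_of_le_one_right (by positivity) this

section
variable {ι κ I : Type} [Fintype ι] [Fintype I]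

/-- The positive and negative parts of `x` and `a`. -/
def splitParts (x a : I → ℝ) : I × Fin 4 → ℝ :=
  fun r => max 0 (![x r.1, -x r.1, a r.1, -a r.1] r.2)

/-- The weights of one squaring step, acting on positive and negative parts. -/
def sqLayer : Matrix (Fin 4) (Fin 4) ℝ := !![2, 2, 0, 0; -2, -2, 0, 0; 4, 4, 4, -4; -4, -4, -4, 4]

/-- The bias of one squaring step. -/
def sqBias : Fin 4 → ℝ := ![-1, 1, -1, 1]

theorem kronecker_mulVec_apply [DecidableEq I] (K : Matrix (Fin 4) (Fin 4) ℝ) (h : I × Fin 4 → ℝ)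
    (i : I) (s : Fin 4) :
    ((1 : Matrix I I ℝ) ⊗ₖ K).mulVec h (i, s) = ∑ t, K s t * h (i, t) := by
  simp [Matrix.mulVec, dotProduct, Fintype.sum_prod_type, Matrix.one_apply, ite_mul]

theorem max_zero_add_max_zero_neg (x : ℝ) : max 0 x + max 0 (-x) = |x| := by
  rcases le_total 0 x with h | h
  · rw [max_eq_right h, max_eq_left (by linarith), abs_of_nonneg h, add_zero]
  · rw [max_eq_left h, max_eq_right (by linarith), abs_of_nonpos h, zero_add]

theorem max_zero_sub_max_zero_neg (x : ℝ) : max 0 x - max 0 (-x) = x := by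
  rcases le_total 0 x with h | h
  · rw [max_eq_right h, max_eq_left (by linarith), sub_zero]
  · rw [max_eq_left h, max_eq_right (by linarith)]; ring

/-- Both `|x| = x⁺ + x⁻` and `a = a⁺ - a⁻` are linear in the nonnegative parts, so a single ReLU
layer performs one step. Rows and biases come in pairs of opposite sign because the next layer again
needs both parts. -/
theorem sqLayer_splitParts [DecidableEq I] (x a : I → ℝ) :
    (fun r => max 0 ((((1 : Matrix I I ℝ) ⊗ₖ sqLayer).mulVec (splitParts x a) +
      fun r : I × Fin 4 => sqBias r.2) r)) =
    splitParts (fun i => 2 * |x i| - 1) (fun i => 4 * a i + 4 * |x i| - 1) := by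
  ext ⟨i, s⟩
  rw [Pi.add_apply, kronecker_mulVec_apply]
  have h1 := max_zero_add_max_zero_neg (x i)
  have h2 := max_zero_sub_max_zero_neg (a i)
  simp only [splitParts, Fin.sum_univ_four]
  congr 1
  fin_cases s <;> simp [sqLayer, sqBias] <;> linarith

/-- The matrix that applies `D` to the differences of the parts of the accumulators. -/
def readOut (D : Matrix κ I ℝ) : Matrix κ (I × Fin 4) ℝ :=
  Matrix.of fun k r => D k r.1 * (![0, 0, 1, -1] : Fin 4 → ℝ) r.2

theorem readOut_splitParts (D : Matrix κ I ℝ) (x a : I → ℝ) :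
    (readOut D).mulVec (splitParts x a) = D.mulVec a := by
  ext k
  simp only [Matrix.mulVec, dotProduct, Fintype.sum_prod_type, Fin.sum_univ_four, readOut,
    splitParts, Matrix.of_apply]
  refine Finset.sum_congr rfl fun i _ => ?_
  have h2 := max_zero_sub_max_zero_neg (a i)
  simp
  rw [← sub_eq_add_neg, ← mul_sub, h2]

/-- The squaring network after its first layer, as a function. -/
def sqChain [DecidableEq I] (D : Matrix κ I ℝ) : ℕ → (I × Fin 4 → ℝ) → κ → ℝ
  | 0, h => (readOut D).mulVec h + 0
  | m + 1, h => sqChain D m fun r =>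
      max 0 ((((1 : Matrix I I ℝ) ⊗ₖ sqLayer).mulVec h + fun r : I × Fin 4 => sqBias r.2) r)

theorem sqChain_splitParts [DecidableEq I] (D : Matrix κ I ℝ) (m : ℕ) : ∀ x a : I → ℝ,
    sqChain D m (splitParts x a) = D.mulVec fun i => sqAcc m (x i) (a i) := by
  induction m with
  | zero => intro x a; rw [sqChain, readOut_splitParts, add_zero]; rfl
  | succ m ih => intro x a; rw [sqChain, sqLayer_splitParts, ih]; rfl

theorem nnzM_readOut [Fintype κ] (D : Matrix κ I ℝ) (t : ℕ) (s : I → Finset κ)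
    (hs : ∀ c, (s c).card ≤ t)
    (h : ∀ r c, D r c ≠ 0 → r ∈ s c) : nnzM (readOut D) ≤ 4 * (t * Fintype.card I) := by
  refine (nnzM_le_of_col _ t (fun r => s r.1) (fun r => hs r.1) fun r c hrc => ?_).trans ?_
  · exact h _ _ (left_ne_zero_of_mul hrc)
  · simp only [Fintype.card_prod, Fintype.card_fin]
    exact le_of_eq (by ring)

theorem nnzM_kronecker [DecidableEq I] :
    nnzM ((1 : Matrix I I ℝ) ⊗ₖ sqLayer) ≤ 4 * (4 * Fintype.card I) := by
  refine (nnzM_le_of_row _ 4 (fun r => {r.1} ×ˢ Finset.univ) (fun r => by simp)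
    fun r c hrc => ?_).trans ?_
  · rw [Matrix.kroneckerMap_apply] at hrc
    have := left_ne_zero_of_mul hrc
    have : r.1 = c.1 := by
      by_contra h
      exact this (Matrix.one_apply_ne h)
    simp [this]
  · simp only [Fintype.card_prod, Fintype.card_fin]
    exact le_of_eq (by ring)

/-- Each step costs at most 16 weights and 4 biases per index, whence the 20. -/
theorem realizes_sqChain [Fintype κ] [DecidableEq I] [Nonempty I] [Nonempty κ] (D : Matrix κ I ℝ) (t : ℕ)
    (s : I → Finset κ) (hs : ∀ c, (s c).card ≤ t) (h : ∀ r c, D r c ≠ 0 → r ∈ s c) (m : ℕ) :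
    Realizes (sqChain D m) (m + 1) (m * (20 * Fintype.card I) + 4 * (t * Fintype.card I)) := by
  induction m with
  | zero =>
    refine (realizes_affine (readOut D) 0).mono ?_
    have := nnzM_readOut D t s hs h
    have h0 : nnzV (0 : κ → ℝ) = 0 := by simp [nnzV]
    omega
  | succ m ih =>
    refine (ih.layer ((1 : Matrix I I ℝ) ⊗ₖ sqLayer) fun r : I × Fin 4 => sqBias r.2).mono ?_
    have h1 := nnzM_kronecker (I := I)
    have h2 := nnzV_le fun r : I × Fin 4 => sqBias r.2
    simp only [Fintype.card_prod, Fintype.card_fin] at h2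
    rw [add_mul]
    omega

/-- Networks for linear combinations of approximate squares of affine functions. -/
theorem realizes_sqBlock [Fintype κ] [Nonempty I] [Nonempty κ] (P : Matrix I ι ℝ) (q : I → ℝ)
    (D : Matrix κ I ℝ) (u : ℕ) (sP : I → Finset ι) (hsP : ∀ r, (sP r).card ≤ u)
    (hP : ∀ r c, P r c ≠ 0 → c ∈ sP r) (t : ℕ) (sD : I → Finset κ)
    (hsD : ∀ c, (sD c).card ≤ t) (hD : ∀ r c, D r c ≠ 0 → r ∈ sD c) (m : ℕ) :
    Realizes (fun z => D.mulVec fun i => sqApprox m ((P.mulVec z + q) i)) (m + 2)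
      ((4 * u + 4 + 20 * m + 4 * t) * Fintype.card I) := by
  classical
  -- The input layer feeds the two parts of the affine value and starts the accumulator at zero; the
  -- factor `4^(-m)` of `sqApprox` is absorbed into the output matrix.
  let v : Fin 4 → ℝ := ![1, -1, 0, 0]
  let A : Matrix (I × Fin 4) ι ℝ := Matrix.of fun r c => v r.2 * P r.1 c
  let b : I × Fin 4 → ℝ := fun r => v r.2 * q r.1
  have hD' : ∀ r c, (((4 : ℝ) ^ m)⁻¹ • D) r c ≠ 0 → r ∈ sD c := fun r c h =>
    hD r c (right_ne_zero_of_mul h)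
  have key := (realizes_sqChain (((4 : ℝ) ^ m)⁻¹ • D) t sD hsD hD' m).layer A b
  have hfun : (fun z => sqChain (((4 : ℝ) ^ m)⁻¹ • D) m fun i => max 0 ((A.mulVec z + b) i)) =
      fun z => D.mulVec fun i => sqApprox m ((P.mulVec z + q) i) := by
    funext z
    have h1 : (fun i => max 0 ((A.mulVec z + b) i)) = splitParts (P.mulVec z + q) 0 := by
      ext ⟨i, s⟩
      have : (A.mulVec z + b) (i, s) = v s * (P.mulVec z + q) i := by
        simp only [A, b, Pi.add_apply, Matrix.mulVec, dotProduct, Matrix.of_apply, mul_add,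
          Finset.mul_sum, mul_assoc]
      rw [this, splitParts]
      congr 1
      fin_cases s <;> simp [v]
    rw [h1, sqChain_splitParts, Matrix.smul_mulVec, ← Matrix.mulVec_smul]
    rfl
  rw [hfun] at key
  refine key.mono ?_
  have h1 : nnzM A ≤ u * Fintype.card (I × Fin 4) :=
    nnzM_le_of_row A u (fun r => sP r.1) (fun r => hsP r.1) fun r c h =>
      hP _ _ (right_ne_zero_of_mul h)
  have h2 := nnzV_le b
  simp only [Fintype.card_prod, Fintype.card_fin] at h1 h2
  nlinarith

end

/-! ## One step of the Neumann series iteration -/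

/-- The index type of a pair of matrices. -/
abbrev PairIdx (n : ℕ) : Type := Bool × Fin n × Fin n

/-- The pair of matrices with entries `z`. -/
def pairMat {n : ℕ} (z : PairIdx n → ℝ) (t : Bool) : Matrix (Fin n) (Fin n) ℝ :=
  Matrix.of fun i j => z (t, i, j)

/-- The index type of the products of entries in two products of matrices, with a sign. -/
abbrev ProdIdx (n : ℕ) : Type := Bool × Bool × Fin n × Fin n × Fin n

/-- The sign encoded by a Boolean. -/
def boolSign (s : Bool) : ℝ := if s then 1 else -1

/-- The weights that prepare the sums and differences of factors. -/
def prodIn (n : ℕ) (R : ℝ) : Matrix (ProdIdx n) (PairIdx n) ℝ :=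
  Matrix.of fun r c => (2 * R)⁻¹ * ((if c = (true, r.2.2.1, r.2.2.2.1) then 1 else 0) +
    boolSign r.2.1 * if c = (r.1, r.2.2.2.1, r.2.2.2.2) then 1 else 0)

/-- The bias that replaces the left factor `B` by `1 + B` in the first product. -/
def prodBias (n : ℕ) (R : ℝ) : ProdIdx n → ℝ :=
  fun r => (2 * R)⁻¹ * if r.1 = false ∧ r.2.2.1 = r.2.2.2.1 then 1 else 0

/-- The weights that sum up the products. -/
def prodOut (n : ℕ) (R : ℝ) : Matrix (PairIdx n) (ProdIdx n) ℝ :=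
  Matrix.of fun k r => R ^ 2 *
    if k = (r.1, r.2.2.1, r.2.2.2.2) then boolSign r.2.1 else 0

/-- One approximate step `(X, B) ↦ ((1 + B) X, B²)`. -/
def stepFun (n : ℕ) (R : ℝ) (m : ℕ) (z : PairIdx n → ℝ) : PairIdx n → ℝ :=
  (prodOut n R).mulVec fun i => sqApprox m (((prodIn n R).mulVec z + prodBias n R) i)

theorem realizes_stepFun (n : ℕ) [NeZero n] (R : ℝ) (m : ℕ) :
    Realizes (stepFun n R m) (m + 2) ((64 + 80 * m) * n ^ 3) := by
  classical
  -- There are `4 n³` squares, each reading two entries and feeding one: `(4·2 + 4 + 20m + 4·1)·4 =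
  -- 64 + 80m`.
  refine (realizes_sqBlock (prodIn n R) (prodBias n R) (prodOut n R) 2
    (fun r => {(true, r.2.2.1, r.2.2.2.1), (r.1, r.2.2.2.1, r.2.2.2.2)})
    (fun r => Finset.card_le_two) ?_ 1 (fun r => {(r.1, r.2.2.1, r.2.2.2.2)})
    (fun r => by simp) ?_ m).mono ?_
  · intro r c h
    by_contra hc
    simp only [Finset.mem_insert, Finset.mem_singleton, not_or] at hc
    apply h
    simp [prodIn, hc.1, hc.2]
  · intro k r h
    by_contra hc
    simp only [Finset.mem_singleton] at hc
    apply h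
    simp [prodOut, hc]
  · simp only [Fintype.card_prod, Fintype.card_bool, Fintype.card_fin]
    exact le_of_eq (by ring)

/-- The left factors of the two products. -/
def leftFactor {n : ℕ} (z : PairIdx n → ℝ) (t : Bool) : Matrix (Fin n) (Fin n) ℝ :=
  if t then pairMat z true else 1 + pairMat z true

/-- The component `true` of a pair carries `B`, the component `false` the partial sum `X`. The
scaling by `2R` brings `x ± y` into `[-1,1]`, where `sqApprox` is accurate, as soon as both factors
are bounded by `R`. -/
theorem prodIn_apply {n : ℕ} (R : ℝ) (z : PairIdx n → ℝ) (t s : Bool) (i j k : Fin n) :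
    ((prodIn n R).mulVec z + prodBias n R) (t, s, i, j, k) =
      (2 * R)⁻¹ * (leftFactor z t i j + boolSign s * pairMat z t j k) := by
  simp only [prodIn, prodBias, Pi.add_apply, Matrix.mulVec, dotProduct, Matrix.of_apply, mul_assoc,
    add_mul, ← Finset.mul_sum, Finset.sum_add_distrib, ite_mul, one_mul, zero_mul,
    Finset.sum_ite_eq', Finset.mem_univ, if_true]
  cases t
  · by_cases h : i = j
    · simp [leftFactor, pairMat, h]
      ring
    · simp [leftFactor, pairMat, h]
  · simp [leftFactor, pairMat]

theorem prodOut_apply {n : ℕ} (R : ℝ) (g : ProdIdx n → ℝ) (t : Bool) (i k : Fin n) :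
    (prodOut n R).mulVec g (t, i, k) =
      ∑ j, R ^ 2 * (g (t, true, i, j, k) - g (t, false, i, j, k)) := by
  simp only [prodOut, Matrix.mulVec, dotProduct, Matrix.of_apply, Fintype.sum_prod_type,
    Prod.mk.injEq, ite_and, mul_ite, ite_mul, mul_zero, zero_mul]
  cases t <;> simp [boolSign, mul_add, Finset.sum_add_distrib, sub_eq_add_neg]

/-- By polarization, a scalar product is off by at most `R²` times two squaring errors, and each
matrix entry sums `n` such products. -/
theorem abs_stepFun_sub {n : ℕ} {R : ℝ} (hR : 0 < R) (m : ℕ) (z : PairIdx n → ℝ) (t : Bool)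
    (hl : ∀ i j, |leftFactor z t i j| ≤ R) (hr : ∀ i j, |pairMat z t i j| ≤ R) (i k : Fin n) :
    |(pairMat (stepFun n R m z) t - leftFactor z t * pairMat z t) i k| ≤
      2 * n * R ^ 2 * (4 ^ m)⁻¹ := by
  rw [Matrix.sub_apply, Matrix.mul_apply]
  change |stepFun n R m z (t, i, k) - _| ≤ _
  rw [stepFun, prodOut_apply, ← Finset.sum_sub_distrib]
  refine (Finset.abs_sum_le_sum_abs _ _).trans ?_
  have hj : ∀ j : Fin n, |R ^ 2 * (sqApprox m (((prodIn n R).mulVec z + prodBias n R)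
      (t, true, i, j, k)) - sqApprox m (((prodIn n R).mulVec z + prodBias n R)
      (t, false, i, j, k))) - leftFactor z t i j * pairMat z t j k| ≤ 2 * R ^ 2 * (4 ^ m)⁻¹ := by
    intro j
    rw [prodIn_apply, prodIn_apply]
    set x := leftFactor z t i j
    set y := pairMat z t j k
    have hx := abs_le.mp (hl i j)
    have hy := abs_le.mp (hr j k)
    have hs : ∀ w : ℝ, |w| ≤ 2 * R → |(2 * R)⁻¹ * w| ≤ 1 := by
      intro w hw
      rw [abs_mul, abs_of_pos (by positivity), inv_mul_le_iff₀ (by positivity), mul_one]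
      exact hw
    have h1 := abs_sqApprox_sub_sq m (hs (x + boolSign true * y)
      (abs_le.mpr ⟨by simp [boolSign]; linarith, by simp [boolSign]; linarith⟩))
    have h2 := abs_sqApprox_sub_sq m (hs (x + boolSign false * y)
      (abs_le.mpr ⟨by simp [boolSign]; linarith, by simp [boolSign]; linarith⟩))
    set p := sqApprox m ((2 * R)⁻¹ * (x + boolSign true * y))
    set q := sqApprox m ((2 * R)⁻¹ * (x + boolSign false * y))
    have he : R ^ 2 * (p - q) - x * y = R ^ 2 * ((p - ((2 * R)⁻¹ * (x + boolSign true * y)) ^ 2) -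
        (q - ((2 * R)⁻¹ * (x + boolSign false * y)) ^ 2)) := by
      simp only [boolSign]
      field_simp
      simp
      ring
    rw [he, abs_mul, abs_of_pos (by positivity : 0 < R ^ 2)]
    have := abs_sub (p - ((2 * R)⁻¹ * (x + boolSign true * y)) ^ 2)
        (q - ((2 * R)⁻¹ * (x + boolSign false * y)) ^ 2)
    nlinarith [sq_nonneg R]
  refine (Finset.sum_le_sum fun j _ => hj j).trans (le_of_eq ?_)
  simp
  ring

/-! ## The spectral norm -/

theorem norm_le_of_sum_sq_mulVec_le {n : ℕ} (A : Matrix (Fin n) (Fin n) ℝ) {K : ℝ} (hK : 0 ≤ K)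
    (h : ∀ x : Fin n → ℝ, ∑ i, (A.mulVec x i) ^ 2 ≤ K ^ 2 * ∑ i, x i ^ 2) : ‖A‖ ≤ K := by
  rw [← Matrix.l2_opNorm_toEuclideanCLM]
  refine ContinuousLinearMap.opNorm_le_bound _ hK fun x => ?_
  refine le_of_sq_le_sq ?_ (by positivity)
  have := h x.ofLp
  rw [mul_pow, EuclideanSpace.norm_sq_eq, EuclideanSpace.norm_sq_eq]
  simpa using this

theorem norm_le_of_abs_entry_le {n : ℕ} (A : Matrix (Fin n) (Fin n) ℝ) {c : ℝ} (hc : 0 ≤ c)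
    (h : ∀ i j, |A i j| ≤ c) : ‖A‖ ≤ n * c := by
  refine norm_le_of_sum_sq_mulVec_le A (by positivity) fun x => ?_
  have hi : ∀ i, (A.mulVec x i) ^ 2 ≤ (n * c ^ 2) * ∑ j, x j ^ 2 := by
    intro i
    refine (Finset.sum_mul_sq_le_sq_mul_sq Finset.univ (fun j => A i j) x).trans ?_
    refine mul_le_mul_of_nonneg_right ?_ (Finset.sum_nonneg fun j _ => sq_nonneg _)
    refine (Finset.sum_le_sum fun (j : Fin n) _ => (?_ : A i j ^ 2 ≤ c ^ 2)).trans_eq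
      (by simp : ∑ _j : Fin n, c ^ 2 = n * c ^ 2)
    rw [← sq_abs]
    exact pow_le_pow_left₀ (abs_nonneg _) (h i j) 2
  refine (Finset.sum_le_sum fun i _ => hi i).trans_eq ?_
  simp
  ring

theorem abs_entry_le_norm {n : ℕ} (A : Matrix (Fin n) (Fin n) ℝ) (i j : Fin n) :
    |A i j| ≤ ‖A‖ := by
  have h := Matrix.l2_opNorm_mulVec A (EuclideanSpace.single j (1 : ℝ))
  simp only [PiLp.norm_single, norm_one, mul_one] at h
  refine le_trans ?_ h
  refine le_trans (le_of_eq ?_) (PiLp.norm_apply_le _ i)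
  simp

/-! ## The Neumann series of a matrix with decaying powers -/

/-- Only the decay of the powers enters, not `‖B‖ < 1`; this is what admits matrices that contract
merely in an equivalent norm. The series converges absolutely and the tail is geometric. -/
theorem isUnit_one_sub_and_norm_inv_sub_le {n : ℕ} (B : Matrix (Fin n) (Fin n) ℝ) {M ρ : ℝ}
    (hρ0 : 0 ≤ ρ) (hρ1 : ρ < 1) (hB : ∀ k : ℕ, ‖B ^ k‖ ≤ M * ρ ^ k) (K : ℕ) :
    IsUnit (1 - B) ∧
      ‖(1 - B)⁻¹ - ∑ k ∈ Finset.range K, B ^ k‖ ≤ M * ρ ^ K * (1 - ρ)⁻¹ := by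
  have hgeo := summable_geometric_of_lt_one hρ0 hρ1
  have hs : Summable (B ^ · : ℕ → Matrix (Fin n) (Fin n) ℝ) :=
    Summable.of_norm_bounded (hgeo.mul_left M) hB
  have h1 := hs.tsum_pow_mul_one_sub
  have hu : IsUnit (1 - B) := IsUnit.of_mul_eq_one_right _ h1
  refine ⟨hu, ?_⟩
  rw [Matrix.inv_eq_left_inv h1, ← hs.sum_add_tsum_nat_add K, add_sub_cancel_left]
  have hsum : HasSum (fun k => M * ρ ^ K * ρ ^ k) (M * ρ ^ K * (1 - ρ)⁻¹) :=
    (hasSum_geometric_of_lt_one hρ0 hρ1).mul_left _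
  refine tsum_of_norm_bounded hsum fun k => (hB (k + K)).trans_eq ?_
  rw [pow_add]
  ring

theorem norm_geom_sum_le {n : ℕ} (B : Matrix (Fin n) (Fin n) ℝ) {M ρ : ℝ}
    (hρ0 : 0 ≤ ρ) (hρ1 : ρ < 1) (hM : 0 ≤ M) (hB : ∀ k : ℕ, ‖B ^ k‖ ≤ M * ρ ^ k) (K : ℕ) :
    ‖∑ k ∈ Finset.range K, B ^ k‖ ≤ M * (1 - ρ)⁻¹ := by
  refine (norm_sum_le _ _).trans ((Finset.sum_le_sum fun k _ => hB k).trans ?_)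
  rw [← Finset.mul_sum, ← tsum_geometric_of_lt_one hρ0 hρ1]
  gcongr
  exact (summable_geometric_of_lt_one hρ0 hρ1).sum_le_tsum _ fun k _ => by positivity

/-- The second half of the sum is `B^(2^j)` times the first half, so one step `X ↦ (1 + B^(2^j)) X`
doubles the number of terms. -/
theorem geom_sum_two_pow_succ {n : ℕ} (B : Matrix (Fin n) (Fin n) ℝ) (j : ℕ) :
    ∑ k ∈ Finset.range (2 ^ (j + 1)), B ^ k =
      (1 + B ^ 2 ^ j) * ∑ k ∈ Finset.range (2 ^ j), B ^ k := by
  rw [pow_succ, mul_two, Finset.sum_range_add, add_mul, one_mul, Finset.mul_sum]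
  simp only [pow_add]

/-! ## The approximate iteration -/

/-- The initial pair `(1, B)`. -/
def initPair {n : ℕ} (B : Matrix (Fin n) (Fin n) ℝ) : PairIdx n → ℝ :=
  fun r => if r.1 then B r.2.1 r.2.2 else (1 : Matrix (Fin n) (Fin n) ℝ) r.2.1 r.2.2

theorem norm_stepFun_sub_le {n : ℕ} {R : ℝ} (hR : 0 < R) (m : ℕ) (z : PairIdx n → ℝ)
    (hB : ‖pairMat z true‖ ≤ R) (hB' : ‖1 + pairMat z true‖ ≤ R) (hX : ‖pairMat z false‖ ≤ R)
    (t : Bool) :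
    ‖pairMat (stepFun n R m z) t - leftFactor z t * pairMat z t‖ ≤
      2 * n ^ 2 * R ^ 2 * (4 ^ m)⁻¹ := by
  refine (norm_le_of_abs_entry_le _ (by positivity) (abs_stepFun_sub hR m z t ?_ ?_)).trans_eq
    (by ring)
  · intro i j
    refine (abs_entry_le_norm _ i j).trans ?_
    cases t
    · simpa [leftFactor] using hB'
    · simpa [leftFactor] using hB
  · intro i j
    refine (abs_entry_le_norm _ i j).trans ?_
    cases t <;> assumption

theorem norm_mul_sub_mul_le {n : ℕ} (A A' X X' : Matrix (Fin n) (Fin n) ℝ) :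
    ‖A' * X' - A * X‖ ≤ ‖A' - A‖ * ‖X'‖ + ‖A‖ * ‖X' - X‖ := by
  have : A' * X' - A * X = (A' - A) * X' + A * (X' - X) := by noncomm_ring
  rw [this]
  exact (norm_add_le _ _).trans (add_le_add (norm_mul_le _ _) (norm_mul_le _ _))

theorem norm_matrix_one_le {n : ℕ} : ‖(1 : Matrix (Fin n) (Fin n) ℝ)‖ ≤ 1 :=
  norm_le_of_sum_sq_mulVec_le _ zero_le_one fun x => by simp

/-- A perturbation argument with `η` the error of a single step. The smallness assumption keeps
every accumulated error below 1, and the margins `+2` and `+1` then keep the perturbed `B^(2^j)`, `1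
+ B^(2^j)` and `X` within radius `R`, so that the one-step estimate applies again. -/
theorem norm_iterate_stepFun_sub_le {n : ℕ} {R : ℝ} (hR : 1 ≤ R) (m J : ℕ)
    (B : Matrix (Fin n) (Fin n) ℝ) (hB : ∀ k, ‖B ^ k‖ + 2 ≤ R)
    (hX : ∀ K, ‖∑ k ∈ Finset.range K, B ^ k‖ + 1 ≤ R)
    (hη : 2 * n ^ 2 * R ^ 2 * (4 ^ m)⁻¹ * (3 * R) ^ J ≤ 1) (j : ℕ) (hj : j ≤ J) :
    ‖pairMat ((stepFun n R m)^[j] (initPair B)) false - ∑ k ∈ Finset.range (2 ^ j), B ^ k‖ ≤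
        2 * n ^ 2 * R ^ 2 * (4 ^ m)⁻¹ * (3 * R) ^ j ∧
      ‖pairMat ((stepFun n R m)^[j] (initPair B)) true - B ^ 2 ^ j‖ ≤
        2 * n ^ 2 * R ^ 2 * (4 ^ m)⁻¹ * (3 * R) ^ j := by
  set η : ℝ := 2 * n ^ 2 * R ^ 2 * (4 ^ m)⁻¹ with hηdef
  have hη0 : 0 ≤ η := by positivity
  induction j with
  | zero =>
    have h1 : pairMat (initPair B) false = 1 := by ext i j; simp [pairMat, initPair]
    have h2 : pairMat (initPair B) true = B := by ext i j; simp [pairMat, initPair]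
    simp [h1, h2, hη0]
  | succ j ih =>
    obtain ⟨ih1, ih2⟩ := ih (by omega)
    rw [Function.iterate_succ_apply']
    set z := (stepFun n R m)^[j] (initPair B)
    set X := ∑ k ∈ Finset.range (2 ^ j), B ^ k with hXdef
    set b := B ^ 2 ^ j with hbdef
    set e := η * (3 * R) ^ j with hedef
    have he0 : 0 ≤ e := by positivity
    have he1 : e ≤ 1 := by
      refine le_trans (mul_le_mul_of_nonneg_left (pow_le_pow_right₀ ?_ ?_) hη0) hη
      · linarith
      · omega
    have hηe : η ≤ e := le_mul_of_one_le_right hη0 (one_le_pow₀ (by linarith))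
    have hbn : ‖b‖ + 2 ≤ R := hB _
    have hXn : ‖X‖ + 1 ≤ R := hX _
    have hb' : ‖pairMat z true‖ ≤ ‖b‖ + 1 := by
      have := norm_add_le b (pairMat z true - b)
      rw [add_sub_cancel] at this
      linarith
    have hX' : ‖pairMat z false‖ ≤ ‖X‖ + 1 := by
      have := norm_add_le X (pairMat z false - X)
      rw [add_sub_cancel] at this
      linarith
    have h1b : ‖1 + pairMat z true‖ ≤ R := by
      have := norm_add_le 1 (pairMat z true)
      have := norm_matrix_one_le (n := n)
      linarith
    have h1b' : ‖1 + b‖ ≤ R := by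
      have := norm_add_le 1 b
      have := norm_matrix_one_le (n := n)
      linarith
    have hstep := norm_stepFun_sub_le (by linarith) m z (by linarith) h1b (by linarith)
    -- The inherited error is amplified by at most `2R`; the new error is bounded by `η ≤ e ≤ R e`,
    -- so `3R` per step suffices.
    have hee : η + (e * R + R * e) ≤ η * (3 * R) ^ (j + 1) := by
      have : η * (3 * R) ^ (j + 1) = 3 * R * e := by rw [hedef]; ring
      nlinarith
    constructor
    · have h1 := hstep false
      have h2 := norm_mul_sub_mul_le (1 + b) (1 + pairMat z true) X (pairMat z false)
      rw [add_sub_add_left_eq_sub] at h2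
      simp only [leftFactor, Bool.false_eq_true, if_false] at h1
      rw [geom_sum_two_pow_succ, ← sub_add_sub_cancel _ ((1 + pairMat z true) * pairMat z false) _]
      refine (norm_add_le _ _).trans (le_trans (add_le_add h1 (h2.trans ?_)) hee)
      gcongr
      linarith
    · have h1 := hstep true
      have h2 := norm_mul_sub_mul_le b (pairMat z true) b (pairMat z true)
      simp only [leftFactor, if_true] at h1
      rw [pow_succ 2 j, mul_two, pow_add,
        ← sub_add_sub_cancel _ (pairMat z true * pairMat z true) _]
      refine (norm_add_le _ _).trans (le_trans (add_le_add h1 (h2.trans ?_)) hee)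
      gcongr
      · linarith
      · linarith

/-! ## The inversion networks -/

/-- The approximate sum of `2 ^ J` terms of the Neumann series, with entries indexed by pairs. -/
def neumannFun (n : ℕ) (R : ℝ) (m J : ℕ) (x : Fin n × Fin n → ℝ) : Fin n × Fin n → ℝ :=
  fun r => (stepFun n R m)^[J] (initPair (Matrix.of fun i j => x (i, j))) (false, r)

theorem realizes_initPair (n : ℕ) [NeZero n] :
    Realizes (fun x : Fin n × Fin n → ℝ => initPair (Matrix.of fun i j => x (i, j))) 1
      (3 * n ^ 2) := by
  classical
  let A : Matrix (PairIdx n) (Fin n × Fin n) ℝ := Matrix.of fun r c => if r = (true, c) then 1 else 0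
  let v : PairIdx n → ℝ := fun r => if r.1 = false ∧ r.2.1 = r.2.2 then 1 else 0
  have hf : (fun x : Fin n × Fin n → ℝ => initPair (Matrix.of fun i j => x (i, j))) =
      fun x => A.mulVec x + v := by
    funext x
    ext ⟨t, i, j⟩
    cases t
    · simp [initPair, A, v, Matrix.mulVec, dotProduct, Matrix.one_apply]
    · simp [initPair, A, v, Matrix.mulVec, dotProduct]
  rw [hf]
  refine (realizes_affine A v).mono ?_
  have h1 : nnzM A ≤ 1 * Fintype.card (Fin n × Fin n) :=
    nnzM_le_of_col A 1 (fun c => {(true, c)}) (fun c => by simp) fun r c h => by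
      by_contra hc
      simp only [Finset.mem_singleton] at hc
      simp [A, hc] at h
  have h2 := nnzV_le v
  simp only [Fintype.card_prod, Fintype.card_bool, Fintype.card_fin] at h1 h2
  nlinarith

theorem realizes_first (n : ℕ) [NeZero n] :
    Realizes (fun (z : PairIdx n → ℝ) (r : Fin n × Fin n) => z (false, r)) 1 (n ^ 2) := by
  classical
  let A : Matrix (Fin n × Fin n) (PairIdx n) ℝ := Matrix.of fun r c => if c = (false, r) then 1 else 0
  have hf : (fun (z : PairIdx n → ℝ) (r : Fin n × Fin n) => z (false, r)) =
      fun z => A.mulVec z + 0 := by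
    funext z
    ext ⟨i, j⟩
    simp [A, Matrix.mulVec, dotProduct]
  rw [hf]
  refine (realizes_affine A 0).mono ?_
  have h1 : nnzM A ≤ 1 * Fintype.card (Fin n × Fin n) :=
    nnzM_le_of_row A 1 (fun c => {(false, c)}) (fun c => by simp) fun r c h => by
      by_contra hc
      simp only [Finset.mem_singleton] at hc
      simp [A, hc] at h
  have h0 : nnzV (0 : Fin n × Fin n → ℝ) = 0 := by simp [nnzV]
  simp only [Fintype.card_prod, Fintype.card_fin] at h1
  nlinarith

/-- The size is the solution of the recursion `W ↦ 2 (w + W)`, with `w` the size of one step. The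
resulting factor `2^J` is the number of series terms. -/
theorem realizes_iterate (n : ℕ) [NeZero n] (R : ℝ) (m J : ℕ) :
    Realizes (fun x : Fin n × Fin n → ℝ =>
        (stepFun n R m)^[J] (initPair (Matrix.of fun i j => x (i, j))))
      (J * (m + 2) + 1) (2 ^ J * (3 * n ^ 2 + 2 * ((64 + 80 * m) * n ^ 3)) -
        2 * ((64 + 80 * m) * n ^ 3)) := by
  induction J with
  | zero => simpa using realizes_initPair n
  | succ J ih =>
    simp only [Function.iterate_succ_apply']
    have h := (realizes_stepFun n R m).comp ih
    have hd : m + 2 + (J * (m + 2) + 1) = (J + 1) * (m + 2) + 1 := by ring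
    rw [hd] at h
    refine h.mono ?_
    set W := (64 + 80 * m) * n ^ 3
    -- This ensures that the subtraction of natural numbers is not truncated.
    have h1 : 1 * (3 * n ^ 2 + 2 * W) ≤ 2 ^ J * (3 * n ^ 2 + 2 * W) :=
      Nat.mul_le_mul_right _ Nat.one_le_two_pow
    have : 2 ^ (J + 1) * (3 * n ^ 2 + 2 * W) = 2 * (2 ^ J * (3 * n ^ 2 + 2 * W)) := by ring
    rw [this]
    omega

theorem realizes_neumannFun (n : ℕ) [NeZero n] (R : ℝ) (m J : ℕ) :
    Realizes (neumannFun n R m J) (J * (m + 2) + 2) (2 ^ J * ((264 + 320 * m) * n ^ 3)) := by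
  have h := (realizes_first n).comp (realizes_iterate n R m J)
  have hd : 1 + (J * (m + 2) + 1) = J * (m + 2) + 2 := by ring
  rw [hd] at h
  refine h.mono ?_
  have hn : n ^ 2 ≤ n ^ 3 := Nat.pow_le_pow_right (NeZero.pos n) (by norm_num)
  have h2 : 1 ≤ 2 ^ J := Nat.one_le_two_pow
  calc _ ≤ 2 * (2 ^ J * n ^ 2 + 2 ^ J * (3 * n ^ 2 + 2 * ((64 + 80 * m) * n ^ 3))) := by
        have : 1 * n ^ 2 ≤ 2 ^ J * n ^ 2 := Nat.mul_le_mul_right _ h2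
        omega
    _ = 2 ^ J * (8 * n ^ 2 + (256 + 320 * m) * n ^ 3) := by ring
    _ ≤ 2 ^ J * (8 * n ^ 3 + (256 + 320 * m) * n ^ 3) := by gcongr
    _ = _ := by ring

theorem exists_neumann_net (n : ℕ) [NeZero n] {R : ℝ} (hR : 1 ≤ R) (m J : ℕ)
    (hη : 2 * n ^ 2 * R ^ 2 * (4 ^ m)⁻¹ * (3 * R) ^ J ≤ 1) :
    ∃ Ψ : NN (n * n) (n * n), Ψ.PosWidths ∧ Ψ.depth = J * (m + 2) + 2 ∧
      Ψ.size ≤ 2 ^ J * ((264 + 320 * m) * n ^ 3) ∧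
      ∀ B : Matrix (Fin n) (Fin n) ℝ, (∀ k, ‖B ^ k‖ + 2 ≤ R) →
        (∀ K, ‖∑ k ∈ Finset.range K, B ^ k‖ + 1 ≤ R) →
        ‖matM (Ψ.realize (vecM B)) - ∑ k ∈ Finset.range (2 ^ J), B ^ k‖ ≤
          2 * n ^ 2 * R ^ 2 * (4 ^ m)⁻¹ * (3 * R) ^ J := by
  -- The swap reflects column stacking: entry `(i, j)` is numbered by `(j, i)`.
  let e : Fin n × Fin n ≃ Fin (n * n) := (Equiv.prodComm _ _).trans finProdFinEquiv
  obtain ⟨Ψ, h1, h2, h3, h4⟩ := realizes_neumannFun n R m J _ _ e e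
  refine ⟨Ψ, h4, h2, h3, fun B hB hX => ?_⟩
  have hv : vecM B = (fun r : Fin n × Fin n => B r.1 r.2) ∘ e.symm := rfl
  have hm : matM (Ψ.realize (vecM B)) =
      pairMat ((stepFun n R m)^[J] (initPair B)) false := by
    rw [hv, h1]
    ext i j
    simp only [matM, Matrix.of_apply, Function.comp_apply, neumannFun, pairMat]
    have : e.symm (finProdFinEquiv (j, i)) = (i, j) := by simp [e]
    rw [this]
    rfl
  rw [hm]
  exact (norm_iterate_stepFun_sub_le hR m J B hB hX hη J le_rfl).1

/-! ## Choice of the parameters -/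

/-- Needed because the depth contains `J² log n`, with `J` itself logarithmic: it makes `J²` at most
linear in the quantities whose logarithms bound `J`. -/
theorem log_le_two_mul_sqrt {x : ℝ} (hx : 1 ≤ x) : Real.log x ≤ 2 * √x := by
  have h := Real.log_le_sub_one_of_pos (Real.sqrt_pos.mpr (by linarith : 0 < x))
  rw [Real.log_sqrt (by linarith)] at h
  linarith

/-- The numbers of squarings in the Neumann product. -/
theorem exists_nat_two_pow_near {c E N : ℝ} (hc : 1 ≤ c) (hE : 1 ≤ E) (hN : 1 ≤ N) :
    ∃ J : ℕ, c * E * N ≤ 2 ^ J ∧ (2 : ℝ) ^ J ≤ 2 * c * E * N ∧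
      (J : ℝ) ≤ 1 + 2 * (Real.log c + Real.log E + Real.log N) := by
  have h1 : 1 ≤ c * E * N := one_le_mul_of_one_le_of_one_le (one_le_mul_of_one_le_of_one_le hc hE) hN
  obtain ⟨k, hk1, hk2⟩ := exists_nat_pow_near h1 (by norm_num : (1 : ℝ) < 2)
  refine ⟨k + 1, hk2.le, by rw [pow_succ]; linarith, ?_⟩
  have h := Real.log_le_log (by positivity) hk1
  rw [Real.log_pow, Real.log_mul (by positivity) (by positivity),
    Real.log_mul (by positivity) (by positivity)] at h
  -- Since `log 2 > 1/2`, the exponent is at most twice the natural logarithm.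
  have h2 := Real.log_two_gt_d9
  have h3 : (0 : ℝ) ≤ k := by positivity
  push_cast
  nlinarith

theorem exists_nat_four_pow_near {T : ℝ} (hT : 1 ≤ T) :
    ∃ m : ℕ, T ≤ 4 ^ m ∧ (m : ℝ) ≤ 1 + Real.log T := by
  obtain ⟨k, hk1, hk2⟩ := exists_nat_pow_near hT (by norm_num : (1 : ℝ) < 4)
  refine ⟨k + 1, hk2.le, ?_⟩
  have h := Real.log_le_log (by positivity) hk1
  rw [Real.log_pow, (by norm_num : (4 : ℝ) = 2 ^ 2), Real.log_pow] at h
  have h2 := Real.log_two_gt_d9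
  have h3 : (0 : ℝ) ≤ k := by positivity
  push_cast at h ⊢
  nlinarith

/-- Bounds for the depth and the size by the factors in the complexity estimates; here `E = 1 + |log ε|`,
`N = 1 + log n`, `G = 1 + log E + log n` and `H = E + log n + log E`. -/
theorem depth_and_size_bounds {c₁ c₂ : ℝ} (hc₁ : 1 ≤ c₁) (hc₂ : 0 ≤ c₂) :
    ∃ C : ℝ, 0 < C ∧ ∀ (E N J m : ℝ), 1 ≤ E → 1 ≤ N → 0 ≤ J → 0 ≤ m →
      J ≤ 1 + 2 * (Real.log c₁ + Real.log E + Real.log N) →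
      m ≤ 1 + (2 * N + (J + 2) * (c₂ * N) + E) →
      J * (m + 2) + 2 ≤ C * (Real.log E + N) * (E + (N - 1) + Real.log E) ∧
      2 * c₁ * E * N * (264 + 320 * m) ≤
        C * E * (Real.log E + N) ^ 2 * (E + (N - 1) + Real.log E) := by
  have hl := Real.log_nonneg hc₁
  set c₄ := 3 + 2 * Real.log c₁ with hc₄
  set c₆ := 5 + 2 * Real.log c₁ with hc₆
  set c₈ := 4 + 2 * c₂ with hc₈
  have h4 : 0 < c₄ := by positivity
  have h6 : 0 < c₆ := by positivity
  have h8 : 0 < c₈ := by positivity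
  clear_value c₄ c₆ c₈
  -- The first group of constants serves the depth, the last summand the size.
  refine ⟨(2 * c₈ * c₄ + 4 * c₈ * c₆ ^ 2 + 2) + 2 * c₁ * (264 + 320 * (c₈ * (2 + c₄))),
    by positivity, ?_⟩
  intro E N J m hE hN hJ0 hm0 hJ hm
  have hlE := Real.log_nonneg hE
  have hlN := Real.log_nonneg hN
  have hlN' := Real.log_le_sub_one_of_pos (by linarith : 0 < N)
  set G := Real.log E + N with hG
  set H := E + (N - 1) + Real.log E with hH
  clear_value G H
  have hG1 : 1 ≤ G := by linarith
  have hGN : N ≤ G := by linarith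
  have hHE : E ≤ H := by linarith
  have hHN : N ≤ H := by linarith
  have hH1 : 1 ≤ H := by linarith
  have hJG : J ≤ c₄ * G := by
    have : Real.log c₁ ≤ Real.log c₁ * G := le_mul_of_one_le_right hl hG1
    rw [hc₄]
    nlinarith
  have hJ2 : J ^ 2 ≤ 2 * c₆ ^ 2 * (E + N) := by
    have h1 := log_le_two_mul_sqrt hE
    have h2 := log_le_two_mul_sqrt hN
    have h3 : 1 ≤ √E := Real.one_le_sqrt.mpr hE
    have h3' : 1 ≤ √N := Real.one_le_sqrt.mpr hN
    have h5 : J ≤ c₆ * (√E + √N) := by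
      have : Real.log c₁ ≤ Real.log c₁ * √E := le_mul_of_one_le_right hl h3
      have : 0 ≤ Real.log c₁ * √N := by positivity
      rw [hc₆]
      nlinarith
    have h7 : J ^ 2 ≤ (c₆ * (√E + √N)) ^ 2 := pow_le_pow_left₀ hJ0 h5 2
    have h9 := Real.sq_sqrt (by linarith : 0 ≤ E)
    have h10 := Real.sq_sqrt (by linarith : 0 ≤ N)
    have h11 : (√E + √N) ^ 2 ≤ 2 * (E + N) := by nlinarith [sq_nonneg (√E - √N)]
    calc J ^ 2 ≤ c₆ ^ 2 * (√E + √N) ^ 2 := by rw [← mul_pow]; exact h7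
      _ ≤ c₆ ^ 2 * (2 * (E + N)) := by gcongr
      _ = _ := by ring
  have hm2 : m + 2 ≤ c₈ * (E + N + J * N) := by
    have : 0 ≤ J * N := by positivity
    rw [hc₈]
    nlinarith [mul_nonneg hc₂ (by linarith : 0 ≤ E)]
  have hNG : N ≤ G * H := by nlinarith
  have hEG : E ≤ G * H := by nlinarith
  have hJN : J * N ≤ c₄ * (G * H) := by
    calc J * N ≤ (c₄ * G) * H := by gcongr
      _ = _ := by ring
  have hJE : J * E ≤ c₄ * (G * H) := by
    calc J * E ≤ (c₄ * G) * H := by gcongr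
      _ = _ := by ring
  -- The critical term of the depth: `N` is charged to `G`, and `J²`, at most linear in `E + N`, is
  -- charged to `H`.
  have hJJN : J ^ 2 * N ≤ 4 * c₆ ^ 2 * (G * H) := by
    calc J ^ 2 * N ≤ (2 * c₆ ^ 2 * (E + N)) * G := by gcongr
      _ ≤ (2 * c₆ ^ 2 * (H + H)) * G := by gcongr
      _ = _ := by ring
  have hGH1 : 1 ≤ G * H := by nlinarith
  constructor
  · have h1 : J * (m + 2) ≤ (2 * c₈ * c₄ + 4 * c₈ * c₆ ^ 2) * (G * H) := by
      calc J * (m + 2) ≤ J * (c₈ * (E + N + J * N)) := by gcongr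
        _ = c₈ * (J * E + J * N + J ^ 2 * N) := by ring
        _ ≤ c₈ * (c₄ * (G * H) + c₄ * (G * H) + 4 * c₆ ^ 2 * (G * H)) := by gcongr
        _ = _ := by ring
    have h2 : 0 ≤ 2 * c₁ * (264 + 320 * (c₈ * (2 + c₄))) * (G * H) := by positivity
    calc J * (m + 2) + 2 ≤ (2 * c₈ * c₄ + 4 * c₈ * c₆ ^ 2) * (G * H) + 2 * (G * H) +
          2 * c₁ * (264 + 320 * (c₈ * (2 + c₄))) * (G * H) := by linarith
      _ = _ := by ring
  · have h1 : 264 + 320 * m ≤ (264 + 320 * (c₈ * (2 + c₄))) * (G * H) := by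
      have : m ≤ c₈ * ((2 + c₄) * (G * H)) := by
        calc m ≤ c₈ * (E + N + J * N) := by linarith
          _ ≤ c₈ * ((G * H) + (G * H) + c₄ * (G * H)) := by gcongr
          _ = _ := by ring
      nlinarith
    calc 2 * c₁ * E * N * (264 + 320 * m)
        ≤ 2 * c₁ * E * G * ((264 + 320 * (c₈ * (2 + c₄))) * (G * H)) := by gcongr
      _ = (2 * c₁ * (264 + 320 * (c₈ * (2 + c₄)))) * (E * G ^ 2 * H) := by ring
      _ ≤ ((2 * c₈ * c₄ + 4 * c₈ * c₆ ^ 2 + 2) + 2 * c₁ * (264 + 320 * (c₈ * (2 + c₄)))) *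
          (E * G ^ 2 * H) := by
          refine mul_le_mul_of_nonneg_right ?_ (by positivity)
          have : 0 ≤ 2 * c₈ * c₄ + 4 * c₈ * c₆ ^ 2 + 2 := by positivity
          linarith
      _ = _ := by ring

/-- The truncation error of the Neumann series. -/
theorem geometric_tail_le {C₀ ρ n E ε : ℝ} (hC₀ : 1 ≤ C₀) (hρ0 : 0 < ρ) (hρ1 : ρ < 1)
    (hn : 1 ≤ n) (hE1 : 1 ≤ E) (hE : Real.log ε = 1 - E) (hε : 0 < ε) (s : ℕ) {J : ℕ}
    (hJ : (Real.log (2 * C₀ / (1 - ρ)) + s + 1) / (1 - ρ) * E * (1 + Real.log n) ≤ 2 ^ J) :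
    C₀ * n ^ s * ρ ^ 2 ^ J * (1 - ρ)⁻¹ ≤ ε / 2 := by
  have hδ0 : 0 < 1 - ρ := by linarith
  have hδ1 : 1 - ρ ≤ 1 := by linarith
  have ha0 : 0 ≤ Real.log (2 * C₀ / (1 - ρ)) := Real.log_nonneg (by
    rw [le_div_iff₀ hδ0]; linarith)
  -- From `ρ ≤ exp (-(1 - ρ))`; it remains to compare exponents.
  have h1 : ρ ^ 2 ^ J ≤ Real.exp (-((1 - ρ) * 2 ^ J)) := by
    have : ρ ≤ Real.exp (-(1 - ρ)) := by
      have := Real.add_one_le_exp (-(1 - ρ))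
      linarith
    refine (pow_le_pow_left₀ hρ0.le this _).trans_eq ?_
    rw [← Real.exp_nat_mul]
    congr 1
    push_cast
    ring
  have hlogn := Real.log_nonneg hn
  generalize 1 - ρ = δ at *
  have hn0 : 0 < n := by linarith
  have hM : 0 < C₀ * n ^ s := by positivity
  -- The left side is `log (2C₀/δ) + s log n + E - 1`, and each of its terms is dominated by a
  -- multiple of `E (1 + log n)`; this dictates the constant in the lower bound for `2^J`.
  have h2 : Real.log (2 * (C₀ * n ^ s) / (δ * ε)) ≤ δ * 2 ^ J := by
    have h3 : 2 * (C₀ * n ^ s) / (δ * ε) = (2 * C₀ / δ) * n ^ s / ε := by field_simp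
    have h4 := mul_le_mul_of_nonneg_left hJ hδ0.le
    refine le_trans ?_ h4
    have h5 : δ * ((Real.log (2 * C₀ / δ) + s + 1) / δ * E * (1 + Real.log n)) =
        (Real.log (2 * C₀ / δ) + s + 1) * (E * (1 + Real.log n)) := by
      field_simp
    rw [h3, h5, Real.log_div (by positivity) (by positivity),
      Real.log_mul (by positivity) (by positivity), Real.log_pow, hE]
    have h7 : E ≤ E * (1 + Real.log n) := le_mul_of_one_le_right (by linarith) (by linarith)
    have h8 : 1 + Real.log n ≤ E * (1 + Real.log n) :=
      le_mul_of_one_le_left (by linarith) hE1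
    have h9 : Real.log (2 * C₀ / δ) ≤ Real.log (2 * C₀ / δ) * (E * (1 + Real.log n)) :=
      le_mul_of_one_le_right ha0 (by linarith)
    have h10 : (s : ℝ) * Real.log n ≤ s * (E * (1 + Real.log n)) := by
      gcongr
      linarith
    linarith
  have h3 : Real.exp (-(δ * 2 ^ J)) ≤ δ * ε / (2 * (C₀ * n ^ s)) := by
    rw [Real.log_le_iff_le_exp (by positivity)] at h2
    rw [Real.exp_neg, inv_le_comm₀ (Real.exp_pos _) (by positivity), inv_div]
    exact h2
  calc C₀ * n ^ s * ρ ^ 2 ^ J * δ⁻¹ ≤ C₀ * n ^ s * (δ * ε / (2 * (C₀ * n ^ s))) * δ⁻¹ := by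
        gcongr
        exact h1.trans h3
    _ = ε / 2 := by field_simp

/-- The number of squaring steps for a prescribed accuracy of the iteration. -/
theorem exists_nat_accuracy {n R E ε : ℝ} (hn : 1 ≤ n) (hR : 1 ≤ R)
    (hE : Real.log ε = 1 - E) (hε0 : 0 < ε) (hε1 : ε < 1) (J : ℕ) {L : ℝ}
    (hL : Real.log (3 * R) ≤ L) :
    ∃ m : ℕ, (m : ℝ) ≤ 1 + (2 * (1 + Real.log n) + ((J : ℝ) + 2) * L + E) ∧
      2 * n ^ 2 * R ^ 2 * (4 ^ m)⁻¹ * (3 * R) ^ J ≤ ε / 2 := by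
  have hn0 : 0 < n := by linarith
  have hR0 : 0 < R := by linarith
  -- The target value for `4^m`: `2 R² (3R)^J` equals `(2/9)(3R)^(J+2)`, and `2/9 ≤ 1/2`.
  have hT1 : 1 ≤ n ^ 2 * (3 * R) ^ (J + 2) / ε := by
    rw [le_div_iff₀ hε0, one_mul]
    have h1 : 1 ≤ n ^ 2 := one_le_pow₀ hn
    have h2 : 1 ≤ (3 * R) ^ (J + 2) := one_le_pow₀ (by linarith)
    exact hε1.le.trans (one_le_mul_of_one_le_of_one_le h1 h2)
  obtain ⟨m, hm1, hm2⟩ := exists_nat_four_pow_near hT1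
  refine ⟨m, hm2.trans ?_, ?_⟩
  · rw [Real.log_div (by positivity) (by positivity),
      Real.log_mul (by positivity) (by positivity), Real.log_pow, Real.log_pow, hE]
    have : ((J : ℝ) + 2) * Real.log (3 * R) ≤ ((J : ℝ) + 2) * L := by gcongr
    push_cast
    linarith
  · have h4 : (0 : ℝ) < 4 ^ m := by positivity
    rw [div_le_iff₀ hε0] at hm1
    have h6 : 2 * n ^ 2 * R ^ 2 * (4 ^ m)⁻¹ * (3 * R) ^ J =
        (2 / 9) * (n ^ 2 * (3 * R) ^ (J + 2)) / 4 ^ m := by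
      rw [pow_add]
      field_simp
      ring
    rw [h6, div_le_iff₀ h4]
    have : 0 < ε * 4 ^ m := by positivity
    linarith

/-- Inversion networks for the matrices `1 - B` for which the powers of `B` decay geometrically,
up to a factor that is polynomial in the size. -/
theorem exists_inversion_net {C₀ ρ : ℝ} (s : ℕ) (hC₀ : 1 ≤ C₀) (hρ0 : 0 < ρ) (hρ1 : ρ < 1) :
    ∃ C : ℝ, 0 < C ∧ ∀ (n : ℕ) (ε : ℝ), 1 ≤ n → 0 < ε → ε < 1 →
      ∃ Ψ : NN (n * n) (n * n), Ψ.PosWidths ∧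
        (∀ B : Matrix (Fin n) (Fin n) ℝ, (∀ k : ℕ, ‖B ^ k‖ ≤ C₀ * n ^ s * ρ ^ k) →
          ‖(1 - B)⁻¹ - matM (Ψ.realize (vecM B))‖ ≤ ε) ∧
        (Ψ.depth : ℝ) ≤ C * (1 + Real.log (1 + |Real.log ε|) + Real.log n) *
          (1 + |Real.log ε| + Real.log n + Real.log (1 + |Real.log ε|)) ∧
        (Ψ.size : ℝ) ≤ C * (n : ℝ) ^ 3 * (1 + |Real.log ε|) *
          (1 + Real.log (1 + |Real.log ε|) + Real.log n) ^ 2 *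
          (1 + |Real.log ε| + Real.log n + Real.log (1 + |Real.log ε|)) := by
  set δ := 1 - ρ with hδ
  have hδ0 : 0 < δ := by linarith
  have hδ1 : δ ≤ 1 := by linarith
  have ha0 : 0 ≤ Real.log (2 * C₀ / δ) := Real.log_nonneg (by
    rw [le_div_iff₀ hδ0]; linarith)
  have hb0 : 0 ≤ Real.log (9 * C₀ / δ) := Real.log_nonneg (by
    rw [le_div_iff₀ hδ0]; linarith)
  -- `c₁` is the constant required by `geometric_tail_le`; `c₂` is chosen so that `log (3R) ≤ c₂ N`
  -- for the radius `R` below.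
  set c₁ := (Real.log (2 * C₀ / δ) + s + 1) / δ with hc₁
  set c₂ := Real.log (9 * C₀ / δ) + s with hc₂
  have hc₁1 : 1 ≤ c₁ := by
    rw [hc₁, le_div_iff₀ hδ0]
    have : (0 : ℝ) ≤ s := by positivity
    linarith
  obtain ⟨C, hC0, hC⟩ := depth_and_size_bounds hc₁1 (by positivity : 0 ≤ c₂)
  refine ⟨C, hC0, fun n ε hn hε0 hε1 => ?_⟩
  have : NeZero n := ⟨by omega⟩
  have hn' : (1 : ℝ) ≤ n := by exact_mod_cast hn
  have hlogε : Real.log ε < 0 := Real.log_neg hε0 hε1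
  have hlogn := Real.log_nonneg hn'
  set E := 1 + |Real.log ε| with hE
  set N := 1 + Real.log n with hN
  have hE' : Real.log ε = 1 - E := by rw [hE, abs_of_neg hlogε]; ring
  have hE1 : 1 ≤ E := by rw [hE]; linarith [abs_nonneg (Real.log ε)]
  have hN1 : 1 ≤ N := by linarith
  set M := C₀ * (n : ℝ) ^ s with hM
  have hns : (1 : ℝ) ≤ (n : ℝ) ^ s := one_le_pow₀ hn'
  have hM1 : 1 ≤ M := one_le_mul_of_one_le_of_one_le hC₀ hns
  have hM0 : 0 < M := by linarith
  obtain ⟨J, hJ1, hJ2, hJ3⟩ := exists_nat_two_pow_near hc₁1 hE1 hN1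
  -- The powers are bounded by `M` and the partial sums by `M / δ`; the 2 is the margin for the
  -- errors and for the unit matrix in `1 + B`.
  set R := M * δ⁻¹ + 2 with hR
  have hδinv : 1 ≤ δ⁻¹ := (one_le_inv₀ hδ0).mpr hδ1
  have hMδ : M ≤ M * δ⁻¹ := le_mul_of_one_le_right hM0.le hδinv
  have hR1 : 1 ≤ R := by linarith
  have hR0 : 0 < R := by linarith
  have hlogM : Real.log (n ^ s : ℝ) = s * Real.log n := Real.log_pow _ _
  have hlog3R : Real.log (3 * R) ≤ c₂ * N := by
    have h1 : 3 * R ≤ (9 * C₀ / δ) * n ^ s := by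
      have : (9 * C₀ / δ) * (n : ℝ) ^ s = 9 * (M * δ⁻¹) := by rw [hM]; field_simp
      rw [this]
      linarith
    refine (Real.log_le_log (by positivity) h1).trans ?_
    rw [Real.log_mul (by positivity) (by positivity), hlogM, hc₂, hN]
    have : 0 ≤ Real.log (9 * C₀ / δ) * Real.log n := by positivity
    have : (0 : ℝ) ≤ s := by positivity
    nlinarith
  obtain ⟨m, hmb, hη⟩ := exists_nat_accuracy hn' hR1 hE' hε0 hε1 J hlog3R
  obtain ⟨Ψ, hΨ1, hΨ2, hΨ3, hΨ4⟩ := exists_neumann_net n hR1 m J (by linarith)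
  obtain ⟨hd, hs⟩ := hC E N J m hE1 hN1 (by positivity) (by positivity) hJ3 hmb
  have hG : 1 + Real.log E + Real.log n = Real.log E + N := by rw [hN]; ring
  have hH : E + Real.log n + Real.log E = E + (N - 1) + Real.log E := by rw [hN]; ring
  refine ⟨Ψ, hΨ1, fun B hB => ?_, ?_, ?_⟩
  · have hgeo := norm_geom_sum_le B hρ0.le hρ1 hM0.le hB
    have hinv := (isUnit_one_sub_and_norm_inv_sub_le B hρ0.le hρ1 hB (2 ^ J)).2
    have hnet := hΨ4 B
      (fun k => by
        have h1 : ρ ^ k ≤ 1 := pow_le_one₀ hρ0.le hρ1.le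
        have h2 := hB k
        have : M * ρ ^ k ≤ M := mul_le_of_le_one_right hM0.le h1
        linarith)
      (fun K => by have := hgeo K; rw [hR]; linarith)
    have htail : M * ρ ^ 2 ^ J * (1 - ρ)⁻¹ ≤ ε / 2 :=
      geometric_tail_le hC₀ hρ0 hρ1 hn' hE1 hE' hε0 s hJ1
    have := norm_sub_le_norm_sub_add_norm_sub (1 - B)⁻¹ (∑ k ∈ Finset.range (2 ^ J), B ^ k)
      (matM (Ψ.realize (vecM B)))
    rw [norm_sub_rev (∑ k ∈ Finset.range (2 ^ J), B ^ k)] at this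
    linarith
  · rw [hG, hH, hΨ2]
    push_cast
    exact hd
  · rw [hG, hH]
    calc (Ψ.size : ℝ) ≤ ((2 ^ J * ((264 + 320 * m) * n ^ 3) : ℕ) : ℝ) := by exact_mod_cast hΨ3
      _ = 2 ^ J * (264 + 320 * m) * n ^ 3 := by push_cast; ring
      _ ≤ (2 * c₁ * E * N) * (264 + 320 * m) * n ^ 3 := by gcongr
      _ ≤ (C * E * (Real.log E + N) ^ 2 * (E + (N - 1) + Real.log E)) * n ^ 3 := by gcongr
      _ = _ := by ring

/-! ## Integrals of polynomials over the unit interval -/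

open Polynomial in
/-- The integral of a polynomial over `(0,1)`. -/
def polyInt : ℝ[X] →ₗ[ℝ] ℝ where
  toFun P := ∫ t in (0 : ℝ)..1, P.eval t
  map_add' P Q := by
    simp only [eval_add]
    exact intervalIntegral.integral_add (P.continuous.intervalIntegrable _ _)
      (Q.continuous.intervalIntegrable _ _)
  map_smul' c P := by
    simp only [eval_smul, smul_eq_mul, RingHom.id_apply]
    exact intervalIntegral.integral_const_mul _ _

namespace Polynomial

theorem polyInt_apply (P : ℝ[X]) : polyInt P = ∫ t in (0 : ℝ)..1, P.eval t := rfl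

theorem polyInt_C (c : ℝ) : polyInt (C c) = c := by simp [polyInt_apply]

theorem polyInt_C_mul (c : ℝ) (P : ℝ[X]) : polyInt (C c * P) = c * polyInt P := by
  rw [← smul_eq_C_mul, map_smul, smul_eq_mul]

theorem polyInt_derivative (P : ℝ[X]) : polyInt (derivative P) = P.eval 1 - P.eval 0 :=
  intervalIntegral.integral_eq_sub_of_hasDerivAt (fun t _ => P.hasDerivAt t)
    ((derivative P).continuous.intervalIntegrable _ _)

theorem polyInt_nonneg (P : ℝ[X]) (h : ∀ t ∈ Set.Icc (0 : ℝ) 1, 0 ≤ P.eval t) : 0 ≤ polyInt P :=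
  intervalIntegral.integral_nonneg zero_le_one h

theorem polyInt_mono (P Q : ℝ[X]) (h : ∀ t ∈ Set.Icc (0 : ℝ) 1, P.eval t ≤ Q.eval t) :
    polyInt P ≤ polyInt Q := by
  have := polyInt_nonneg (Q - P) fun t ht => by rw [eval_sub]; linarith [h t ht]
  rw [map_sub] at this
  linarith

theorem polyInt_sq_nonneg (P : ℝ[X]) : 0 ≤ polyInt (P ^ 2) :=
  polyInt_nonneg _ fun t _ => by rw [eval_pow]; exact sq_nonneg _

theorem polyInt_sq_pos {P : ℝ[X]} (hP : P ≠ 0) : 0 < polyInt (P ^ 2) := by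
  obtain ⟨t, ht, htP⟩ : ∃ t ∈ Set.Ioo (0 : ℝ) 1, P.eval t ≠ 0 := by
    by_contra hcon
    push Not at hcon
    exact hP (eq_zero_of_infinite_isRoot _
      ((Set.Ioo_infinite (by norm_num : (0 : ℝ) < 1)).mono fun t ht => hcon t ht))
  refine intervalIntegral.integral_pos zero_lt_one (P ^ 2).continuous.continuousOn
    (fun s _ => by rw [eval_pow]; exact sq_nonneg _) ⟨t, ⟨ht.1.le, ht.2.le⟩, ?_⟩
  rw [eval_pow]
  positivity

/-- The Cauchy-Schwarz inequality. -/
theorem polyInt_mul_sq_le (P Q : ℝ[X]) :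
    polyInt (P * Q) ^ 2 ≤ polyInt (P ^ 2) * polyInt (Q ^ 2) := by
  have h : ∀ x : ℝ, 0 ≤ polyInt (P ^ 2) * (x * x) + 2 * polyInt (P * Q) * x + polyInt (Q ^ 2) := by
    intro x
    have h1 := polyInt_sq_nonneg (C x * P + Q)
    have h2 : (C x * P + Q) ^ 2 = C (x * x) * P ^ 2 + C (2 * x) * (P * Q) + Q ^ 2 := by
      simp only [C_mul, C_ofNat]
      ring
    rw [h2, map_add, map_add, polyInt_C_mul, polyInt_C_mul] at h1
    linarith
  have := discrim_le_zero h
  rw [discrim] at this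
  nlinarith

/-- The oscillation of the square of a polynomial. -/
theorem eval_sq_le (v : ℝ[X]) {θ : ℝ} (hθ : 0 < θ) {x y : ℝ} (hx : x ∈ Set.Icc (0 : ℝ) 1)
    (hy : y ∈ Set.Icc (0 : ℝ) 1) :
    v.eval x ^ 2 ≤ v.eval y ^ 2 + (θ * polyInt (v ^ 2) + θ⁻¹ * polyInt (derivative v ^ 2)) := by
  have h1 : ∫ t in y..x, (derivative (v ^ 2)).eval t = v.eval x ^ 2 - v.eval y ^ 2 := by
    rw [intervalIntegral.integral_eq_sub_of_hasDerivAt (fun t _ => (v ^ 2).hasDerivAt t)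
      ((derivative (v ^ 2)).continuous.intervalIntegrable _ _), eval_pow, eval_pow]
  -- By Young's inequality with weight `θ`, `g` dominates `|(v²)'| = 2|v v'|`.
  set g : ℝ[X] := C θ * v ^ 2 + C θ⁻¹ * derivative v ^ 2 with hg
  have hg0 : ∀ t, 0 ≤ g.eval t := by
    intro t
    simp only [hg, eval_add, eval_mul, eval_C, eval_pow]
    positivity
  have h2 : ∀ t, |(derivative (v ^ 2)).eval t| ≤ g.eval t := by
    intro t
    simp only [hg, eval_add, eval_mul, eval_C, eval_pow, derivative_pow, Nat.cast_ofNat,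
      Nat.add_one_sub_one, pow_one]
    set a := v.eval t
    set b := (derivative v).eval t
    have h3 : θ * a ^ 2 + θ⁻¹ * b ^ 2 - 2 * a * b = θ⁻¹ * (θ * a - b) ^ 2 := by field_simp; ring
    have h4 : θ * a ^ 2 + θ⁻¹ * b ^ 2 + 2 * a * b = θ⁻¹ * (θ * a + b) ^ 2 := by field_simp; ring
    have h5 : 0 ≤ θ⁻¹ * (θ * a - b) ^ 2 := by positivity
    have h6 : 0 ≤ θ⁻¹ * (θ * a + b) ^ 2 := by positivity
    exact abs_le.mpr ⟨by linarith, by linarith⟩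
  have h3 : |∫ t in y..x, (derivative (v ^ 2)).eval t| ≤ polyInt g := by
    have hgi : MeasureTheory.IntegrableOn (fun t => g.eval t) (Set.Ioc 0 1) :=
      (intervalIntegrable_iff_integrableOn_Ioc_of_le zero_le_one).mp
        (g.continuous.intervalIntegrable _ _)
    have hsub : Set.uIoc y x ⊆ Set.Ioc 0 1 := by
      intro t ht
      rw [Set.mem_uIoc] at ht
      rcases ht with ht | ht
      · exact ⟨lt_of_le_of_lt hy.1 ht.1, ht.2.trans hx.2⟩
      · exact ⟨lt_of_le_of_lt hx.1 ht.1, ht.2.trans hy.2⟩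
    rw [← Real.norm_eq_abs, intervalIntegral.norm_intervalIntegral_eq]
    refine (MeasureTheory.norm_integral_le_of_norm_le (hgi.mono_set hsub)
      (Filter.Eventually.of_forall h2)).trans ?_
    rw [polyInt_apply, intervalIntegral.integral_of_le zero_le_one]
    exact MeasureTheory.setIntegral_mono_set hgi (Filter.Eventually.of_forall hg0)
      hsub.eventuallyLE
  rw [h1, hg, map_add, polyInt_C_mul, polyInt_C_mul] at h3
  linarith [(abs_le.mp h3).2]

/-- The oscillation bound with `θ = 1`, averaged over `y`. -/
theorem eval_sq_le_add (v : ℝ[X]) {x : ℝ} (hx : x ∈ Set.Icc (0 : ℝ) 1) :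
    v.eval x ^ 2 ≤ 2 * polyInt (v ^ 2) + polyInt (derivative v ^ 2) := by
  have h := polyInt_mono (C (v.eval x ^ 2)) (v ^ 2 +
    C (1 * polyInt (v ^ 2) + 1⁻¹ * polyInt (derivative v ^ 2))) fun y hy => by
      simpa using eval_sq_le v one_pos hx hy
  rw [polyInt_C, map_add, polyInt_C] at h
  linarith

/-- The Poincaré inequality for polynomials that vanish at `0`. -/
theorem polyInt_sq_le_of_eval_zero (v : ℝ[X]) (hv : v.eval 0 = 0) :
    polyInt (v ^ 2) ≤ 4 * polyInt (derivative v ^ 2) := by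
  -- With `θ = 1/2` and `y = 0`, half of the mean square is absorbed on the left.
  have h := polyInt_mono (v ^ 2)
    (C (2⁻¹ * polyInt (v ^ 2) + (2⁻¹ : ℝ)⁻¹ * polyInt (derivative v ^ 2))) fun x hx => by
      have := eval_sq_le v (by norm_num : (0 : ℝ) < 2⁻¹) hx (y := 0) (by simp)
      rw [hv] at this
      simpa using this
  rw [polyInt_C, inv_inv] at h
  linarith

/-! ## Legendre polynomials -/

theorem polyInt_derivative_mul (P Q : ℝ[X]) :
    polyInt (derivative P * Q) =
      P.eval 1 * Q.eval 1 - P.eval 0 * Q.eval 0 - polyInt (P * derivative Q) := by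
  have := polyInt_derivative (P * Q)
  rw [derivative_mul, map_add, eval_mul, eval_mul] at this
  linarith

theorem polyInt_iterate_derivative_mul (F : ℝ[X]) (k : ℕ) : ∀ Q : ℝ[X],
    (∀ j < k, (derivative^[j] F).eval 0 = 0 ∧ (derivative^[j] F).eval 1 = 0) →
    polyInt (derivative^[k] F * Q) = (-1) ^ k * polyInt (F * derivative^[k] Q) := by
  induction k with
  | zero => intro Q _; simp
  | succ k ih =>
    intro Q h
    obtain ⟨h0, h1⟩ := h k (Nat.lt_succ_self k)
    rw [Function.iterate_succ_apply', polyInt_derivative_mul, h0, h1,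
      ih _ fun j hj => h j (hj.trans (Nat.lt_succ_self k)), ← Function.iterate_succ_apply]
    ring

theorem coeff_legendre01 (i k : ℕ) :
    (legendre01 i).coeff k = (-1) ^ i * ((-1) ^ k * i.choose k * (i + k).choose i) := by
  rw [legendre01, coeff_C_mul, coeff_map, coeff_shiftedLegendre]
  simp

theorem coeff_legendre01_eq_zero {i k : ℕ} (h : i < k) : (legendre01 i).coeff k = 0 := by
  simp [coeff_legendre01, Nat.choose_eq_zero_of_lt h]

theorem natDegree_legendre01_le (i : ℕ) : (legendre01 i).natDegree ≤ i :=
  natDegree_le_iff_coeff_eq_zero.mpr fun _ h => coeff_legendre01_eq_zero h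

theorem factorial_mul_legendre01 (i : ℕ) : C (i.factorial : ℝ) * legendre01 i =
    C ((-1) ^ i) * derivative^[i] (X ^ i * (1 - X) ^ i) := by
  have h := congrArg (map (Int.castRingHom ℝ)) (factorial_mul_shiftedLegendre_eq i)
  rw [Polynomial.map_mul, Polynomial.map_natCast, ← iterate_derivative_map] at h
  simp only [Polynomial.map_mul, Polynomial.map_pow, map_X, Polynomial.map_sub,
    Polynomial.map_one] at h
  rw [← h, legendre01, C_eq_natCast]
  ring

/-- Rodrigues' formula and `i` integrations by parts move all derivatives onto `Q`, where they
vanish for degree reasons. The boundary terms vanish because `X^i (1 - X)^i` has zeros of order `i`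
at both endpoints. -/
theorem polyInt_legendre01_mul {i : ℕ} {Q : ℝ[X]} (hQ : Q.degree < i) :
    polyInt (legendre01 i * Q) = 0 := by
  have h0 : (i.factorial : ℝ) ≠ 0 := by positivity
  have hd : derivative^[i] Q = 0 := by
    by_cases hQ0 : Q = 0
    · simp [hQ0]
    · exact iterate_derivative_eq_zero ((natDegree_lt_iff_degree_lt hQ0).mpr hQ)
  have hvan : ∀ j < i, (derivative^[j] ((X : ℝ[X]) ^ i * (1 - X) ^ i)).eval 0 = 0 ∧
      (derivative^[j] ((X : ℝ[X]) ^ i * (1 - X) ^ i)).eval 1 = 0 := by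
    intro j hj
    have hij : i - j ≠ 0 := by omega
    constructor
    · obtain ⟨q, hq⟩ := pow_sub_dvd_iterate_derivative_of_pow_dvd j
        (Dvd.intro _ rfl : (X : ℝ[X]) ^ i ∣ X ^ i * (1 - X) ^ i)
      rw [hq]
      simp [hij]
    · obtain ⟨q, hq⟩ := pow_sub_dvd_iterate_derivative_of_pow_dvd j
        (Dvd.intro_left _ rfl : (1 - X : ℝ[X]) ^ i ∣ X ^ i * (1 - X) ^ i)
      rw [hq]
      simp [hij]
  have h1 := polyInt_iterate_derivative_mul _ i Q hvan
  rw [hd, mul_zero, map_zero, mul_zero] at h1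
  have h2 : (i.factorial : ℝ) * polyInt (legendre01 i * Q) = 0 := by
    rw [← polyInt_C_mul, ← mul_assoc, factorial_mul_legendre01, mul_assoc, polyInt_C_mul, h1,
      mul_zero]
  exact (mul_eq_zero.mp h2).resolve_left h0

theorem eval_zero_legendre01 (i : ℕ) : (legendre01 i).eval 0 = (-1) ^ i := by
  rw [← coeff_zero_eq_eval_zero, coeff_legendre01]
  simp

theorem legendre01_comp_one_sub (i : ℕ) :
    C ((-1) ^ i) * (legendre01 i).comp (1 - X) = legendre01 i := by
  have h := congrArg (map (Int.castRingHom ℝ)) (neg_one_pow_mul_shiftedLegendre_comp_one_sub_X_eq i)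
  rw [Polynomial.map_mul, Polynomial.map_comp] at h
  simp only [Polynomial.map_pow, Polynomial.map_neg, Polynomial.map_one, Polynomial.map_sub,
    map_X] at h
  rw [legendre01, mul_comp, C_comp]
  conv_rhs => rw [← h]
  simp

theorem eval_one_legendre01 (i : ℕ) : (legendre01 i).eval 1 = 1 := by
  rw [← legendre01_comp_one_sub]
  simp [eval_zero_legendre01, ← mul_pow]

theorem eval_zero_derivative_legendre01 (i : ℕ) :
    (derivative (legendre01 i)).eval 0 = -((-1) ^ i * (i * (i + 1))) := by
  rw [← coeff_zero_eq_eval_zero, coeff_derivative, coeff_legendre01]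
  simp [Nat.choose_succ_self_right]

theorem eval_one_derivative_legendre01 (i : ℕ) :
    (derivative (legendre01 i)).eval 1 = i * (i + 1) := by
  rw [← legendre01_comp_one_sub]
  rw [derivative_C_mul, derivative_comp, eval_mul, eval_C]
  simp [eval_zero_derivative_legendre01, ← mul_assoc, ← mul_pow]

/-- The leading terms cancel in `t L' - i L`, so this polynomial has degree below `i` and is
orthogonal to `L`. -/
theorem polyInt_legendre01_mul_X_mul_derivative (i : ℕ) :
    polyInt (legendre01 i * (X * derivative (legendre01 i))) = i * polyInt (legendre01 i ^ 2) := by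
  have h : (X * derivative (legendre01 i) - C (i : ℝ) * legendre01 i).degree < (i : WithBot ℕ) := by
    rw [degree_lt_iff_coeff_zero]
    intro k hk
    rw [coeff_sub, coeff_C_mul]
    rcases hk.eq_or_lt with rfl | hk
    · cases i with
      | zero => simp
      | succ i => rw [coeff_X_mul, coeff_derivative]; push_cast; ring
    · cases k with
      | zero => omega
      | succ k => rw [coeff_X_mul, coeff_derivative, coeff_legendre01_eq_zero hk]; ring
  have h2 := polyInt_legendre01_mul h
  rw [mul_sub, map_sub, mul_left_comm (legendre01 i) (C _), polyInt_C_mul, ← sq] at h2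
  linarith

/-- Integrating `(t L²)' = L² + 2 t L L'` over `(0,1)` gives `1`, as `L(1) = 1`. -/
theorem polyInt_legendre01_sq (i : ℕ) : (2 * i + 1) * polyInt (legendre01 i ^ 2) = 1 := by
  have h := polyInt_derivative (X * legendre01 i ^ 2)
  have h2 : derivative (X * legendre01 i ^ 2) =
      legendre01 i ^ 2 + C 2 * (legendre01 i * (X * derivative (legendre01 i))) := by
    rw [derivative_mul, derivative_X, derivative_pow]
    simp
    ring
  rw [h2, map_add, polyInt_C_mul, polyInt_legendre01_mul_X_mul_derivative] at h
  simp [eval_one_legendre01] at h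
  linarith

theorem polyInt_legendre01_sq_le_one (i : ℕ) : polyInt (legendre01 i ^ 2) ≤ 1 := by
  have h := polyInt_legendre01_sq i
  have h0 := polyInt_sq_nonneg (legendre01 i)
  have : (0 : ℝ) ≤ i := by positivity
  nlinarith

/-- After an integration by parts, `L''` is orthogonal to `L`, and only the endpoint values `L'(1) =
i(i+1)` and its reflection remain. -/
theorem polyInt_derivative_legendre01_sq (i : ℕ) :
    polyInt (derivative (legendre01 i) ^ 2) = 2 * (i * (i + 1)) := by
  have h := polyInt_derivative_mul (legendre01 i) (derivative (legendre01 i))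
  have h2 : polyInt (legendre01 i * derivative (derivative (legendre01 i))) = 0 := by
    apply polyInt_legendre01_mul
    rw [degree_lt_iff_coeff_zero]
    intro k hk
    rw [coeff_derivative, coeff_derivative, coeff_legendre01_eq_zero (by omega)]
    simp
  rw [h2, ← sq, eval_one_legendre01, eval_zero_legendre01, eval_one_derivative_legendre01,
    eval_zero_derivative_legendre01] at h
  rw [h]
  have : ((-1 : ℝ) ^ i) * (-1) ^ i = 1 := by rw [← mul_pow]; simp
  linear_combination (i * (i + 1) : ℝ) * this

theorem polyInt_legendre01_mul_legendre01 {i j : ℕ} (h : i ≠ j) :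
    polyInt (legendre01 i * legendre01 j) = 0 := by
  rcases lt_or_gt_of_ne h with h | h
  · rw [mul_comm]
    apply polyInt_legendre01_mul
    rw [degree_lt_iff_coeff_zero]
    exact fun k hk => coeff_legendre01_eq_zero (by omega)
  · apply polyInt_legendre01_mul
    rw [degree_lt_iff_coeff_zero]
    exact fun k hk => coeff_legendre01_eq_zero (by omega)

end Polynomial

/-! ## Gauss-Lobatto quadrature of squares -/

namespace IsGaussLobatto

open Polynomial

variable {q : ℕ} {x w : Fin q → ℝ}

theorem polyInt_eq (h : IsGaussLobatto q x w) {P : ℝ[X]} (hP : P.natDegree ≤ 2 * q - 3) :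
    polyInt P = ∑ k, w k * P.eval (x k) :=
  h.exact_of_natDegree_le P hP

/-- The error of the quadrature rule is nonpositive for squares of polynomials of degree `q - 1`. -/
theorem polyInt_sq_le (h : IsGaussLobatto q x w) (hq : 2 ≤ q) {v : ℝ[X]}
    (hv : v.natDegree ≤ q - 1) : polyInt (v ^ 2) ≤ ∑ k, w k * v.eval (x k) ^ 2 := by
  classical
  obtain ⟨k₀, hk₀⟩ := h.exists_zero
  obtain ⟨k₁, hk₁⟩ := h.exists_one
  have hne : k₁ ≠ k₀ := by
    rintro rfl
    rw [hk₀] at hk₁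
    exact zero_ne_one hk₁
  set S : Finset (Fin q) := (Finset.univ.erase k₀).erase k₁ with hS
  have hScard : S.card = q - 2 := by
    rw [hS, Finset.card_erase_of_mem (by simp [hne]), Finset.card_erase_of_mem (by simp)]
    simp
    omega
  set PS : ℝ[X] := ∏ k ∈ S, (X - C (x k)) with hPS
  have hPSmon : PS.Monic := monic_prod_of_monic _ _ fun k _ => monic_X_sub_C _
  have hPSdeg : PS.natDegree = q - 2 := by
    rw [hPS, natDegree_prod_of_monic _ _ fun k _ => monic_X_sub_C _]
    simp [hScard]
  -- `Z` is monic of degree `2q - 2`, vanishes at all nodes and is nonpositive on `[0,1]`.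
  -- Subtracting `c² Z` from `v²` lowers the degree to the range of exactness without changing nodal
  -- values, so the quadrature error is `c² ∫ Z ≤ 0`.
  set Z : ℝ[X] := X * (X - C 1) * PS ^ 2 with hZ
  have hXmon : (X * (X - C 1) : ℝ[X]).Monic := monic_X.mul (monic_X_sub_C 1)
  have hZmon : Z.Monic := hXmon.mul (hPSmon.pow 2)
  have hZdeg : Z.natDegree = 2 * (q - 1) := by
    rw [hZ, hXmon.natDegree_mul (hPSmon.pow 2), monic_X.natDegree_mul (monic_X_sub_C 1),
      hPSmon.natDegree_pow, hPSdeg, natDegree_X, natDegree_X_sub_C]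
    omega
  have hZx : ∀ k, Z.eval (x k) = 0 := by
    intro k
    rw [hZ]
    by_cases hk : k ∈ S
    · have : PS.eval (x k) = 0 := by
        rw [hPS, eval_prod]
        exact Finset.prod_eq_zero hk (by simp)
      simp [this]
    · simp only [hS, Finset.mem_erase, Finset.mem_univ, and_true, not_and_or, not_not] at hk
      rcases hk with rfl | rfl
      · simp [hk₁]
      · simp [hk₀]
  set c := v.coeff (q - 1) with hc
  set H : ℝ[X] := v ^ 2 - C (c ^ 2) * Z with hH
  have hHdeg : H.natDegree ≤ 2 * q - 3 := by
    have h1 : H.natDegree ≤ 2 * (q - 1) := by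
      refine (natDegree_sub_le _ _).trans (max_le ?_ ?_)
      · exact natDegree_pow_le_of_le 2 hv
      · exact (natDegree_C_mul_le _ _).trans hZdeg.le
    have h2 : H.coeff (2 * (q - 1)) = 0 := by
      have h3 : Z.coeff (2 * (q - 1)) = 1 := by rw [← hZdeg]; exact hZmon.coeff_natDegree
      rw [hH, coeff_sub, coeff_C_mul, h3, coeff_pow_of_natDegree_le hv]
      ring
    have := natDegree_le_pred h1 h2
    omega
  have hHx : ∀ k, H.eval (x k) = v.eval (x k) ^ 2 := by
    intro k
    rw [hH, eval_sub, eval_mul, hZx, eval_pow]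
    ring
  have hI := h.polyInt_eq hHdeg
  simp only [hHx] at hI
  rw [← hI, hH, map_sub, polyInt_C_mul]
  have hZ0 : 0 ≤ polyInt (-Z) := by
    refine polyInt_nonneg _ fun t ht => ?_
    have : (-Z).eval t = t * (1 - t) * PS.eval t ^ 2 := by
      rw [hZ]
      simp
      ring
    rw [this]
    exact mul_nonneg (mul_nonneg ht.1 (by linarith [ht.2])) (sq_nonneg _)
  rw [map_neg] at hZ0
  nlinarith [sq_nonneg c]

/-- Applied to the square of a Lagrange basis polynomial, the quadrature returns exactly its weight,
which therefore dominates a positive integral. -/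
theorem weight_pos (h : IsGaussLobatto q x w) (hq : 2 ≤ q) (k : Fin q) : 0 < w k := by
  classical
  have hinj : Set.InjOn x (Finset.univ : Finset (Fin q)) := h.strictMono.injective.injOn
  set v := Lagrange.basis Finset.univ x k with hv
  have hdeg : v.natDegree ≤ q - 1 := by
    have := Lagrange.degree_basis hinj (Finset.mem_univ k)
    rw [natDegree_eq_of_degree_eq_some this]
    simp
  have h1 := h.polyInt_sq_le hq hdeg
  have h2 : ∑ j, w j * v.eval (x j) ^ 2 = w k := by
    rw [Finset.sum_eq_single k]
    · rw [hv, Lagrange.eval_basis_self hinj (Finset.mem_univ k)]; ring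
    · intro j _ hj
      rw [hv, Lagrange.eval_basis_of_ne hj.symm (Finset.mem_univ j)]
      ring
    · simp
  rw [h2] at h1
  refine lt_of_lt_of_le (polyInt_sq_pos ?_) h1
  exact Lagrange.basis_ne_zero hinj (Finset.mem_univ k)

theorem sum_weight (h : IsGaussLobatto q x w) : ∑ k, w k = 1 := by
  have := h.polyInt_eq (P := C 1) (by simp)
  rw [polyInt_C] at this
  simpa using this.symm

end IsGaussLobatto

/-! ## The univariate basis -/

/-- The degree of the leading Legendre polynomial in the basis function `phi1d i`. -/
def legIdx (i : ℕ) : ℕ := if i = 0 then 0 else i + 1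

namespace Polynomial

theorem legIdx_ne_one (i : ℕ) : legIdx i ≠ 1 := by
  unfold legIdx
  split_ifs <;> omega

theorem legIdx_injective : Function.Injective legIdx := by
  intro i j h
  unfold legIdx at h
  split_ifs at h <;> omega

theorem legIdx_le (i : ℕ) : legIdx i ≤ i + 1 := by
  unfold legIdx
  split_ifs <;> omega

theorem phi1d_eq (i : ℕ) : phi1d i = legendre01 (legIdx i) ∨
    1 ≤ i ∧ phi1d i = legendre01 (legIdx i) - legendre01 1 := by
  unfold phi1d legIdx
  split_ifs with h1 h2
  · exact Or.inl rfl
  · exact Or.inl rfl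
  · exact Or.inr ⟨by omega, rfl⟩

/-- The corrections `-L₁` are invisible here, because `legIdx` never takes the value 1. Testing with
Legendre polynomials thus reads off coefficients in the basis. -/
theorem polyInt_legendre01_mul_phi1d (i j : ℕ) :
    polyInt (legendre01 (legIdx i) * phi1d j) =
      if j = i then polyInt (legendre01 (legIdx i) ^ 2) else 0 := by
  have h : polyInt (legendre01 (legIdx i) * legendre01 (legIdx j)) =
      if j = i then polyInt (legendre01 (legIdx i) ^ 2) else 0 := by
    split_ifs with hij
    · rw [hij, sq]
    · exact polyInt_legendre01_mul_legendre01 fun h => hij (legIdx_injective h).symm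
  rcases phi1d_eq j with hj | ⟨_, hj⟩
  · rw [hj, h]
  · rw [hj, mul_sub, map_sub, polyInt_legendre01_mul_legendre01 (legIdx_ne_one i), sub_zero, h]

theorem natDegree_phi1d_le (i : ℕ) : (phi1d i).natDegree ≤ i + 1 := by
  have h := (natDegree_legendre01_le (legIdx i)).trans (legIdx_le i)
  rcases phi1d_eq i with hi | ⟨_, hi⟩
  · rw [hi]; exact h
  · rw [hi]
    exact (natDegree_sub_le _ _).trans (max_le h ((natDegree_legendre01_le 1).trans (by omega)))

theorem polyInt_sub_sq_le (P Q : ℝ[X]) :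
    polyInt ((P - Q) ^ 2) ≤ 2 * polyInt (P ^ 2) + 2 * polyInt (Q ^ 2) := by
  rw [← polyInt_C_mul, ← polyInt_C_mul, ← map_add]
  refine polyInt_mono _ _ fun t _ => ?_
  simp only [eval_pow, eval_sub, eval_add, eval_mul, eval_C]
  nlinarith [sq_nonneg (P.eval t + Q.eval t)]

theorem polyInt_phi1d_sq_le (i : ℕ) : polyInt (phi1d i ^ 2) ≤ 4 := by
  have h1 := polyInt_legendre01_sq_le_one (legIdx i)
  have h2 := polyInt_legendre01_sq_le_one 1
  rcases phi1d_eq i with hi | ⟨_, hi⟩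
  · rw [hi]; linarith
  · rw [hi]
    linarith [polyInt_sub_sq_le (legendre01 (legIdx i)) (legendre01 1)]

theorem polyInt_derivative_phi1d_sq_le {i p : ℕ} (hi : i < p) (hp : 2 ≤ p) :
    polyInt (derivative (phi1d i) ^ 2) ≤ 8 * (p : ℝ) ^ 2 := by
  have hp' : (2 : ℝ) ≤ p := by exact_mod_cast hp
  have hl : (legIdx i : ℝ) ≤ p := by exact_mod_cast (legIdx_le i).trans hi
  have h1 : polyInt (derivative (legendre01 (legIdx i)) ^ 2) ≤ 2 * (p * (p + 1)) := by
    rw [polyInt_derivative_legendre01_sq]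
    gcongr
  have h2 : polyInt (derivative (legendre01 1) ^ 2) = 4 := by
    rw [polyInt_derivative_legendre01_sq]
    norm_num
  rcases phi1d_eq i with hi | ⟨_, hi⟩
  · rw [hi]; nlinarith
  · rw [hi, derivative_sub]
    have := polyInt_sub_sq_le (derivative (legendre01 (legIdx i))) (derivative (legendre01 1))
    nlinarith

/-- The function with coefficients `c` in the univariate basis. -/
def phiSum {p : ℕ} (c : Fin p → ℝ) : ℝ[X] := ∑ i, C (c i) * phi1d i

theorem eval_phiSum {p : ℕ} (c : Fin p → ℝ) (t : ℝ) :
    (phiSum c).eval t = ∑ i : Fin p, (phi1d i).eval t * c i := by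
  simp [phiSum, eval_finsetSum, mul_comm]

theorem eval_derivative_phiSum {p : ℕ} (c : Fin p → ℝ) (t : ℝ) :
    (derivative (phiSum c)).eval t = ∑ i : Fin p, (derivative (phi1d i)).eval t * c i := by
  simp [phiSum, eval_finsetSum, mul_comm]

theorem natDegree_phiSum_le {p : ℕ} (c : Fin p → ℝ) : (phiSum c).natDegree ≤ p := by
  refine natDegree_sum_le_of_forall_le _ _ fun i _ => ?_
  exact (natDegree_C_mul_le _ _).trans ((natDegree_phi1d_le i).trans i.isLt)

theorem polyInt_legendre01_mul_phiSum {p : ℕ} (c : Fin p → ℝ) (i : Fin p) :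
    polyInt (legendre01 (legIdx i) * phiSum c) = c i * polyInt (legendre01 (legIdx i) ^ 2) := by
  rw [phiSum, Finset.mul_sum, map_sum, Finset.sum_eq_single i]
  · rw [mul_left_comm, polyInt_C_mul, polyInt_legendre01_mul_phi1d, if_pos rfl]
  · intro j _ hj
    rw [mul_left_comm, polyInt_C_mul, polyInt_legendre01_mul_phi1d,
      if_neg fun h => hj (Fin.ext h), mul_zero]
  · simp

/-- The bound of a coefficient by the mean square. -/
theorem sq_le_of_polyInt_legendre01_mul {l p : ℕ} (hl : l ≤ p) (v : ℝ[X]) (c : ℝ)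
    (h : polyInt (legendre01 l * v) = c * polyInt (legendre01 l ^ 2)) :
    c ^ 2 ≤ (2 * p + 1) * polyInt (v ^ 2) := by
  have h1 := polyInt_mul_sq_le (legendre01 l) v
  have h2 := polyInt_legendre01_sq l
  rw [h] at h1
  have hγ : 0 < polyInt (legendre01 l ^ 2) := by
    have h3 := polyInt_sq_nonneg (legendre01 l)
    refine lt_of_le_of_ne h3 fun h0 => ?_
    rw [← h0] at h2
    simp at h2
  have h3 : c ^ 2 * polyInt (legendre01 l ^ 2) ≤ polyInt (v ^ 2) := by
    refine le_of_mul_le_mul_left ?_ hγ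
    calc _ = (c * polyInt (legendre01 l ^ 2)) ^ 2 := by ring
      _ ≤ _ := h1
  have hl' : (l : ℝ) ≤ p := by exact_mod_cast hl
  calc c ^ 2 = (2 * l + 1) * (c ^ 2 * polyInt (legendre01 l ^ 2)) := by
        linear_combination (-(c ^ 2)) * h2
    _ ≤ (2 * p + 1) * polyInt (v ^ 2) := by
        gcongr

theorem sum_sq_le_polyInt {p : ℕ} (hp : 2 ≤ p) (c : Fin p → ℝ) :
    ∑ i, c i ^ 2 ≤ 12 * (p : ℝ) ^ 2 * polyInt (phiSum c ^ 2) := by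
  have hp' : (2 : ℝ) ≤ p := by exact_mod_cast hp
  have h0 := polyInt_sq_nonneg (phiSum c)
  calc ∑ i, c i ^ 2 ≤ ∑ _i : Fin p, (2 * p + 1) * polyInt (phiSum c ^ 2) :=
        Finset.sum_le_sum fun i _ => sq_le_of_polyInt_legendre01_mul
          ((legIdx_le i).trans i.isLt) _ _ (polyInt_legendre01_mul_phiSum c i)
    _ = (p * (2 * p + 1)) * polyInt (phiSum c ^ 2) := by simp; ring
    _ ≤ 12 * (p : ℝ) ^ 2 * polyInt (phiSum c ^ 2) :=
        mul_le_mul_of_nonneg_right (by nlinarith) h0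

theorem sum_sq_le_polyInt_derivative {p : ℕ} (hp : 2 ≤ p) (c : Fin p → ℝ) :
    ∑ i : Fin p, (if (i : ℕ) = 0 then 0 else 1) * c i ^ 2 ≤
      12 * (p : ℝ) ^ 2 * polyInt (derivative (phiSum c) ^ 2) := by
  have hp' : (2 : ℝ) ≤ p := by exact_mod_cast hp
  -- Removing the value at `0` makes the Poincaré inequality applicable. It does not affect the
  -- tested coefficients with `i ≠ 0`, since those Legendre polynomials are orthogonal to constants.
  -- The final constant is `4 p (2p + 1) ≤ 12 p²`.
  set v := phiSum c - C ((phiSum c).eval 0) with hv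
  have hpoin := polyInt_sq_le_of_eval_zero v (by simp [hv])
  have hdv : derivative v = derivative (phiSum c) := by simp [hv]
  rw [hdv] at hpoin
  have h0 := polyInt_sq_nonneg (derivative (phiSum c))
  have h0v := polyInt_sq_nonneg v
  have hi : ∀ i : Fin p, (if (i : ℕ) = 0 then 0 else 1) * c i ^ 2 ≤
      (2 * p + 1) * (4 * polyInt (derivative (phiSum c) ^ 2)) := by
    intro i
    split_ifs with hi0
    · rw [zero_mul]; positivity
    · rw [one_mul]
      refine (sq_le_of_polyInt_legendre01_mul ((legIdx_le i).trans i.isLt) v _ ?_).trans ?_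
      · rw [hv, mul_sub, map_sub, polyInt_legendre01_mul_phiSum,
          polyInt_legendre01_mul (Q := C _), sub_zero]
        refine lt_of_le_of_lt degree_C_le ?_
        rw [legIdx, if_neg hi0]
        exact_mod_cast Nat.succ_pos _
      · gcongr
  calc _ ≤ ∑ _i : Fin p, (2 * p + 1) * (4 * polyInt (derivative (phiSum c) ^ 2)) :=
        Finset.sum_le_sum fun i _ => hi i
    _ = (p * (2 * p + 1) * 4) * polyInt (derivative (phiSum c) ^ 2) := by simp; ring
    _ ≤ 12 * (p : ℝ) ^ 2 * polyInt (derivative (phiSum c) ^ 2) :=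
        mul_le_mul_of_nonneg_right (by nlinarith) h0

end Polynomial

namespace IsGaussLobatto

open Polynomial

variable {p : ℕ} {x w : Fin (p + 1) → ℝ}

/-- Squares here may have degree `2p = 2q - 2`, one above the degree of exactness; the sign of the
quadrature error is favourable. -/
theorem sum_sq_le_quad (h : IsGaussLobatto (p + 1) x w) (hp : 2 ≤ p) (c : Fin p → ℝ) :
    ∑ i, c i ^ 2 ≤
      12 * (p : ℝ) ^ 2 * ∑ k, w k * (∑ i : Fin p, (phi1d i).eval (x k) * c i) ^ 2 := by
  refine (sum_sq_le_polyInt hp c).trans ?_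
  have := h.polyInt_sq_le (by omega) (natDegree_phiSum_le c)
  simp only [eval_phiSum] at this
  gcongr

theorem sum_sq_le_quad_derivative (h : IsGaussLobatto (p + 1) x w) (hp : 2 ≤ p) (c : Fin p → ℝ) :
    ∑ i : Fin p, (if (i : ℕ) = 0 then 0 else 1) * c i ^ 2 ≤
      12 * (p : ℝ) ^ 2 * ∑ k, w k * (∑ i : Fin p, (derivative (phi1d i)).eval (x k) * c i) ^ 2 := by
  refine (sum_sq_le_polyInt_derivative hp c).trans ?_
  have hd : (derivative (phiSum c)).natDegree ≤ p + 1 - 1 :=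
    (natDegree_derivative_le _).trans ((Nat.sub_le _ _).trans (natDegree_phiSum_le c))
  have := h.polyInt_sq_le (by omega) hd
  simp only [eval_derivative_phiSum] at this
  gcongr

/-- For this upper bound the sign of the error is unfavourable, so a pointwise bound is used
together with the total weight 1. -/
theorem quad_phi1d_sq_le (h : IsGaussLobatto (p + 1) x w) (hp : 2 ≤ p) {i : ℕ} (hi : i < p) :
    ∑ k, w k * (phi1d i).eval (x k) ^ 2 ≤ 16 * (p : ℝ) ^ 2 := by
  have hp' : (2 : ℝ) ≤ p := by exact_mod_cast hp
  have hb : ∀ k, (phi1d i).eval (x k) ^ 2 ≤ 16 * (p : ℝ) ^ 2 := by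
    intro k
    have h1 := eval_sq_le_add (phi1d i) (h.mem_Icc k)
    have h2 := polyInt_phi1d_sq_le i
    have h3 := polyInt_derivative_phi1d_sq_le hi hp
    nlinarith
  calc _ ≤ ∑ k, w k * (16 * (p : ℝ) ^ 2) := Finset.sum_le_sum fun k _ =>
        mul_le_mul_of_nonneg_left (hb k) (h.weight_pos (by omega) k).le
    _ = _ := by rw [← Finset.sum_mul, h.sum_weight, one_mul]

theorem quad_derivative_phi1d_sq_le (h : IsGaussLobatto (p + 1) x w) (hp : 2 ≤ p) {i : ℕ}
    (hi : i < p) : ∑ k, w k * (derivative (phi1d i)).eval (x k) ^ 2 ≤ 16 * (p : ℝ) ^ 2 := by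
  have hdeg : (derivative (phi1d i) ^ 2).natDegree ≤ 2 * (p + 1) - 3 := by
    refine natDegree_pow_le.trans ?_
    have h1 := natDegree_derivative_le (phi1d i)
    have h2 := natDegree_phi1d_le i
    omega
  have h1 := h.polyInt_eq hdeg
  simp only [eval_pow] at h1
  rw [← h1]
  have := polyInt_derivative_phi1d_sq_le hi hp
  have : 0 ≤ (p : ℝ) ^ 2 := by positivity
  linarith

end IsGaussLobatto

/-! ## Tensor products -/

/-- Univariate lower bounds imply lower bounds for tensor products. -/
theorem tensor_lower_bound {p q : ℕ} (w : Fin q → ℝ) (hw : ∀ k, 0 ≤ w k) {m : ℝ} (hm : 0 ≤ m)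
    (d : ℕ) : ∀ (T : Fin d → Fin q → Fin p → ℝ) (π : Fin d → Fin p → ℝ), (∀ l i, 0 ≤ π l i) →
    (∀ l (c : Fin p → ℝ), ∑ i, π l i * c i ^ 2 ≤ m * ∑ k, w k * (∑ i, T l k i * c i) ^ 2) →
    ∀ c : (Fin d → Fin p) → ℝ,
      ∑ i, (∏ l, π l (i l)) * c i ^ 2 ≤
        m ^ d * ∑ k : Fin d → Fin q, (∏ l, w (k l)) * (∑ i, (∏ l, T l (k l) (i l)) * c i) ^ 2 := by
  induction d with
  | zero => intro T π _ _ c; simp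
  | succ d ih =>
    intro T π hπ hT c
    have hsplit : ∀ {n : ℕ} (f : (Fin (d + 1) → Fin n) → ℝ),
        ∑ i, f i = ∑ i₀ : Fin n, ∑ i : Fin d → Fin n, f (Fin.cons i₀ i) := by
      intro n f
      rw [← Fintype.sum_prod_type']
      exact (Equiv.sum_comp (Fin.consEquiv fun _ => Fin n) f).symm
    let W : (Fin d → Fin q) → ℝ := fun k => ∏ l, w (k l)
    -- `g` contracts all variables but the first. The induction hypothesis is applied for each fixed
    -- first index, then the univariate bound for each fixed tuple of remaining nodes.
    let g : (Fin d → Fin q) → Fin p → ℝ := fun k i₀ =>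
      ∑ i : Fin d → Fin p, (∏ l, T l.succ (k l) (i l)) * c (Fin.cons i₀ i)
    have hW : ∀ k, 0 ≤ W k := fun k => Finset.prod_nonneg fun l _ => hw _
    have h1 : ∀ i₀ : Fin p, ∑ i : Fin d → Fin p, (∏ l, π l.succ (i l)) * c (Fin.cons i₀ i) ^ 2 ≤
        m ^ d * ∑ k, W k * g k i₀ ^ 2 := fun i₀ =>
      ih (fun l => T l.succ) (fun l => π l.succ) (fun l => hπ l.succ) (fun l => hT l.succ)
        fun i => c (Fin.cons i₀ i)
    calc ∑ i, (∏ l, π l (i l)) * c i ^ 2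
        = ∑ i₀, π 0 i₀ * ∑ i : Fin d → Fin p, (∏ l, π l.succ (i l)) * c (Fin.cons i₀ i) ^ 2 := by
          rw [hsplit]
          simp only [Fin.prod_univ_succ, Fin.cons_zero, Fin.cons_succ, Finset.mul_sum, mul_assoc]
      _ ≤ ∑ i₀, π 0 i₀ * (m ^ d * ∑ k, W k * g k i₀ ^ 2) :=
          Finset.sum_le_sum fun i₀ _ => mul_le_mul_of_nonneg_left (h1 i₀) (hπ 0 i₀)
      _ = m ^ d * ∑ k, W k * ∑ i₀, π 0 i₀ * g k i₀ ^ 2 := by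
          simp only [Finset.mul_sum]
          rw [Finset.sum_comm]
          refine Finset.sum_congr rfl fun k _ => Finset.sum_congr rfl fun i₀ _ => ?_
          ring
      _ ≤ m ^ d * ∑ k, W k * (m * ∑ k₀, w k₀ * (∑ i₀, T 0 k₀ i₀ * g k i₀) ^ 2) := by
          refine mul_le_mul_of_nonneg_left ?_ (by positivity)
          exact Finset.sum_le_sum fun k _ => mul_le_mul_of_nonneg_left (hT 0 (g k)) (hW k)
      _ = m ^ (d + 1) * ∑ k₀, ∑ k, w k₀ * W k * (∑ i₀, T 0 k₀ i₀ * g k i₀) ^ 2 := by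
          rw [Finset.sum_comm, pow_succ, mul_assoc]
          congr 1
          rw [Finset.mul_sum]
          refine Finset.sum_congr rfl fun k _ => ?_
          simp only [Finset.mul_sum]
          refine Finset.sum_congr rfl fun k₀ _ => ?_
          ring
      _ = _ := by
          rw [hsplit]
          congr 1
          refine Finset.sum_congr rfl fun k₀ _ => Finset.sum_congr rfl fun k _ => ?_
          rw [hsplit]
          simp only [Fin.prod_univ_succ, Fin.cons_zero, Fin.cons_succ, W, g, Finset.mul_sum,
            mul_assoc]

/-! ## Gradients of the tensor product basis -/

theorem partialD_phi {d p : ℕ} (l : Fin d) (j : Fin (nb d p)) (x : Fin d → ℝ) :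
    partialD l (phi d p j) x = ∏ l', (if l' = l then Polynomial.derivative
      (phi1d (modeIndex d p j l')) else phi1d (modeIndex d p j l')).eval (x l') := by
  have h1 : ∀ l' ∈ (Finset.univ : Finset (Fin d)), HasFDerivAt
      (fun y : Fin d → ℝ => (phi1d (modeIndex d p j l')).eval (y l'))
      ((Polynomial.derivative (phi1d (modeIndex d p j l'))).eval (x l') •
        (ContinuousLinearMap.proj l' : (Fin d → ℝ) →L[ℝ] ℝ)) x := fun l' _ =>
    ((phi1d (modeIndex d p j l')).hasDerivAt (x l')).comp_hasFDerivAt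
      (f := fun y : Fin d → ℝ => y l') x (hasFDerivAt_apply l' x)
  have h2 := HasFDerivAt.finsetProd h1
  have h3 : phi d p j = fun y => ∏ l', (phi1d (modeIndex d p j l')).eval (y l') := rfl
  rw [partialD, h3, h2.fderiv]
  simp only [sum_apply, smul_apply,
    ContinuousLinearMap.proj_apply, smul_eq_mul]
  rw [Finset.sum_eq_single l, ← Finset.mul_prod_erase _ _ (Finset.mem_univ l)]
  · rw [if_pos rfl, Pi.single_eq_same, mul_one, mul_comm]
    congr 1
    refine Finset.prod_congr rfl fun l' hl' => ?_
    rw [if_neg (Finset.ne_of_mem_erase hl')]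
  · intro l' _ hl'
    rw [Pi.single_eq_of_ne hl', mul_zero, mul_zero]
  · simp

theorem modeIndex_injective (d p : ℕ) : Function.Injective (modeIndex d p) := by
  intro i j h
  have h1 := finFunctionFinEquiv.symm.injective h
  simp only [Fin.mk.injEq, Nat.add_right_cancel_iff] at h1
  exact Fin.ext h1

/-- The numbering starts at 1, so the constant mode is excluded; this makes the gradient form
definite. -/
theorem exists_modeIndex_ne_zero {d p : ℕ} (j : Fin (nb d p)) :
    ∃ l, (modeIndex d p j l : ℕ) ≠ 0 := by
  by_contra hcon
  push Not at hcon
  have h1 : ((finFunctionFinEquiv (modeIndex d p j) : Fin (p ^ d)) : ℕ) = j + 1 := by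
    rw [modeIndex, Equiv.apply_symm_apply]
  rw [finFunctionFinEquiv_apply] at h1
  simp [hcon] at h1

/-- The partial derivatives at the quadrature nodes of the function with coefficients `y`. -/
def gradAt (d p q : ℕ) (y : Fin (nb d p) → ℝ) (l : Fin d) (k : Fin (q ^ d)) : ℝ :=
  ∑ j, partialD l (phi d p j) (quadNode d q k) * y j

theorem sum_quad_eq {d q : ℕ} (f : Fin (q ^ d) → ℝ) :
    ∑ k, f k = ∑ k : Fin d → Fin q, f (finFunctionFinEquiv k) :=
  (Equiv.sum_comp finFunctionFinEquiv f).symm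

theorem quadWeight_finFunctionFinEquiv {d q : ℕ} (k : Fin d → Fin q) :
    quadWeight d q (finFunctionFinEquiv k) = ∏ l, glWeight q (k l) := by
  simp [quadWeight]

theorem quadWeight_pos {d q : ℕ} (hq : 2 ≤ q) (k : Fin (q ^ d)) : 0 < quadWeight d q k :=
  Finset.prod_pos fun _ _ => (isGaussLobatto_gl q hq).weight_pos hq _

theorem sum_sq_le_sum_quadWeight_mul_gradAt_sq {d p : ℕ} (hp : 2 ≤ p) (y : Fin (nb d p) → ℝ) :
    ∑ j, y j ^ 2 ≤ (12 * (p : ℝ) ^ 2) ^ d *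
      ∑ k, quadWeight d (p + 1) k * ∑ l, gradAt d p (p + 1) y l k ^ 2 := by
  have hgl := isGaussLobatto_gl (p + 1) (by omega)
  -- Extension by zero to the missing constant mode restores the full tensor grid of indices.
  let c : (Fin d → Fin p) → ℝ := Function.extend (modeIndex d p) y fun _ => 0
  have hinj := modeIndex_injective d p
  have hc : ∀ j, c (modeIndex d p j) = y j := hinj.extend_apply y _
  have hc0 : ∀ i, i ∉ Set.range (modeIndex d p) → c i = 0 := fun i hi =>
    Function.extend_apply' y _ i hi
  have hl : ∀ l : Fin d, ∑ j, (if (modeIndex d p j l : ℕ) = 0 then 0 else 1) * y j ^ 2 ≤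
      (12 * (p : ℝ) ^ 2) ^ d * ∑ k, quadWeight d (p + 1) k * gradAt d p (p + 1) y l k ^ 2 := by
    intro l
    have h := tensor_lower_bound (glWeight (p + 1)) (fun k => (hgl.weight_pos (by omega) k).le)
      (by positivity : 0 ≤ 12 * (p : ℝ) ^ 2) d
      (fun l' k i => (if l' = l then Polynomial.derivative (phi1d i) else phi1d i).eval
        (glNode (p + 1) k))
      -- The derivative in direction `l` controls exactly the modes with nonzero `l`-th digit;
      -- summing over `l` reaches every mode.
      (fun l' i => if l' = l then (if (i : ℕ) = 0 then 0 else 1) else 1)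
      (fun l' i => by split_ifs <;> norm_num)
      (fun l' c => by
        by_cases hl' : l' = l
        · simp only [hl', if_true]
          exact hgl.sum_sq_le_quad_derivative hp c
        · simp only [hl', if_false, one_mul]
          exact hgl.sum_sq_le_quad hp c) c
    have h1 : ∑ i : Fin d → Fin p, (∏ l', if l' = l then (if (i l' : ℕ) = 0 then (0 : ℝ) else 1)
        else 1) * c i ^ 2 = ∑ j, (if (modeIndex d p j l : ℕ) = 0 then 0 else 1) * y j ^ 2 := by
      refine (Fintype.sum_of_injective _ hinj _ _ (fun i hi => ?_) fun j => ?_).symm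
      · rw [hc0 i hi]; ring
      · rw [hc]
        simp
    have h2 : ∀ k : Fin d → Fin (p + 1), ∑ i : Fin d → Fin p, (∏ l', (if l' = l then
        Polynomial.derivative (phi1d (i l')) else phi1d (i l')).eval (glNode (p + 1) (k l'))) * c i
        = gradAt d p (p + 1) y l (finFunctionFinEquiv k) := by
      intro k
      refine (Fintype.sum_of_injective _ hinj _ _ (fun i hi => ?_) fun j => ?_).symm
      · rw [hc0 i hi]; ring
      · rw [hc, partialD_phi]
        simp [quadNode]
    rw [h1] at h
    simp only [h2] at h
    rw [sum_quad_eq]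
    simpa only [quadWeight_finFunctionFinEquiv] using h
  calc ∑ j, y j ^ 2
      ≤ ∑ j, ∑ l, (if (modeIndex d p j l : ℕ) = 0 then 0 else 1) * y j ^ 2 := by
        refine Finset.sum_le_sum fun j _ => ?_
        obtain ⟨l, hl⟩ := exists_modeIndex_ne_zero j
        refine le_trans (le_of_eq ?_) (Finset.single_le_sum (fun l _ => ?_) (Finset.mem_univ l))
        · rw [if_neg hl, one_mul]
        · split_ifs
          · rw [zero_mul]
          · rw [one_mul]; exact sq_nonneg _
    _ = ∑ l, ∑ j, (if (modeIndex d p j l : ℕ) = 0 then 0 else 1) * y j ^ 2 := Finset.sum_comm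
    _ ≤ ∑ l, (12 * (p : ℝ) ^ 2) ^ d *
          ∑ k, quadWeight d (p + 1) k * gradAt d p (p + 1) y l k ^ 2 :=
        Finset.sum_le_sum fun l _ => hl l
    _ = _ := by
        rw [← Finset.mul_sum, Finset.sum_comm]
        simp only [Finset.mul_sum]

theorem sum_quadWeight_mul_partialD_sq_le {d p : ℕ} (hp : 2 ≤ p) (l : Fin d) (j : Fin (nb d p)) :
    ∑ k, quadWeight d (p + 1) k * partialD l (phi d p j) (quadNode d (p + 1) k) ^ 2 ≤
      (16 * (p : ℝ) ^ 2) ^ d := by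
  have hgl := isGaussLobatto_gl (p + 1) (by omega)
  let P : Fin d → ℝ[X] := fun l' => if l' = l then Polynomial.derivative
      (phi1d (modeIndex d p j l')) else phi1d (modeIndex d p j l')
  have h1 : ∑ k, quadWeight d (p + 1) k * partialD l (phi d p j) (quadNode d (p + 1) k) ^ 2 =
      ∏ l', ∑ k, glWeight (p + 1) k * (P l').eval (glNode (p + 1) k) ^ 2 := by
    rw [sum_quad_eq, Finset.prod_univ_sum, Fintype.piFinset_univ]
    refine Finset.sum_congr rfl fun k _ => ?_
    rw [quadWeight_finFunctionFinEquiv, partialD_phi, Finset.prod_mul_distrib, Finset.prod_pow]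
    simp [quadNode, P]
  rw [h1]
  refine (Finset.prod_le_prod (fun l' _ => ?_) fun l' _ => ?_).trans_eq
    (by simp : ∏ _l' : Fin d, 16 * (p : ℝ) ^ 2 = (16 * (p : ℝ) ^ 2) ^ d)
  · exact Finset.sum_nonneg fun k _ => mul_nonneg (hgl.weight_pos (by omega) k).le (sq_nonneg _)
  · simp only [P]
    split_ifs
    · exact hgl.quad_derivative_phi1d_sq_le hp (Fin.isLt _)
    · exact hgl.quad_phi1d_sq_le hp (Fin.isLt _)

/-- A crude Cauchy-Schwarz bound that loses a factor `n_b`; any polynomial dependence on `n_b` is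
good enough, since only its logarithm enters the complexity. -/
theorem sum_quadWeight_mul_gradAt_sq_le {d p : ℕ} (hp : 2 ≤ p) (y : Fin (nb d p) → ℝ) :
    ∑ k, quadWeight d (p + 1) k * ∑ l, gradAt d p (p + 1) y l k ^ 2 ≤
      d * nb d p * (16 * (p : ℝ) ^ 2) ^ d * ∑ j, y j ^ 2 := by
  have h1 : ∀ k l, gradAt d p (p + 1) y l k ^ 2 ≤
      (∑ j, partialD l (phi d p j) (quadNode d (p + 1) k) ^ 2) * ∑ j, y j ^ 2 := fun k l =>
    Finset.sum_mul_sq_le_sq_mul_sq _ _ _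
  calc _ ≤ ∑ k, quadWeight d (p + 1) k *
        ∑ l, (∑ j, partialD l (phi d p j) (quadNode d (p + 1) k) ^ 2) * ∑ j, y j ^ 2 :=
        Finset.sum_le_sum fun k _ => mul_le_mul_of_nonneg_left
          (Finset.sum_le_sum fun l _ => h1 k l) (quadWeight_pos (by omega) k).le
    _ = (∑ l : Fin d, ∑ j, ∑ k, quadWeight d (p + 1) k *
          partialD l (phi d p j) (quadNode d (p + 1) k) ^ 2) * ∑ j, y j ^ 2 := by
        simp only [← Finset.sum_mul, ← mul_assoc]
        congr 1
        simp only [Finset.mul_sum]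
        rw [Finset.sum_comm]
        refine Finset.sum_congr rfl fun l _ => Finset.sum_comm
    _ ≤ (∑ _l : Fin d, ∑ _j : Fin (nb d p), (16 * (p : ℝ) ^ 2) ^ d) * ∑ j, y j ^ 2 := by
        refine mul_le_mul_of_nonneg_right ?_ (Finset.sum_nonneg fun j _ => sq_nonneg _)
        exact Finset.sum_le_sum fun l _ => Finset.sum_le_sum fun j _ =>
          sum_quadWeight_mul_partialD_sq_le hp l j
    _ = _ := by
        simp only [Finset.sum_const, Finset.card_univ, Fintype.card_fin, nsmul_eq_mul]
        ring

/-! ## The Galerkin matrices -/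

theorem galerkin_mulVec_dotProduct (d p q : ℕ) (a : (Fin d → ℝ) → ℝ) (y : Fin (nb d p) → ℝ) :
    y ⬝ᵥ (galerkin d p q a).mulVec y =
      ∑ k, quadWeight d q k * a (quadNode d q k) * ∑ l, gradAt d p q y l k ^ 2 := by
  have h : ∀ k l, gradAt d p q y l k ^ 2 = ∑ i, ∑ j, y i * ((partialD l (phi d p j)
      (quadNode d q k) * partialD l (phi d p i) (quadNode d q k)) * y j) := by
    intro k l
    rw [sq, gradAt, Finset.sum_mul_sum]
    refine Finset.sum_congr rfl fun i _ => Finset.sum_congr rfl fun j _ => ?_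
    ring
  simp only [h, dotProduct, Matrix.mulVec, galerkin, Matrix.of_apply, quadForm, Finset.mul_sum,
    Finset.sum_mul]
  rw [Finset.sum_comm]
  rw [Finset.sum_congr rfl fun j _ => Finset.sum_comm]
  rw [Finset.sum_comm]
  refine Finset.sum_congr rfl fun k _ => ?_
  rw [Finset.sum_congr rfl fun j _ => Finset.sum_comm]
  rw [Finset.sum_comm]
  refine Finset.sum_congr rfl fun l _ => ?_
  rw [Finset.sum_comm]
  refine Finset.sum_congr rfl fun i _ => Finset.sum_congr rfl fun j _ => ?_
  ring

theorem galerkin_isSymm (d p q : ℕ) (a : (Fin d → ℝ) → ℝ) : (galerkin d p q a).IsSymm := by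
  ext i j
  simp only [galerkin, Matrix.transpose_apply, Matrix.of_apply, quadForm]
  refine Finset.sum_congr rfl fun k _ => ?_
  congr 1
  exact Finset.sum_congr rfl fun l _ => mul_comm _ _

/-! ## Contractions in the energy norm -/

section
variable {n : ℕ} {S A : Matrix (Fin n) (Fin n) ℝ}

theorem Matrix.IsSymm.dotProduct_mulVec_comm (hS : S.IsSymm) (x y : Fin n → ℝ) :
    x ⬝ᵥ S.mulVec y = y ⬝ᵥ S.mulVec x := by
  rw [Matrix.dotProduct_mulVec, ← Matrix.mulVec_transpose, hS, dotProduct_comm]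

theorem isUnit_of_sum_sq_le {Λ : ℝ} (h : ∀ y, ∑ i, y i ^ 2 ≤ Λ * (y ⬝ᵥ S.mulVec y)) :
    IsUnit S := by
  rw [← Matrix.mulVec_injective_iff_isUnit]
  refine (injective_iff_map_eq_zero S.mulVecLin).mpr fun y hy => ?_
  have h1 := h y
  rw [Matrix.mulVecLin_apply] at hy
  rw [hy, dotProduct_zero, mul_zero] at h1
  have h2 := (Finset.sum_eq_zero_iff_of_nonneg fun i _ => sq_nonneg (y i)).mp
    (le_antisymm h1 (Finset.sum_nonneg fun i _ => sq_nonneg _))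
  ext i
  simpa using h2 i (Finset.mem_univ i)

/-- With `E = 1 - α S⁻¹ A`, the matrix `S E = T` is symmetric, so `E` is self-adjoint in the energy
inner product and a bound of its quadratic form bounds its operator norm. -/
theorem energy_contraction (hS : S.IsSymm) (hA : A.IsSymm) (hu : IsUnit S) {α ρ : ℝ} (hρ : 0 < ρ)
    (h : ∀ y, |y ⬝ᵥ (S - α • A).mulVec y| ≤ ρ * (y ⬝ᵥ S.mulVec y)) (y : Fin n → ℝ) :
    (1 - α • (S⁻¹ * A)).mulVec y ⬝ᵥ S.mulVec ((1 - α • (S⁻¹ * A)).mulVec y) ≤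
      ρ ^ 2 * (y ⬝ᵥ S.mulVec y) := by
  have hdet := (Matrix.isUnit_iff_isUnit_det S).mp hu
  set T := S - α • A with hT
  have hTs : T.IsSymm := hS.sub (hA.smul α)
  have hST : S * (1 - α • (S⁻¹ * A)) = T := by
    rw [mul_sub, mul_one, mul_smul_comm, Matrix.mul_nonsing_inv_cancel_left _ _ hdet]
  set z := (1 - α • (S⁻¹ * A)).mulVec y with hz
  have hSz : S.mulVec z = T.mulVec y := by rw [hz, Matrix.mulVec_mulVec, hST]
  -- Polarization: subtracting the bounds for `ρ y ± z` and using `z · T y = z · S z` gives `4 z·Sz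
  -- ≤ 2ρ² y·Sy + 2 z·Sz`.
  have h1 := (abs_le.mp (h (ρ • y + z))).2
  have h2 := (abs_le.mp (h (ρ • y - z))).1
  have hTc := hTs.dotProduct_mulVec_comm z y
  have hSc := hS.dotProduct_mulVec_comm z y
  rw [hSz] at hSc
  simp only [Matrix.mulVec_add, Matrix.mulVec_sub, Matrix.mulVec_smul, add_dotProduct,
    sub_dotProduct, dotProduct_add, dotProduct_sub, smul_dotProduct, dotProduct_smul, smul_eq_mul,
    hSz] at h1 h2 ⊢
  rw [← hTc] at h1 h2
  have h3 : ρ * (2 * (z ⬝ᵥ T.mulVec y)) ≤ ρ * (2 * (ρ ^ 2 * (y ⬝ᵥ S.mulVec y))) := by linarith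
  linarith [le_of_mul_le_mul_left h3 hρ]

/-- All `k` contractions take place in the energy norm, and the passage to the Euclidean norm is
paid once, so `M` does not depend on `k`. -/
theorem norm_pow_le_of_energy_contraction (hS : S.IsSymm) (hA : A.IsSymm) {α ρ Λ₁ Λ₂ M : ℝ}
    (hρ : 0 < ρ) (hΛ₁ : 0 ≤ Λ₁) (hM : 0 ≤ M) (hMΛ : Λ₁ * Λ₂ ≤ M ^ 2)
    (h₁ : ∀ y, ∑ i, y i ^ 2 ≤ Λ₁ * (y ⬝ᵥ S.mulVec y))
    (h₂ : ∀ y, y ⬝ᵥ S.mulVec y ≤ Λ₂ * ∑ i, y i ^ 2)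
    (h : ∀ y, |y ⬝ᵥ (S - α • A).mulVec y| ≤ ρ * (y ⬝ᵥ S.mulVec y)) (k : ℕ) :
    ‖(1 - α • (S⁻¹ * A)) ^ k‖ ≤ M * ρ ^ k := by
  have hu := isUnit_of_sum_sq_le h₁
  have hk : ∀ (k : ℕ) (y : Fin n → ℝ), ((1 - α • (S⁻¹ * A)) ^ k).mulVec y ⬝ᵥ
      S.mulVec (((1 - α • (S⁻¹ * A)) ^ k).mulVec y) ≤ ρ ^ (2 * k) * (y ⬝ᵥ S.mulVec y) := by
    intro k
    induction k with
    | zero => intro y; simp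
    | succ k ih =>
      intro y
      rw [pow_succ', ← Matrix.mulVec_mulVec]
      refine (energy_contraction hS hA hu hρ h _).trans ?_
      calc _ ≤ ρ ^ 2 * (ρ ^ (2 * k) * (y ⬝ᵥ S.mulVec y)) :=
            mul_le_mul_of_nonneg_left (ih y) (by positivity)
        _ = _ := by ring
  refine norm_le_of_sum_sq_mulVec_le _ (by positivity) fun y => ?_
  have hy : 0 ≤ ∑ i, y i ^ 2 := Finset.sum_nonneg fun i _ => sq_nonneg _
  calc _ ≤ Λ₁ * (ρ ^ (2 * k) * (y ⬝ᵥ S.mulVec y)) :=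
        (h₁ _).trans (mul_le_mul_of_nonneg_left (hk k y) hΛ₁)
    _ ≤ Λ₁ * (ρ ^ (2 * k) * (Λ₂ * ∑ i, y i ^ 2)) := by
        have := h₂ y
        gcongr
    _ = (Λ₁ * Λ₂) * (ρ ^ (2 * k) * ∑ i, y i ^ 2) := by ring
    _ ≤ M ^ 2 * (ρ ^ (2 * k) * ∑ i, y i ^ 2) := by gcongr
    _ = _ := by ring

end

/-! ### Geometric decay of the powers for the Galerkin matrices -/

theorem nb_pos {d p : ℕ} (hd : 1 ≤ d) (hp : 2 ≤ p) : 1 ≤ nb d p := by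
  have : p ^ 1 ≤ p ^ d := Nat.pow_le_pow_right (by omega) hd
  rw [pow_one] at this
  unfold nb
  omega

theorem pow_le_two_mul_nb {d p : ℕ} (hd : 1 ≤ d) (hp : 2 ≤ p) : p ^ d ≤ 2 * nb d p := by
  have := nb_pos hd hp
  unfold nb at *
  omega

/-- The powers of `1 - α Ã^a` decay geometrically in the spectral norm, up to a factor that is
polynomial in the number of basis functions. -/
theorem norm_pow_one_sub_precGalerkin_le {d p : ℕ} (hd : 1 ≤ d) (hp : 2 ≤ p) {α ρ : ℝ}
    (hρ : 0 < ρ) (a : (Fin d → ℝ) → ℝ)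
    (ha : ∀ k, |1 - α * a (quadNode d (p + 1) k)| ≤ ρ) (k : ℕ) :
    ‖(1 - α • precGalerkin d p (p + 1) a) ^ k‖ ≤
      (16 * d * 192 ^ d : ℝ) * (nb d p : ℝ) ^ 5 * ρ ^ k := by
  have hn : (1 : ℝ) ≤ nb d p := by exact_mod_cast nb_pos hd hp
  have hd' : (1 : ℝ) ≤ d := by exact_mod_cast hd
  have hS : ∀ y : Fin (nb d p) → ℝ, y ⬝ᵥ (galerkin d p (p + 1) fun _ => 1).mulVec y =
      ∑ k, quadWeight d (p + 1) k * ∑ l, gradAt d p (p + 1) y l k ^ 2 := by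
    intro y
    rw [galerkin_mulVec_dotProduct]
    simp
  refine norm_pow_le_of_energy_contraction (galerkin_isSymm _ _ _ _) (galerkin_isSymm _ _ _ _) hρ
    (Λ₁ := (12 * (p : ℝ) ^ 2) ^ d) (Λ₂ := d * nb d p * (16 * (p : ℝ) ^ 2) ^ d)
    (by positivity) (by positivity) ?_ (fun y => ?_) (fun y => ?_) (fun y => ?_) k
  -- `Λ₁ Λ₂ = d n_b 192^d p^(4d)`, and `p^d ≤ 2 n_b` yields `16 d 192^d n_b^5`. This number is at
  -- least 1, so it may replace its own square root as the factor `M`.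
  · have h1 : (12 * (p : ℝ) ^ 2) ^ d * (d * nb d p * (16 * (p : ℝ) ^ 2) ^ d) =
        d * nb d p * 192 ^ d * ((p : ℝ) ^ d) ^ 4 := by
      have : (192 : ℝ) = 12 * 16 := by norm_num
      rw [this, mul_pow, mul_pow, mul_pow]
      ring
    have h2 : (p : ℝ) ^ d ≤ 2 * nb d p := by exact_mod_cast pow_le_two_mul_nb hd hp
    rw [h1]
    calc _ ≤ d * nb d p * 192 ^ d * (2 * (nb d p : ℝ)) ^ 4 := by gcongr
      _ = (16 * d * 192 ^ d : ℝ) * (nb d p : ℝ) ^ 5 := by ring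
      _ ≤ _ := by
        refine le_self_pow₀ ?_ two_ne_zero
        have h3 : (1 : ℝ) ≤ 192 ^ d := one_le_pow₀ (by norm_num)
        refine one_le_mul_of_one_le_of_one_le (one_le_mul_of_one_le_of_one_le (by linarith) h3)
          (one_le_pow₀ hn)
  · rw [hS]
    exact sum_sq_le_sum_quadWeight_mul_gradAt_sq hp y
  · rw [hS]
    exact sum_quadWeight_mul_gradAt_sq_le hp y
  · rw [Matrix.sub_mulVec, dotProduct_sub, Matrix.smul_mulVec, dotProduct_smul, hS,
      galerkin_mulVec_dotProduct, smul_eq_mul, Finset.mul_sum, Finset.mul_sum,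
      ← Finset.sum_sub_distrib]
    refine (Finset.abs_sum_le_sum_abs _ _).trans (Finset.sum_le_sum fun k _ => ?_)
    have h0 : 0 ≤ quadWeight d (p + 1) k * ∑ l, gradAt d p (p + 1) y l k ^ 2 :=
      mul_nonneg (quadWeight_pos (by omega) k).le (Finset.sum_nonneg fun l _ => sq_nonneg _)
    have h1 : ∀ g w b : ℝ, w * g - α * (w * b * g) = (1 - α * b) * (w * g) := by intros; ring
    rw [h1, abs_mul, abs_of_nonneg h0]
    exact mul_le_mul_of_nonneg_right (ha k) h0

/-! ## The input network -/

theorem idKron_mulVec_vecM {n : ℕ} (M X : Matrix (Fin n) (Fin n) ℝ) :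
    (idKron M).mulVec (vecM X) = vecM (M * X) := by
  have hX : vecM X = (fun r : Fin n × Fin n => X r.2 r.1) ∘ finProdFinEquiv.symm := rfl
  rw [idKron, hX, reindex_mulVec]
  ext r
  simp only [Function.comp_apply, vecM, Matrix.mul_apply, Matrix.mulVec, dotProduct,
    Fintype.sum_prod_type, Matrix.kroneckerMap_apply, Matrix.one_apply, ite_mul, one_mul, zero_mul]
  rw [Finset.sum_comm]
  simp

theorem nnzMat_idKron_le {n : ℕ} (M : Matrix (Fin n) (Fin n) ℝ) : nnzMat (idKron M) ≤ n ^ 3 := by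
  rw [idKron, nnzMat_reindex]
  refine (nnzM_le_of_row _ n (fun r => {r.1} ×ˢ Finset.univ) (fun r => by simp)
    fun r c hrc => ?_).trans ?_
  · rw [Matrix.kroneckerMap_apply] at hrc
    have h1 := left_ne_zero_of_mul hrc
    have : r.1 = c.1 := by
      by_contra h
      exact h1 (Matrix.one_apply_ne h)
    simp [this]
  · simp only [Fintype.card_prod, Fintype.card_fin]
    exact le_of_eq (by ring)

theorem realize_inputNet (d p q : ℕ) (α : ℝ) (a : (Fin d → ℝ) → ℝ) :
    (inputNet d p q α).realize (nodalValues d q a) = vecM (-α • galerkin d p q a) := by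
  ext r
  simp only [inputNet, NN.realize, Pi.add_apply, Pi.zero_apply, add_zero, Matrix.mulVec,
    dotProduct, Matrix.of_apply, vecM, nodeMatrix, galerkin, quadForm, nodalValues,
    Matrix.smul_apply, smul_eq_mul, Finset.mul_sum, Finset.sum_mul]
  refine Finset.sum_congr rfl fun k _ => Finset.sum_congr rfl fun l _ => ?_
  ring

theorem realize_precInputNet (d p q : ℕ) (α : ℝ) (a : (Fin d → ℝ) → ℝ) :
    (precInputNet d p q α).realize (nodalValues d q a) = vecM (1 - α • precGalerkin d p q a) := by
  rw [precInputNet, NN.realize_sparseConcat, realize_inputNet, NN.realize, idKron_mulVec_vecM,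
    precGalerkin]
  ext r
  simp only [Pi.add_apply, vecM, Matrix.sub_apply, Matrix.smul_apply, Matrix.mul_smul, smul_eq_mul]
  ring

theorem depth_precInputNet (d p q : ℕ) (α : ℝ) : (precInputNet d p q α).depth = 2 := by
  rw [precInputNet, NN.depth_sparseConcat]
  rfl

theorem size_precInputNet_le (d p q : ℕ) (α : ℝ) :
    (precInputNet d p q α).size ≤ 2 * (nb d p ^ 3 + nb d p ^ 2 + nb d p ^ 2 * q ^ d) := by
  refine (NN.size_sparseConcat _ _).trans ?_
  have h1 := nnzMat_idKron_le (galerkin d p q fun _ => 1)⁻¹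
  have h2 : nnzVec (vecM (1 : Matrix (Fin (nb d p)) (Fin (nb d p)) ℝ)) ≤ nb d p ^ 2 := by
    refine (Finset.card_le_univ _).trans ?_
    rw [Fintype.card_fin, sq]
  have h3 : (inputNet d p q α).size ≤ nb d p ^ 2 * q ^ d := by
    rw [inputNet, NN.size, nnzVec_zero, add_zero]
    refine (Finset.card_le_univ _).trans ?_
    simp [sq]
  simp only [NN.size]
  omega

theorem posWidths_precInputNet {d p : ℕ} (q : ℕ) (hn : 1 ≤ nb d p) (α : ℝ) :
    (precInputNet d p q α).PosWidths := by
  have : 0 < nb d p * nb d p := Nat.mul_pos hn hn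
  exact NN.posWidths_sparseConcat _ _ this this

/-! ## The full network -/

theorem matM_smul {n : ℕ} (c : ℝ) (v : Fin (n * n) → ℝ) : matM (c • v) = c • matM v := rfl

theorem realize_fullNet (d p q : ℕ) (α : ℝ) (Ψ : NN (nb d p * nb d p) (nb d p * nb d p))
    (a : (Fin d → ℝ) → ℝ) :
    matM ((fullNet d p q α Ψ).realize (nodalValues d q a)) =
      α • matM (Ψ.realize (vecM (1 - α • precGalerkin d p q a))) := by
  rw [fullNet, NN.realize_concat, NN.realize_sparseConcat, realize_precInputNet, NN.realize,
    add_zero, Matrix.smul_mulVec, Matrix.one_mulVec, matM_smul]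

theorem depth_fullNet (d p q : ℕ) (α : ℝ) (Ψ : NN (nb d p * nb d p) (nb d p * nb d p)) :
    (fullNet d p q α Ψ).depth = Ψ.depth + 2 := by
  have h := NN.depth_concat (NN.sparseConcat Ψ (precInputNet d p q α)) (NN.last
    (α • (1 : Matrix (Fin (nb d p * nb d p)) (Fin (nb d p * nb d p)) ℝ)) 0)
  rw [NN.depth_sparseConcat, depth_precInputNet, NN.depth] at h
  rw [fullNet]
  omega

/-- The input layer has at most `n_b² n_q` weights, and `n_q = (p+1)^d ≤ (2p)^d` is at most `2^(d+1)
n_b`; hence it fits into the cubic bound. -/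
theorem size_fullNet_le {d p : ℕ} (hd : 1 ≤ d) (hp : 2 ≤ p) (α : ℝ)
    (Ψ : NN (nb d p * nb d p) (nb d p * nb d p)) :
    (fullNet d p (p + 1) α Ψ).size ≤ 2 * Ψ.size + (8 + 8 * 2 ^ d) * nb d p ^ 3 := by
  have h1 := (NN.size_concat_smul α (NN.sparseConcat Ψ (precInputNet d p (p + 1) α))).trans
    (NN.size_sparseConcat _ _)
  have h2 := size_precInputNet_le d p (p + 1) α
  have hq : (p + 1) ^ d ≤ 2 ^ d * (2 * nb d p) := by
    calc (p + 1) ^ d ≤ (2 * p) ^ d := Nat.pow_le_pow_left (by omega) d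
      _ = 2 ^ d * p ^ d := mul_pow _ _ _
      _ ≤ _ := Nat.mul_le_mul_left _ (pow_le_two_mul_nb hd hp)
  have h3 : nb d p ^ 2 ≤ nb d p ^ 3 := Nat.pow_le_pow_right (nb_pos hd hp) (by norm_num)
  have h4 : nb d p ^ 2 * (p + 1) ^ d ≤ 2 * (2 ^ d * nb d p ^ 3) := by
    calc _ ≤ nb d p ^ 2 * (2 ^ d * (2 * nb d p)) := Nat.mul_le_mul_left _ hq
      _ = _ := by ring
  have h5 : (8 + 8 * 2 ^ d) * nb d p ^ 3 = 8 * nb d p ^ 3 + 8 * (2 ^ d * nb d p ^ 3) := by ring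
  rw [h5]
  change (NN.concat _ _).size ≤ _
  omega

theorem posWidths_fullNet {d p : ℕ} (q : ℕ) (hn : 1 ≤ nb d p) (α : ℝ)
    {Ψ : NN (nb d p * nb d p) (nb d p * nb d p)} (hΨ : Ψ.PosWidths) :
    (fullNet d p q α Ψ).PosWidths := by
  refine NN.posWidths_concat _ _ ?_ (NN.posWidths_sparseConcat _ _ hΨ
    (posWidths_precInputNet q hn α))
  exact Nat.mul_pos hn hn

/-- Bounds of a coefficient on the open cube extend to the closed cube. -/
theorem bounds_on_Icc {d : ℕ} {a : (Fin d → ℝ) → ℝ} (ha : Continuous a) {amin amax : ℝ}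
    (h : ∀ x ∈ Set.pi Set.univ fun _ : Fin d => Set.Ioo (0 : ℝ) 1, amin ≤ a x ∧ a x ≤ amax)
    {x : Fin d → ℝ} (hx : ∀ l, x l ∈ Set.Icc (0 : ℝ) 1) : amin ≤ a x ∧ a x ≤ amax := by
  -- Gauss-Lobatto nodes may lie on the boundary of the cube, so the bounds must be extended by
  -- continuity.
  have hcl : x ∈ closure (Set.pi Set.univ fun _ : Fin d => Set.Ioo (0 : ℝ) 1) := by
    rw [closure_pi_set, closure_Ioo zero_ne_one]
    exact fun l _ => hx l
  exact (isClosed_Icc (a := amin) (b := amax)).closure_subset_iff.mpr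
    (Set.image_subset_iff.mpr fun y hy => h y hy)
    (image_closure_subset_closure_image ha ⟨x, hcl, rfl⟩)

theorem isUnit_of_isUnit_smul {n : ℕ} {α : ℝ} (hα : α ≠ 0) {M : Matrix (Fin n) (Fin n) ℝ}
    (h : IsUnit (α • M)) : IsUnit M := by
  have : M = α⁻¹ • (α • M) := by rw [smul_smul, inv_mul_cancel₀ hα, one_smul]
  rw [this]
  exact h.smul (Units.mk0 α⁻¹ (inv_ne_zero hα))

theorem proposition5p4 (d : ℕ) (hd : 1 ≤ d) (amin amax : ℝ) (hamin : 0 < amin) (hamax : 0 < amax) :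
    ∃ Cinv : ℝ, 0 < Cinv ∧
      ∀ (AD : ℝ) (_hAD : 0 < AD) (D : Set ((Fin d → ℝ) → ℝ)) (_hHol : D ⊆ Hol d AD)
        (_hbd : ∀ a ∈ D, ∀ x ∈ Set.pi Set.univ fun _ : Fin d => Set.Ioo (0 : ℝ) 1,
          amin ≤ a x ∧ a x ≤ amax)
        (Ccoer Ccont α δ : ℝ) (_hCcoer : Ccoer = min amin 1) (_hCcont : Ccont = max amax 1)
        (_hα : α = 1 / (Ccoer + Ccont)) (_hδ : δ = α * Ccoer)
        (p : ℕ) (_hp : 2 ≤ p) (ε : ℝ) (_hε : 0 < ε) (_hε1 : ε < 1),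
        ∃ Ψ : NN (nb d p * nb d p) (nb d p * nb d p),
          IsInversionNet (nb d p) δ (ε / α) Ψ ∧
          (fullNet d p (p + 1) α Ψ).PosWidths ∧
          (∀ a ∈ D, IsUnit (precGalerkin d p (p + 1) a) ∧
            ‖(precGalerkin d p (p + 1) a)⁻¹ -
              matM ((fullNet d p (p + 1) α Ψ).realize (nodalValues d (p + 1) a))‖ ≤ ε) ∧
          ((fullNet d p (p + 1) α Ψ).depth : ℝ) ≤
            Cinv * (1 + Real.log (1 + |Real.log ε|) + Real.log (nb d p)) *
              (1 + |Real.log ε| + Real.log (nb d p) + Real.log (1 + |Real.log ε|)) ∧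
          ((fullNet d p (p + 1) α Ψ).size : ℝ) ≤
            Cinv * (nb d p : ℝ) ^ 3 * (1 + |Real.log ε|) *
              (1 + Real.log (1 + |Real.log ε|) + Real.log (nb d p)) ^ 2 *
              (1 + |Real.log ε| + Real.log (nb d p) + Real.log (1 + |Real.log ε|)) := by
  have hc0 : 0 < min amin 1 := lt_min hamin one_pos
  have hc1 : min amin 1 ≤ 1 := min_le_right _ _
  have hC1 : 1 ≤ max amax 1 := le_max_right _ _
  set c := min amin 1 with hc
  set K := max amax 1 with hK
  have hcK : 0 < c + K := by linarith
  have hα0 : 0 < 1 / (c + K) := by positivity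
  have hα1 : 1 / (c + K) ≤ 1 := by rw [div_le_one hcK]; linarith
  -- This identity is the reason for the choice of `α`: it turns `αc ≤ αa ≤ αK` into `αc ≤ 1 - αa ≤
  -- 1 - αc`.
  have hsum : 1 / (c + K) * c + 1 / (c + K) * K = 1 := by field_simp
  set α₀ := 1 / (c + K) with hα₀
  have hδ0 : 0 < α₀ * c := by positivity
  have hδ1 : 0 < α₀ * K := by positivity
  have hd' : (1 : ℝ) ≤ d := by exact_mod_cast hd
  have hC₀ : (1 : ℝ) ≤ 16 * d * 192 ^ d :=
    one_le_mul_of_one_le_of_one_le (by linarith) (one_le_pow₀ (by norm_num))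
  obtain ⟨C, hC, hnet⟩ := exists_inversion_net 5 hC₀ (by linarith : 0 < 1 - α₀ * c)
    (by linarith)
  refine ⟨2 * C + (8 + 8 * 2 ^ d), by positivity, ?_⟩
  rintro AD - D hHol hbd Ccoer Ccont α δ rfl rfl rfl rfl p hp ε hε0 hε1
  have hn := nb_pos hd hp
  have hn' : (1 : ℝ) ≤ nb d p := by exact_mod_cast hn
  obtain ⟨Ψ, hΨpos, hΨ, hdepth, hsize⟩ := hnet (nb d p) ε hn hε0 hε1
  have hlogn := Real.log_nonneg hn'
  have hE1 : 1 ≤ 1 + |Real.log ε| := by linarith [abs_nonneg (Real.log ε)]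
  have hlE := Real.log_nonneg hE1
  have hMn : (1 : ℝ) ≤ 16 * d * 192 ^ d * (nb d p : ℝ) ^ 5 :=
    one_le_mul_of_one_le_of_one_le hC₀ (one_le_pow₀ hn')
  refine ⟨Ψ, fun B hB => ?_, posWidths_fullNet _ hn _ hΨpos, fun a haD => ?_, ?_, ?_⟩
  -- On the spectral ball the powers satisfy the decay hypothesis trivially, because `C₀ n_b^5 ≥ 1`.
  -- The network is built for accuracy `ε`, which is at least as good as `ε / α` since `α ≤ 1`.
  · have hε' : ε ≤ ε / α₀ := by
      rw [le_div_iff₀ hα0]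
      exact mul_le_of_le_one_right hε0.le hα1
    refine (hΨ B fun k => ?_).trans hε'
    have h1 : ‖B ^ k‖ ≤ (1 - α₀ * c) ^ k := by
      rcases Nat.eq_zero_or_pos k with rfl | hk
      · simpa using norm_matrix_one_le
      · exact (norm_pow_le' B hk).trans (pow_le_pow_left₀ (norm_nonneg _) hB k)
    refine h1.trans (le_mul_of_one_le_left (pow_nonneg (by linarith) k) hMn)
  · have hcont : Continuous a := (hHol haD).1.continuous
    have hnode : ∀ k, |1 - α₀ * a (quadNode d (p + 1) k)| ≤ 1 - α₀ * c := by
      intro k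
      obtain ⟨h1, h2⟩ := bounds_on_Icc hcont (hbd a haD) (x := quadNode d (p + 1) k)
        fun l => (isGaussLobatto_gl (p + 1) (by omega)).mem_Icc _
      have h3 : α₀ * c ≤ α₀ * a (quadNode d (p + 1) k) :=
        mul_le_mul_of_nonneg_left ((min_le_left _ _).trans h1) hα0.le
      have h4 : α₀ * a (quadNode d (p + 1) k) ≤ α₀ * K :=
        mul_le_mul_of_nonneg_left (h2.trans (le_max_left _ _)) hα0.le
      exact abs_le.mpr ⟨by linarith, by linarith⟩
    have hpow := norm_pow_one_sub_precGalerkin_le hd hp (by linarith : 0 < 1 - α₀ * c) a hnode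
    -- Only the invertibility is used, so the truncation index is irrelevant.
    have hu := (isUnit_one_sub_and_norm_inv_sub_le _ (by linarith : 0 ≤ 1 - α₀ * c)
      (by linarith) hpow 0).1
    rw [sub_sub_cancel] at hu
    have hu' := isUnit_of_isUnit_smul hα0.ne' hu
    refine ⟨hu', ?_⟩
    have h1 := hΨ _ hpow
    rw [sub_sub_cancel] at h1
    have h2 : (precGalerkin d p (p + 1) a)⁻¹ = α₀ • (α₀ • precGalerkin d p (p + 1) a)⁻¹ := by
      have hdet := (Matrix.isUnit_iff_isUnit_det _).mp hu'
      refine Matrix.inv_eq_left_inv ?_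
      rw [smul_mul_assoc, ← mul_smul_comm]
      exact Matrix.nonsing_inv_mul _ ((Matrix.isUnit_iff_isUnit_det _).mp hu)
    rw [realize_fullNet, h2, ← smul_sub, norm_smul, Real.norm_of_nonneg hα0.le]
    calc _ ≤ α₀ * ε := mul_le_mul_of_nonneg_left h1 hα0.le
      _ ≤ ε := mul_le_of_le_one_left hε0.le hα1
  · rw [depth_fullNet]
    set G := 1 + Real.log (1 + |Real.log ε|) + Real.log (nb d p)
    set H := 1 + |Real.log ε| + Real.log (nb d p) + Real.log (1 + |Real.log ε|)
    have hG : 1 ≤ G := by simp only [G]; linarith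
    have hH : 1 ≤ H := by simp only [H]; linarith
    have hGH : 1 ≤ G * H := one_le_mul_of_one_le_of_one_le hG hH
    have h2d : (0 : ℝ) ≤ 8 * 2 ^ d := by positivity
    push_cast
    calc (Ψ.depth : ℝ) + 2 ≤ C * G * H + 2 := by linarith
      _ ≤ C * (G * H) + 2 * (G * H) := by linarith
      _ = (C + 2) * (G * H) := by ring
      _ ≤ (2 * C + (8 + 8 * 2 ^ d)) * (G * H) :=
        mul_le_mul_of_nonneg_right (by linarith) (by positivity)
      _ = _ := by ring
  · set E := 1 + |Real.log ε|
    set G := 1 + Real.log E + Real.log (nb d p)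
    set H := E + Real.log (nb d p) + Real.log E
    have hG : 1 ≤ G := by simp only [G]; linarith
    have hH : 1 ≤ H := by simp only [H]; linarith
    have hEGH : 1 ≤ E * G ^ 2 * H :=
      one_le_mul_of_one_le_of_one_le (one_le_mul_of_one_le_of_one_le hE1 (one_le_pow₀ hG)) hH
    have hfull : ((fullNet d p (p + 1) α₀ Ψ).size : ℝ) ≤
        2 * Ψ.size + (8 + 8 * 2 ^ d) * (nb d p : ℝ) ^ 3 := by
      exact_mod_cast size_fullNet_le hd hp α₀ Ψ
    calc _ ≤ 2 * (C * (nb d p : ℝ) ^ 3 * E * G ^ 2 * H) + (8 + 8 * 2 ^ d) * (nb d p : ℝ) ^ 3 := by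
          linarith
      _ ≤ 2 * (C * (nb d p : ℝ) ^ 3 * E * G ^ 2 * H) +
          (8 + 8 * 2 ^ d) * (nb d p : ℝ) ^ 3 * (E * G ^ 2 * H) := by
          have := le_mul_of_one_le_right
            (by positivity : 0 ≤ (8 + 8 * 2 ^ d) * (nb d p : ℝ) ^ 3) hEGH
          linarith
      _ = _ := by ring

end
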